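/- Conventions. Let $X=(X,d,\mu)$ be a metric measure space: $(X,d)$ is a proper metric space and $\mu$ a Borel measure for which all balls have positive finite measure. Let $Y$ be a proper metric space and $p\ge 1$. Curves are continuous maps $\gamma:[0,1]\to X$, with length $\ell(\gamma)$; $\int_\gamma g$ is the integral of $g$ with respect to arc length if $\gamma$ is rectifiable, and $\infty$ otherwise. A Borel function $g:X\to[0,\infty]$ is an upper gradient of $u$ if $d(u(\gamma(0)),u(\gamma(1)))\le\int_\gamma g$ for every curve $\gamma$. The $p$-modulus of a curve family $\Gamma$ is $\operatorname{Mod}_p(\Gamma)=\inf\int_X\rho^p\,d\mu$, the infimum over Borel $\rho:X\to[0,\infty]$ with $\int_\gamma\rho\ge1$ for all $\gamma\in\Gamma$; $g$ is a $p$-weak upper gradient if the upper gradient inequality holds outside a family of $p$-modulus zero. $N^{1,p}_{loc}(X,Y)$ is the set of maps $u:X\to Y$ such that, for an isometric embedding $\iota$ of $Y$ into a separable Banach space $V$, $\iota\circ u$ is $\mu$-measurable and every point of $X$ has a neighbourhood $U$ on which $\iota\circ u$ belongs to $L^p(U;V)$ and has an upper gradient in $L^p(U)$. The minimal $p$-weak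 upper gradient $g_u$ is the ($\mu$-a.e. unique) $p$-weak upper gradient in $L^p_{loc}(X)$ that is a.e. at most any other one. For $x,y\in X$ and $\delta>0$ let $\Gamma_\delta(x,y)$ be the family of Lipschitz curves $\gamma:[0,1]\to X$ with $\gamma(0)\in\bar B(x,\delta)$, $\gamma(1)\in\bar B(y,\delta)$. The $Q$-essential pull-back distance of $u$ is $$d'_{u,Q}(x,y)=\lim_{\delta\to0}\ \sup_{\operatorname{Mod}_Q(\Gamma_0)=0}\ \inf\{\ell(u\circ\gamma):\gamma\in\Gamma_\delta(x,y)\setminus\Gamma_0\}\in[0,\infty],\qquad \inf\varnothing=\infty.$$ Proposition. Let $1\le Q<p$, $C_\mu\ge1$, $c>0$, $C_P\ge1$, $\sigma\ge1$. There are constants $C\ge1$ and $\sigma'\ge1$, depending only on $p,Q,C_\mu,c,C_P,\sigma$, with the following property. Let $X$ be a metric measure space such that (i) $\mu(B(x,2r))\le C_\mu\,\mu(B(x,r))$ for all $x\in X$ and $0<r<\operatorname{diam}X$; (ii) $c\left(\frac{\operatorname{diam}B}{\operatorname{diam}B'}\right)^Q\le\frac{\mu(B)}{\mu(B')}$, that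 is, $c(\operatorname{diam}B)^Q\mu(B')\le\mu(B)(\operatorname{diam}B')^Q$, for all balls $B\subset B'\subset X$; (iii) (the $Q$-Poincaré inequality) $\frac1{\mu(B)}\int_B|w-w_B|\,d\mu\le C_P\operatorname{diam}B\,\left(\frac1{\mu(\sigma B)}\int_{\sigma B}g^Q\,d\mu\right)^{1/Q}$ for every $w\in L^1_{loc}(X)$, every upper gradient $g$ of $w$ and every ball $B\subset X$, where $w_B=\frac1{\mu(B)}\int_B w\,d\mu$, and $\sigma B$ is the ball with the same centre and $\sigma$ times the radius. Let $Y$ be a proper metric space and $u\in N^{1,p}_{loc}(X,Y)$. Then $d_u:=d'_{u,Q}$ is a finite-valued pseudometric on $X$, and for every ball $B\subset X$ and all $x,y\in B$ $$d_u(x,y)\le C(\operatorname{diam}B)^{Q/p}\,d(x,y)^{1-Q/p}\left(\frac1{\mu(\sigma'B)}\int_{\sigma'B}g_u^p\,d\mu\right)^{1/p}.$$ -/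

import Mathlib

open MeasureTheory Set Filter Topology
open scoped ENNReal

namespace EssPullback

universe u v

/-- Curves in `X`: continuous maps `[0,1] → X`. -/
abbrev Curve (X : Type u) [TopologicalSpace X] := C(unitInterval, X)

section Curves

variable {X : Type u} [MetricSpace X]

/-- The length `ℓ(c) ∈ [0,∞]` of a (not necessarily continuous) map `c : [0,1] → X`. -/
noncomputable def length (c : unitInterval → X) : ℝ≥0∞ := eVariationOn c univ

/-- The line integral `∫_γ g = ∫₀^{ℓ(γ)} g(γ_s(t)) dt`, where `γ_s` is the arc length
parametrization of `γ`, if `γ` is rectifiable, and `∞` otherwise. -/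
noncomputable def lineIntegral (γ : Curve X) (g : X → ℝ≥0∞) : ℝ≥0∞ :=
  open Classical in
  if length γ = ⊤ then ⊤
  else ∫⁻ t in Icc (0 : ℝ) (length γ).toReal, g (naturalParameterization γ univ 0 t)

/-- The Borel function `g : X → [0,∞]` is an upper gradient of `f` in `U`:
the upper gradient inequality holds for all curves in `U`.
Only the values of `f` and `g` in `U` matter. -/
def IsUpperGradientOn {Y : Type v} [MetricSpace Y] [MeasurableSpace X] (U : Set X)
    (f : X → Y) (g : X → ℝ≥0∞) : Prop :=
  Measurable g ∧
    ∀ γ : Curve X, (∀ t, γ t ∈ U) → edist (f (γ 0)) (f (γ 1)) ≤ lineIntegral γ g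

/-- The `p`-modulus of a family of curves. -/
noncomputable def modulus [MeasurableSpace X] (μ : Measure X) (p : ℝ) (Γ : Set (Curve X)) :
    ℝ≥0∞ :=
  ⨅ (ρ : X → ℝ≥0∞) (_ : Measurable ρ) (_ : ∀ γ ∈ Γ, 1 ≤ lineIntegral γ ρ),
    ∫⁻ x, ρ x ^ p ∂μ

/-- The Borel function `g : X → [0,∞]` is a `p`-weak upper gradient of `f : X → Y`. -/
def IsWeakUpperGradient {Y : Type v} [MetricSpace Y] [MeasurableSpace X] (μ : Measure X)
    (p : ℝ) (f : X → Y) (g : X → ℝ≥0∞) : Prop :=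
  Measurable g ∧ ∃ Γ₀ : Set (Curve X), modulus μ p Γ₀ = 0 ∧
    ∀ γ : Curve X, γ ∉ Γ₀ → edist (f (γ 0)) (f (γ 1)) ≤ lineIntegral γ g

/-- `g ∈ L^p_loc(X)`, for functions with values in `[0,∞]`. -/
def LocLp [MeasurableSpace X] (μ : Measure X) (p : ℝ) (g : X → ℝ≥0∞) : Prop :=
  ∀ x, ∃ U : Set X, IsOpen U ∧ x ∈ U ∧ ∫⁻ z in U, g z ^ p ∂μ < ⊤

/-- `g` is (a representative of) the minimal `p`-weak upper gradient `g_f` of `f`: it is a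
`p`-weak upper gradient in `L^p_loc` that is almost everywhere at most any other one. -/
def IsMinimalWeakUpperGradient {Y : Type v} [MetricSpace Y] [MeasurableSpace X]
    (μ : Measure X) (p : ℝ) (f : X → Y) (g : X → ℝ≥0∞) : Prop :=
  IsWeakUpperGradient μ p f g ∧ LocLp μ p g ∧
    ∀ h : X → ℝ≥0∞, IsWeakUpperGradient μ p f h → LocLp μ p h → g ≤ᵐ[μ] h

/-- The restriction of `f : X → V` to `U` is `p`-Newtonian: it belongs to `L^p(U;V)` and has an
upper gradient in `L^p(U)`. -/
def IsNewtonianOn {V : Type v} [NormedAddCommGroup V] [MeasurableSpace X] (μ : Measure X)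
    (p : ℝ) (U : Set X) (f : X → V) : Prop :=
  MemLp f (ENNReal.ofReal p) (μ.restrict U) ∧
    ∃ g : X → ℝ≥0∞, IsUpperGradientOn U f g ∧ ∫⁻ z in U, g z ^ p ∂μ < ⊤

/-- Locally `p`-Newtonian maps with values in a Banach space. -/
def IsLocNewtonian {V : Type v} [NormedAddCommGroup V] [MeasurableSpace X] (μ : Measure X)
    (p : ℝ) (f : X → V) : Prop :=
  AEStronglyMeasurable f μ ∧
    ∀ x, ∃ U : Set X, IsOpen U ∧ x ∈ U ∧ IsNewtonianOn μ p U f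

/-- `f ∈ N^{1,p}_loc(X,Y)` for a complete separable metric space `Y`: composed with an isometric
embedding of `Y` into a separable Banach space, `f` is locally `p`-Newtonian. (The condition does
not depend on the embedding, as balls have finite measure.) -/
def MemLocNewtonian {Y : Type v} [MetricSpace Y] [MeasurableSpace X] (μ : Measure X)
    (p : ℝ) (f : X → Y) : Prop :=
  ∃ (V : Type v) (_ : NormedAddCommGroup V) (_ : NormedSpace ℝ V) (_ : CompleteSpace V)
    (_ : TopologicalSpace.SeparableSpace V) (ι : Y → V),
    Isometry ι ∧ IsLocNewtonian μ p (fun x => ι (f x))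

/-- The family `Γ(E,F)` of Lipschitz curves `[0,1] → X` from `E` to `F`. -/
def curvesJoining (E F : Set X) : Set (Curve X) :=
  {γ | (∃ K, LipschitzWith K γ) ∧ γ 0 ∈ E ∧ γ 1 ∈ F}

/-- The `p`-essential infimum of a functional `F` over a family of curves:
`sup_{Mod_p Γ₀ = 0} inf {F γ : γ ∈ Γ \ Γ₀}`. -/
noncomputable def essInfMod [MeasurableSpace X] (μ : Measure X) (p : ℝ) (Γ : Set (Curve X))
    (F : Curve X → ℝ≥0∞) : ℝ≥0∞ :=
  ⨆ (Γ₀ : Set (Curve X)) (_ : modulus μ p Γ₀ = 0), ⨅ γ ∈ Γ \ Γ₀, F γ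

/-- The essential length `essℓ_{f,p}(Γ)`: the `p`-essential infimum of `ℓ(f ∘ γ)`, `γ ∈ Γ`. -/
noncomputable def essLength {Y : Type v} [MetricSpace Y] [MeasurableSpace X] (μ : Measure X)
    (p : ℝ) (f : X → Y) (Γ : Set (Curve X)) : ℝ≥0∞ :=
  essInfMod μ p Γ fun γ => length fun t => f (γ t)

/-- The `p`-essential pull-back distance
`d'_{f,p}(x,y) = lim_{δ → 0} essℓ_{f,p} Γ(B̄(x,δ), B̄(y,δ))`. The quantity increases as `δ`
decreases, so the limit is the supremum; see `tendsto_essPullbackDist`. -/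
noncomputable def essPullbackDist {Y : Type v} [MetricSpace Y] [MeasurableSpace X]
    (μ : Measure X) (p : ℝ) (f : X → Y) (x y : X) : ℝ≥0∞ :=
  ⨆ (δ : ℝ) (_ : 0 < δ),
    essLength μ p f (curvesJoining (Metric.closedBall x δ) (Metric.closedBall y δ))

theorem tendsto_essPullbackDist {Y : Type v} [MetricSpace Y] [MeasurableSpace X]
    (μ : Measure X) (p : ℝ) (f : X → Y) (x y : X) :
    Tendsto (fun δ : ℝ =>
      essLength μ p f (curvesJoining (Metric.closedBall x δ) (Metric.closedBall y δ)))
      (𝓝[>] 0) (𝓝 (essPullbackDist μ p f x y)) := by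
  have h : Antitone (fun δ : ℝ =>
      essLength μ p f (curvesJoining (Metric.closedBall x δ) (Metric.closedBall y δ))) := by
    intro a b hab
    refine iSup₂_mono fun Γ₀ _ => biInf_mono ?_
    rintro γ ⟨⟨hL, h0, h1⟩, hγ⟩
    exact ⟨⟨hL, Metric.closedBall_subset_closedBall hab h0,
      Metric.closedBall_subset_closedBall hab h1⟩, hγ⟩
  have := h.tendsto_nhdsGT 0
  rwa [sSup_image] at this

end Curves

section Spaces

variable {X : Type u} [MetricSpace X] [MeasurableSpace X]

/-- All balls have positive finite measure. -/
def BallsPosFinite (μ : Measure X) : Prop :=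
  ∀ (x : X) (r : ℝ), 0 < r → 0 < μ (Metric.ball x r) ∧ μ (Metric.ball x r) < ⊤

/-- `μ` is doubling, with constant `C`. -/
def DoublingWith (C : ℝ) (μ : Measure X) : Prop :=
  ∀ (x : X) (r : ℝ), 0 < r → ENNReal.ofReal r < Metric.ediam (univ : Set X) →
    μ (Metric.ball x (2 * r)) ≤ ENNReal.ofReal C * μ (Metric.ball x r)

/-- The relative volume lower bound `c (diam B / diam B')^Q ≤ μ(B) / μ(B')` for all balls
`B ⊆ B'`, with the denominators cleared. -/
def RelVolumeBound (c Q : ℝ) (μ : Measure X) : Prop :=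
  ∀ (x x' : X) (r r' : ℝ), 0 < r → 0 < r' → Metric.ball x r ⊆ Metric.ball x' r' →
    ENNReal.ofReal c * Metric.ediam (Metric.ball x r) ^ Q * μ (Metric.ball x' r') ≤
      μ (Metric.ball x r) * Metric.ediam (Metric.ball x' r') ^ Q

/-- The `q`-Poincaré inequality with constants `C` and `σ`. -/
def PoincareWith (q C σ : ℝ) (μ : Measure X) : Prop :=
  ∀ (w : X → ℝ) (g : X → ℝ≥0∞), LocallyIntegrable w μ → IsUpperGradientOn univ w g →
    ∀ (x : X) (r : ℝ), 0 < r →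
      ⨍⁻ y in Metric.ball x r, ‖w y - ⨍ z in Metric.ball x r, w z ∂μ‖ₑ ∂μ ≤
        ENNReal.ofReal C * Metric.ediam (Metric.ball x r) *
          (⨍⁻ y in Metric.ball x (σ * r), g y ^ q ∂μ) ^ (1 / q)

end Spaces

end EssPullback

/-! The core is that the Poincaré inequality produces curves (`exists_curve_of_poincareSum`). Let
`g` and `ρ` be lower semicontinuous, with finite sums at `x` and `y` of the Poincaré right-hand
sides over dyadic radii. Put `h = g + ε(ρ + 1)` and let continuous `a_k` increase to `h`. The least
cost of a chain from `x`, with steps weighted by `a_k`, is a function with upper gradient `a_k ≤ h`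
(`isUpperGradientOn_of_local_bound`), so the telescoped Poincaré inequality (`edist_le_poincareSum`)
bounds its value at `y` independently of `k`. Since `a_k ≥ ε`, chains of bounded cost and vanishing
step size subconverge to a Lipschitz curve (`exists_curve_of_chains`), and monotone convergence
carries the bound over to the line integral of `h`. So the integral of `g` is controlled by its
sums, up to an arbitrarily small error, and that of `ρ` is finite.

A family has `Q`-modulus zero exactly when some `Q`-integrable `ρ` has infinite integral along all
its curves, so finiteness of the integral of `ρ` means avoiding the family. Semicontinuity comes
from the Vitali–Carathéodory theorem. The sums of a `Q`-integrable `ρ` are finite off a null set,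
where the maximal function of `ρ^Q` is finite. The sums of a `p`-integrable `g` with `p > Q` are
bounded at every point: Hölder and the relative volume bound turn them into a geometric series in
`diam^(1 - Q/p)`, which is Morrey's estimate and the origin of the exponents
(`poincareSum_le_morrey`). With endpoints off the null set but close to `x` and `y`, and with `g` a
weak upper gradient of `u`, the length of `u ∘ γ` is at most the integral of `g`; this is the Hölder
estimate.

Finiteness is the same estimate for an upper gradient integrable on a large ball. In the triangle
inequality, near-optimal curves from `x` to `y` and from `y` to `z` need not meet near `y`. Making
`ρ` infinite on the null set forces both to visit good points near `y`, and a third curve with short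
image joins these. -/

namespace EssPullback

universe u v

/-! ### Arc length, line integrals, subcurves and reversal. -/

section LineIntegrals

variable {X : Type u} [MetricSpace X]

/-- The arc length `ℓ(γ|_{[0,t]})` of a rectifiable curve. -/
noncomputable def arc (γ : Curve X) (t : unitInterval) : ℝ := variationOnFromTo γ univ 0 t

/-- The arc length parametrization of a rectifiable curve. -/
noncomputable def natParam (γ : Curve X) : ℝ → X := naturalParameterization γ univ 0

theorem locallyBoundedVariationOn_of_length {γ : Curve X} (hγ : length γ ≠ ⊤) :
    LocallyBoundedVariationOn γ univ :=
  BoundedVariationOn.locallyBoundedVariationOn hγ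

@[simp] theorem arc_zero (γ : Curve X) : arc γ 0 = 0 := variationOnFromTo.self _ _ _

theorem arc_one (γ : Curve X) : arc γ 1 = (length γ).toReal := by
  rw [arc, variationOnFromTo.eq_of_le _ _ zero_le_one, length]
  rw [← unitInterval.univ_eq_Icc, inter_univ]

theorem arc_mono {γ : Curve X} (hγ : length γ ≠ ⊤) : Monotone (arc γ) :=
  monotoneOn_univ.1 (variationOnFromTo.monotoneOn (locallyBoundedVariationOn_of_length hγ)
    (mem_univ _))

theorem natParam_arc {γ : Curve X} (hγ : length γ ≠ ⊤) (t : unitInterval) :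
    natParam γ (arc γ t) = γ t :=
  edist_eq_zero.1 (edist_naturalParameterization_eq_zero
    (locallyBoundedVariationOn_of_length hγ) (mem_univ _) (mem_univ _))

theorem eVariationOn_Icc_eq_arc {γ : Curve X} (hγ : length γ ≠ ⊤) {s t : unitInterval}
    (hst : s ≤ t) : eVariationOn γ (Icc s t) = ENNReal.ofReal (arc γ t - arc γ s) := by
  have h := locallyBoundedVariationOn_of_length hγ
  rw [arc, arc, variationOnFromTo.sub_right h (mem_univ _) (mem_univ _) (mem_univ _),
    variationOnFromTo.eq_of_le _ _ hst, univ_inter, ENNReal.ofReal_toReal]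
  exact ne_top_of_le_ne_top hγ (eVariationOn.mono _ (subset_univ _))

/-- The variation can only jump where the curve itself jumps. -/
theorem arc_continuous {γ : Curve X} (hγ : length γ ≠ ⊤) : Continuous (arc γ) := by
  have h := locallyBoundedVariationOn_of_length hγ
  rw [continuous_iff_continuousAt]
  intro b
  have hl := variationOnFromTo.tendsto_left (a := 0) (b := b) (mem_univ _) (mem_univ _) h
    (γ.continuous.continuousAt.mono_left nhdsWithin_le_nhds)
  have hr := variationOnFromTo.tendsto_right (a := 0) (b := b) (mem_univ _) (mem_univ _) h
    (γ.continuous.continuousAt.mono_left nhdsWithin_le_nhds)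
  simp only [univ_inter, dist_self, sub_zero, add_zero] at hl hr
  exact continuousAt_iff_continuous_left'_right'.2 ⟨hl, hr⟩

theorem exists_arc_eq {γ : Curve X} (hγ : length γ ≠ ⊤) {s t : unitInterval} (hst : s ≤ t)
    {τ : ℝ} (hτ : τ ∈ Icc (arc γ s) (arc γ t)) : ∃ r ∈ Icc s t, arc γ r = τ :=
  intermediate_value_Icc hst (arc_continuous hγ).continuousOn hτ

theorem dist_natParam_le {γ : Curve X} (hγ : length γ ≠ ⊤) {a b : ℝ}
    (ha : a ∈ Icc 0 (arc γ 1)) (hb : b ∈ Icc 0 (arc γ 1)) :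
    dist (natParam γ a) (natParam γ b) ≤ |a - b| := by
  wlog hab : a ≤ b generalizing a b
  · rw [dist_comm, abs_sub_comm]
    exact this hb ha (le_of_not_ge hab)
  rw [← arc_zero γ] at ha hb
  obtain ⟨s, -, rfl⟩ := exists_arc_eq hγ zero_le_one ha
  obtain ⟨t, ht, htb⟩ := exists_arc_eq hγ s.2.2 (τ := b) ⟨hab, hb.2⟩
  subst htb
  rw [natParam_arc hγ, natParam_arc hγ, abs_sub_comm, abs_of_nonneg (sub_nonneg.2 hab),
    ← ENNReal.ofReal_le_ofReal_iff (sub_nonneg.2 hab), ← eVariationOn_Icc_eq_arc hγ ht.1,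
    ← edist_dist]
  exact eVariationOn.edist_le _ (left_mem_Icc.2 ht.1) (right_mem_Icc.2 ht.1)

theorem continuousOn_natParam {γ : Curve X} (hγ : length γ ≠ ⊤) :
    ContinuousOn (natParam γ) (Icc 0 (arc γ 1)) := by
  refine LipschitzOnWith.continuousOn (K := 1) (LipschitzOnWith.of_dist_le_mul ?_)
  intro a ha b hb
  simpa [Real.dist_eq] using dist_natParam_le hγ ha hb

theorem lineIntegral_eq {γ : Curve X} (hγ : length γ ≠ ⊤) (g : X → ℝ≥0∞) :
    lineIntegral γ g = ∫⁻ τ in Icc (0 : ℝ) (arc γ 1), g (natParam γ τ) := by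
  rw [lineIntegral, if_neg hγ, arc_one]
  rfl

theorem lineIntegral_of_length_eq_top {γ : Curve X} (hγ : length γ = ⊤) (g : X → ℝ≥0∞) :
    lineIntegral γ g = ⊤ := by
  rw [lineIntegral, if_pos hγ]

theorem length_ne_top_of_lineIntegral {γ : Curve X} {g : X → ℝ≥0∞} (h : lineIntegral γ g ≠ ⊤) :
    length γ ≠ ⊤ := fun h' => h (lineIntegral_of_length_eq_top h' g)

theorem lineIntegral_mono (γ : Curve X) {g h : X → ℝ≥0∞} (hgh : ∀ x, g x ≤ h x) :
    lineIntegral γ g ≤ lineIntegral γ h := by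
  by_cases hγ : length γ = ⊤
  · rw [lineIntegral_of_length_eq_top hγ, lineIntegral_of_length_eq_top hγ]
  · rw [lineIntegral_eq hγ, lineIntegral_eq hγ]
    exact lintegral_mono fun _ => hgh _

/-- The line integral may be computed in any parametrization of unit speed. -/
theorem lineIntegral_eq_of_param {γ : Curve X} {V : unitInterval → ℝ} {c : ℝ → X}
    (hVγ : ∀ s t, s ≤ t → V s ≤ V t ∧
      eVariationOn γ (Icc s t) = ENNReal.ofReal (V t - V s))
    (hc : ∀ t, γ t = c (V t)) (g : X → ℝ≥0∞) :
    length γ ≠ ⊤ ∧ lineIntegral γ g = ∫⁻ τ in Icc (V 0) (V 1), g (c τ) := by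
  have huniv := unitInterval.univ_eq_Icc
  have hlen : length γ = ENNReal.ofReal (V 1 - V 0) := by
    rw [length, huniv, (hVγ 0 1 zero_le_one).2]
  have hγ : length γ ≠ ⊤ := by rw [hlen]; exact ENNReal.ofReal_ne_top
  refine ⟨hγ, ?_⟩
  have harc : ∀ t, arc γ t = V t - V 0 := by
    intro t
    have h := eVariationOn_Icc_eq_arc hγ (show (0 : unitInterval) ≤ t from t.2.1)
    rw [(hVγ 0 t t.2.1).2, arc_zero, sub_zero, ENNReal.ofReal_eq_ofReal_iff] at h
    · exact h.symm
    · exact sub_nonneg.2 (hVγ 0 t t.2.1).1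
    · rw [← arc_zero γ]; exact arc_mono hγ t.2.1
  rw [lineIntegral_eq hγ]
  have hmp := measurePreserving_add_left (volume : Measure ℝ) (V 0)
  have hpre : (fun τ => V 0 + τ) ⁻¹' Icc (V 0) (V 1) = Icc 0 (arc γ 1) := by
    ext τ
    simp only [mem_preimage, mem_Icc, harc]
    constructor <;> rintro ⟨h1, h2⟩ <;> constructor <;> linarith
  rw [← hmp.setLIntegral_comp_preimage_emb (measurableEmbedding_addLeft _) _ (Icc (V 0) (V 1)),
    hpre]
  refine setLIntegral_congr_fun measurableSet_Icc fun τ hτ => ?_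
  rw [← arc_zero γ] at hτ
  obtain ⟨r, -, rfl⟩ := exists_arc_eq hγ zero_le_one hτ
  simp only [natParam_arc hγ]
  rw [hc r, harc r, add_sub_cancel]

/-- The affine monotone map of `[0,1]` onto `[s,t]`. -/
noncomputable def affineParam (s t : unitInterval) : C(unitInterval, unitInterval) where
  toFun r := ⟨(1 - r) * s + r * t, by
    have := r.2.1; have := r.2.2; have := s.2.1; have := s.2.2; have := t.2.1; have := t.2.2
    constructor
    · have : 0 ≤ 1 - (r : ℝ) := by linarith
      positivity
    · nlinarith⟩
  continuous_toFun := by fun_prop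

theorem affineParam_apply (s t r : unitInterval) :
    (affineParam s t r : ℝ) = (1 - r) * s + r * t := rfl

@[simp] theorem affineParam_zero (s t : unitInterval) : affineParam s t 0 = s := by
  apply Subtype.ext; simp [affineParam_apply]

@[simp] theorem affineParam_one (s t : unitInterval) : affineParam s t 1 = t := by
  apply Subtype.ext; simp [affineParam_apply]

theorem affineParam_mono {s t : unitInterval} (hst : s ≤ t) : Monotone (affineParam s t) := by
  intro a b hab
  have hst' : (s : ℝ) ≤ t := hst
  have hab' : (a : ℝ) ≤ b := hab
  change (affineParam s t a : ℝ) ≤ affineParam s t b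
  rw [affineParam_apply, affineParam_apply]
  nlinarith

theorem affineParam_lipschitz (s t : unitInterval) : LipschitzWith 1 (affineParam s t) := by
  refine LipschitzWith.of_dist_le_mul fun a b => ?_
  rw [Subtype.dist_eq, Subtype.dist_eq, affineParam_apply, affineParam_apply, Real.dist_eq,
    Real.dist_eq, show (1 - (a : ℝ)) * s + a * t - ((1 - b) * s + b * t) =
      (a - b) * (t - s) by ring, abs_mul, NNReal.coe_one, one_mul]
  refine mul_le_of_le_one_right (abs_nonneg _) (abs_le.2 ?_)
  have := s.2.1; have := s.2.2; have := t.2.1; have := t.2.2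
  constructor <;> linarith

theorem image_Icc_of_monotone {φ : C(unitInterval, unitInterval)} (hφ : Monotone φ)
    {a b : unitInterval} (hab : a ≤ b) : φ '' Icc a b = Icc (φ a) (φ b) := by
  refine subset_antisymm ?_ (intermediate_value_Icc hab φ.continuous.continuousOn)
  rintro _ ⟨x, hx, rfl⟩
  exact ⟨hφ hx.1, hφ hx.2⟩

/-- The subcurve `γ|_{[s,t]}`. -/
noncomputable def subcurve (γ : Curve X) (s t : unitInterval) : Curve X := γ.comp (affineParam s t)

theorem subcurve_apply (γ : Curve X) (s t r : unitInterval) :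
    subcurve γ s t r = γ (affineParam s t r) := rfl

@[simp] theorem subcurve_zero (γ : Curve X) (s t : unitInterval) : subcurve γ s t 0 = γ s := by
  simp [subcurve_apply]

@[simp] theorem subcurve_one (γ : Curve X) (s t : unitInterval) : subcurve γ s t 1 = γ t := by
  simp [subcurve_apply]

theorem subcurve_zero_one (γ : Curve X) : subcurve γ 0 1 = γ := by
  ext r
  rw [subcurve_apply]
  congr 1
  apply Subtype.ext
  simp [affineParam_apply]

theorem length_subcurve {Y : Type*} [MetricSpace Y] (f : unitInterval → Y)
    {s t : unitInterval} (hst : s ≤ t) :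
    length (fun r => f (affineParam s t r)) = eVariationOn f (Icc s t) := by
  have huniv := unitInterval.univ_eq_Icc
  have := eVariationOn.comp_eq_of_monotoneOn f (t := univ) (affineParam s t)
    ((affineParam_mono hst).monotoneOn _)
  rw [huniv, image_Icc_of_monotone (affineParam_mono hst) zero_le_one, affineParam_zero,
    affineParam_one, ← huniv] at this
  exact this

/-- The arc length of the whole curve is already a unit-speed parameter for the subcurve; it merely
starts at `arc γ s` instead of `0`. -/
theorem lineIntegral_subcurve {γ : Curve X} (hγ : length γ ≠ ⊤) {s t : unitInterval}
    (hst : s ≤ t) (g : X → ℝ≥0∞) :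
    length (subcurve γ s t) ≠ ⊤ ∧
      lineIntegral (subcurve γ s t) g = ∫⁻ τ in Icc (arc γ s) (arc γ t), g (natParam γ τ) := by
  have := lineIntegral_eq_of_param (γ := subcurve γ s t) (V := fun r => arc γ (affineParam s t r))
    (c := natParam γ) ?_ ?_ g
  · simpa using this
  · intro a b hab
    refine ⟨arc_mono hγ (affineParam_mono hst hab), ?_⟩
    rw [← eVariationOn_Icc_eq_arc hγ (affineParam_mono hst hab),
      ← image_Icc_of_monotone (affineParam_mono hst) hab]
    exact eVariationOn.comp_eq_of_monotoneOn γ _ ((affineParam_mono hst).monotoneOn _)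
  · intro r
    rw [natParam_arc hγ, subcurve_apply]

theorem lintegral_Icc_add_Icc (f : ℝ → ℝ≥0∞) {a b c : ℝ} (hab : a ≤ b) (hbc : b ≤ c) :
    (∫⁻ τ in Icc a b, f τ) + ∫⁻ τ in Icc b c, f τ = ∫⁻ τ in Icc a c, f τ := by
  rw [← restrict_Ioc_eq_restrict_Icc, ← restrict_Ioc_eq_restrict_Icc,
    ← restrict_Ioc_eq_restrict_Icc, ← Ioc_union_Ioc_eq_Ioc hab hbc,
    lintegral_union measurableSet_Ioc (Ioc_disjoint_Ioc_of_le le_rfl)]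

theorem lineIntegral_subcurve_add {γ : Curve X} (hγ : length γ ≠ ⊤) {r s t : unitInterval}
    (hrs : r ≤ s) (hst : s ≤ t) (g : X → ℝ≥0∞) :
    lineIntegral (subcurve γ r s) g + lineIntegral (subcurve γ s t) g =
      lineIntegral (subcurve γ r t) g := by
  rw [(lineIntegral_subcurve hγ hrs g).2, (lineIntegral_subcurve hγ hst g).2,
    (lineIntegral_subcurve hγ (hrs.trans hst) g).2,
    lintegral_Icc_add_Icc _ (arc_mono hγ hrs) (arc_mono hγ hst)]

theorem lineIntegral_subcurve_le {γ : Curve X} (hγ : length γ ≠ ⊤) {s t : unitInterval}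
    (hst : s ≤ t) (g : X → ℝ≥0∞) : lineIntegral (subcurve γ s t) g ≤ lineIntegral γ g := by
  rw [(lineIntegral_subcurve hγ hst g).2, lineIntegral_eq hγ]
  refine lintegral_mono_set (Icc_subset_Icc ?_ (arc_mono hγ t.2.2))
  rw [← arc_zero γ]
  exact arc_mono hγ s.2.1

/-- An upper gradient inequality on all subcurves of a curve bounds the length of its image. -/
theorem length_comp_le_lineIntegral {Y : Type v} [MetricSpace Y] {γ : Curve X} (f : X → Y)
    (g : X → ℝ≥0∞)
    (h : ∀ s t : unitInterval, s ≤ t → edist (f (γ s)) (f (γ t)) ≤ lineIntegral (subcurve γ s t) g) :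
    length (fun t => f (γ t)) ≤ lineIntegral γ g := by
  by_cases hγ : length γ = ⊤
  · rw [lineIntegral_of_length_eq_top hγ]; exact le_top
  refine iSup_le ?_
  rintro ⟨n, w, hw, -⟩
  have hsum : ∀ m, ∑ i ∈ Finset.range m, edist (f (γ (w (i + 1)))) (f (γ (w i))) ≤
      lineIntegral (subcurve γ (w 0) (w m)) g := by
    intro m
    induction m with
    | zero => simp
    | succ m ih =>
      rw [Finset.sum_range_succ, ← lineIntegral_subcurve_add hγ (hw m.zero_le) (hw m.le_succ)]
      refine add_le_add ih ?_
      rw [edist_comm]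
      exact h _ _ (hw m.le_succ)
  exact (hsum n).trans (lineIntegral_subcurve_le hγ (hw n.zero_le) g)

/-- The reversed curve. -/
def reverse (γ : Curve X) : Curve X := γ.comp ⟨unitInterval.symm, unitInterval.continuous_symm⟩

theorem reverse_apply (γ : Curve X) (t : unitInterval) : reverse γ t = γ (unitInterval.symm t) :=
  rfl

theorem length_symm {Y : Type*} [MetricSpace Y] (f : unitInterval → Y) :
    length (fun t => f (unitInterval.symm t)) = length f := by
  have h : AntitoneOn unitInterval.symm univ := fun a _ b _ hab =>
    unitInterval.symm_le_symm.2 hab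
  have := eVariationOn.comp_eq_of_antitoneOn f unitInterval.symm h
  rw [image_univ_of_surjective unitInterval.symm_bijective.surjective] at this
  exact this

theorem lineIntegral_reverse (γ : Curve X) (g : X → ℝ≥0∞) :
    lineIntegral (reverse γ) g = lineIntegral γ g := by
  by_cases hγ : length γ = ⊤
  · rw [lineIntegral_of_length_eq_top hγ, lineIntegral_of_length_eq_top]
    rw [← hγ]
    exact length_symm γ
  have hsymm : AntitoneOn unitInterval.symm univ := fun a _ b _ hab =>
    unitInterval.symm_le_symm.2 hab
  -- The negative of arc length increases along the reversed curve and serves as its unit-speed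
  -- parameter.
  have := (lineIntegral_eq_of_param (γ := reverse γ)
    (V := fun r => - arc γ (unitInterval.symm r))
    (c := fun τ => natParam γ (-τ))
    ?_ ?_ g).2
  · rw [this, lineIntegral_eq hγ]
    have hmp := Measure.measurePreserving_neg (volume : Measure ℝ)
    have hpre : (Neg.neg : ℝ → ℝ) ⁻¹' Icc 0 (arc γ 1) = Icc (-arc γ 1) 0 := by
      ext τ
      simp only [mem_preimage, mem_Icc]
      constructor <;> rintro ⟨h1, h2⟩ <;> constructor <;> linarith
    rw [← hmp.setLIntegral_comp_preimage_emb (MeasurableEquiv.neg ℝ).measurableEmbedding _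
      (Icc 0 (arc γ 1)), hpre]
    simp
  · intro a b hab
    have hab' := unitInterval.symm_le_symm.2 hab
    refine ⟨neg_le_neg (arc_mono hγ hab'), ?_⟩
    rw [neg_sub_neg, ← eVariationOn_Icc_eq_arc hγ hab']
    have h1 := eVariationOn.comp_eq_of_antitoneOn γ (t := Icc a b) unitInterval.symm
      (hsymm.mono (subset_univ _))
    have h2 : unitInterval.symm '' Icc a b = Icc (unitInterval.symm b) (unitInterval.symm a) := by
      ext x
      constructor
      · rintro ⟨y, hy, rfl⟩
        exact ⟨unitInterval.symm_le_symm.2 hy.2, unitInterval.symm_le_symm.2 hy.1⟩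
      · intro hx
        refine ⟨unitInterval.symm x, ⟨?_, ?_⟩, unitInterval.symm_symm x⟩
        · rw [← unitInterval.symm_symm a]; exact unitInterval.symm_le_symm.2 hx.2
        · rw [← unitInterval.symm_symm b]; exact unitInterval.symm_le_symm.2 hx.1
    rw [h2] at h1
    exact h1
  · intro r
    rw [neg_neg, natParam_arc hγ, reverse_apply]

end LineIntegrals

/-! ### Concatenation of curves and Lipschitz curves. -/

section Concatenation

variable {X : Type u} [MetricSpace X]

/-- The midpoint of the unit interval. -/
noncomputable def unitHalf : unitInterval := ⟨1 / 2, by norm_num, by norm_num⟩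

theorem coe_unitHalf : (unitHalf : ℝ) = 1 / 2 := rfl

/-- The concatenation of two curves. -/
noncomputable def concat (γ₁ γ₂ : Curve X) (h : γ₁ 1 = γ₂ 0) : Curve X where
  toFun t := if (t : ℝ) ≤ 1 / 2 then γ₁ (projIcc 0 1 zero_le_one (2 * t))
    else γ₂ (projIcc 0 1 zero_le_one (2 * t - 1))
  continuous_toFun := by
    refine Continuous.if_le ?_ ?_ (by fun_prop) (by fun_prop) ?_
    · exact γ₁.continuous.comp (continuous_projIcc.comp (by fun_prop))
    · exact γ₂.continuous.comp (continuous_projIcc.comp (by fun_prop))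
    · intro t ht
      rw [ht]
      norm_num
      exact h

variable {γ₁ γ₂ : Curve X} (h : γ₁ 1 = γ₂ 0)

theorem concat_apply_le {t : unitInterval} (ht : (t : ℝ) ≤ 1 / 2) :
    concat γ₁ γ₂ h t = γ₁ (projIcc 0 1 zero_le_one (2 * t)) := if_pos ht

theorem concat_apply_ge {t : unitInterval} (ht : 1 / 2 ≤ (t : ℝ)) :
    concat γ₁ γ₂ h t = γ₂ (projIcc 0 1 zero_le_one (2 * t - 1)) := by
  rcases ht.eq_or_lt with ht' | ht'
  · rw [concat_apply_le h ht'.symm.le, ← ht']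
    norm_num
    exact h
  · exact if_neg ht'.not_ge

theorem concat_affineParam_left (r : unitInterval) :
    concat γ₁ γ₂ h (affineParam 0 unitHalf r) = γ₁ r := by
  have h1 : (affineParam 0 unitHalf r : ℝ) = r / 2 := by
    rw [affineParam_apply, coe_unitHalf]; simp; ring
  rw [concat_apply_le h (by rw [h1]; linarith [r.2.2]), h1, mul_div_cancel₀ _ two_ne_zero,
    projIcc_val]

theorem concat_affineParam_right (r : unitInterval) :
    concat γ₁ γ₂ h (affineParam unitHalf 1 r) = γ₂ r := by
  have h1 : (affineParam unitHalf 1 r : ℝ) = (1 + r) / 2 := by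
    rw [affineParam_apply, coe_unitHalf]; simp; ring
  rw [concat_apply_ge h (by rw [h1]; linarith [r.2.1]), h1, mul_div_cancel₀ _ two_ne_zero,
    add_sub_cancel_left, projIcc_val]

theorem concat_zero : concat γ₁ γ₂ h 0 = γ₁ 0 := by
  simpa using concat_affineParam_left h 0

theorem concat_one : concat γ₁ γ₂ h 1 = γ₂ 1 := by
  simpa using concat_affineParam_right h 1

theorem unitHalf_nonneg : (0 : unitInterval) ≤ unitHalf := unitHalf.2.1

theorem unitHalf_le_one : unitHalf ≤ (1 : unitInterval) := unitHalf.2.2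

theorem length_eq_add_of_unitHalf {Y : Type*} [MetricSpace Y] (f : unitInterval → Y) :
    length f = length (fun r => f (affineParam 0 unitHalf r)) +
      length (fun r => f (affineParam unitHalf 1 r)) := by
  rw [length_subcurve f unitHalf_nonneg, length_subcurve f unitHalf_le_one, length,
    unitInterval.univ_eq_Icc]
  simpa using (eVariationOn.Icc_add_Icc f (s := univ) unitHalf_nonneg unitHalf_le_one
    (mem_univ _)).symm

theorem length_comp_concat {Y : Type*} [MetricSpace Y] (f : X → Y) :
    length (fun t => f (concat γ₁ γ₂ h t)) =
      length (fun t => f (γ₁ t)) + length (fun t => f (γ₂ t)) := by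
  rw [length_eq_add_of_unitHalf]
  simp only [concat_affineParam_left, concat_affineParam_right]

theorem lineIntegral_concat (g : X → ℝ≥0∞) :
    lineIntegral (concat γ₁ γ₂ h) g = lineIntegral γ₁ g + lineIntegral γ₂ g := by
  have hlen : length (concat γ₁ γ₂ h) = length γ₁ + length γ₂ := length_comp_concat h id
  have h1 : subcurve (concat γ₁ γ₂ h) 0 unitHalf = γ₁ :=
    ContinuousMap.ext (concat_affineParam_left h)
  have h2 : subcurve (concat γ₁ γ₂ h) unitHalf 1 = γ₂ :=
    ContinuousMap.ext (concat_affineParam_right h)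
  by_cases htop : length (concat γ₁ γ₂ h) = ⊤
  · rw [lineIntegral_of_length_eq_top htop]
    rw [hlen, ENNReal.add_eq_top] at htop
    rcases htop with h' | h' <;> simp [lineIntegral_of_length_eq_top h']
  · have := lineIntegral_subcurve_add htop unitHalf_nonneg unitHalf_le_one g
    rw [h1, h2, subcurve_zero_one] at this
    exact this.symm

theorem lipschitz_concat (h₁ : ∃ K, LipschitzWith K γ₁) (h₂ : ∃ K, LipschitzWith K γ₂) :
    ∃ K, LipschitzWith K (concat γ₁ γ₂ h) := by
  obtain ⟨K₁, h₁⟩ := h₁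
  obtain ⟨K₂, h₂⟩ := h₂
  -- Each half runs through its curve at double speed, whence the factor 2. Parameters on different
  -- sides are compared through the midpoint.
  have hA : ∀ s t : unitInterval, (s : ℝ) ≤ t → (t : ℝ) ≤ 1 / 2 →
      dist (concat γ₁ γ₂ h s) (concat γ₁ γ₂ h t) ≤ 2 * K₁ * (t - s) := by
    intro s t hst ht
    rw [concat_apply_le h ht, concat_apply_le h (hst.trans ht)]
    refine (h₁.dist_le_mul _ _).trans ?_
    have := (LipschitzWith.projIcc (zero_le_one (α := ℝ))).dist_le_mul (2 * (s : ℝ)) (2 * t)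
    rw [NNReal.coe_one, one_mul, dist_comm (2 * (s : ℝ)), Real.dist_eq,
      abs_of_nonneg (by linarith)] at this
    calc _ ≤ (K₁ : ℝ) * (2 * t - 2 * s) := by gcongr
      _ = _ := by ring
  have hB : ∀ s t : unitInterval, (s : ℝ) ≤ t → 1 / 2 ≤ (s : ℝ) →
      dist (concat γ₁ γ₂ h s) (concat γ₁ γ₂ h t) ≤ 2 * K₂ * (t - s) := by
    intro s t hst hs
    rw [concat_apply_ge h hs, concat_apply_ge h (hs.trans hst)]
    refine (h₂.dist_le_mul _ _).trans ?_
    have := (LipschitzWith.projIcc (zero_le_one (α := ℝ))).dist_le_mul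
      (2 * (s : ℝ) - 1) (2 * t - 1)
    rw [NNReal.coe_one, one_mul, dist_comm (2 * (s : ℝ) - 1), Real.dist_eq,
      abs_of_nonneg (by linarith)] at this
    calc _ ≤ (K₂ : ℝ) * (2 * t - 1 - (2 * s - 1)) := by gcongr
      _ = _ := by ring
  have key : ∀ s t : unitInterval, (s : ℝ) ≤ t →
      dist (concat γ₁ γ₂ h s) (concat γ₁ γ₂ h t) ≤ (2 * K₁ + 2 * K₂) * (t - s) := by
    intro s t hst
    have hK₁ := K₁.2
    have hK₂ := K₂.2
    rcases le_total (t : ℝ) (1 / 2) with ht | ht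
    · exact (hA s t hst ht).trans (by nlinarith)
    rcases le_total (s : ℝ) (1 / 2) with hs | hs
    · have h1 := hA s unitHalf hs le_rfl
      have h2 := hB unitHalf t ht le_rfl
      rw [coe_unitHalf] at h1 h2
      refine (dist_triangle _ _ _).trans ((add_le_add h1 h2).trans ?_)
      nlinarith
    · exact (hB s t hst hs).trans (by nlinarith)
  refine ⟨2 * K₁ + 2 * K₂, LipschitzWith.of_dist_le_mul fun s t => ?_⟩
  rw [Subtype.dist_eq, Real.dist_eq]
  push_cast
  rcases le_total (s : ℝ) t with hst | hst
  · rw [abs_sub_comm, abs_of_nonneg (sub_nonneg.2 hst)]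
    exact key s t hst
  · rw [dist_comm, abs_of_nonneg (sub_nonneg.2 hst)]
    exact key t s hst

theorem lipschitz_subcurve {γ : Curve X} (hγ : ∃ K, LipschitzWith K γ) (s t : unitInterval) :
    ∃ K, LipschitzWith K (subcurve γ s t) := by
  obtain ⟨K, hK⟩ := hγ
  exact ⟨K * 1, hK.comp (affineParam_lipschitz s t)⟩

theorem lipschitz_reverse {γ : Curve X} (hγ : ∃ K, LipschitzWith K γ) :
    ∃ K, LipschitzWith K (reverse γ) := by
  obtain ⟨K, hK⟩ := hγ
  refine ⟨K * 1, hK.comp (LipschitzWith.of_dist_le_mul fun a b => ?_)⟩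
  simp only [ContinuousMap.coe_mk, Subtype.dist_eq, Real.dist_eq, unitInterval.coe_symm_eq,
    NNReal.coe_one, one_mul]
  rw [sub_sub_sub_cancel_left, abs_sub_comm]

theorem length_ne_top_of_lipschitz {γ : Curve X} (hγ : ∃ K, LipschitzWith K γ) :
    length γ ≠ ⊤ := by
  obtain ⟨K, hK⟩ := hγ
  have h1 : eVariationOn (γ ∘ (id : unitInterval → unitInterval)) univ ≤
      K * eVariationOn (id : unitInterval → unitInterval) univ :=
    (hK.lipschitzOnWith (s := univ)).comp_eVariationOn_le (mapsTo_univ _ _)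
  have h2 : eVariationOn (id : unitInterval → unitInterval) univ ≤ ENNReal.ofReal (1 - 0) := by
    have : eVariationOn (id : unitInterval → unitInterval) univ =
        eVariationOn (fun t : unitInterval => (t : ℝ)) univ := rfl
    rw [this]
    have h3 : MonotoneOn (fun t : unitInterval => (t : ℝ)) univ := fun _ _ _ _ h => h
    have := (h3.eVariationOn_eq (mem_univ (0 : unitInterval)) (mem_univ 1)).le
    simpa [← unitInterval.univ_eq_Icc] using this
  exact ne_top_of_le_ne_top (ENNReal.mul_ne_top ENNReal.coe_ne_top ENNReal.ofReal_ne_top)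
    (h1.trans (mul_le_mul_right h2 _))

end Concatenation

/-! ### Modulus zero and infinite line integrals. -/

section Modulus

variable {X : Type u} [MetricSpace X]

theorem lineIntegral_const_mul {γ : Curve X} (hγ : length γ ≠ ⊤) {c : ℝ≥0∞} (hc : c ≠ ⊤)
    (g : X → ℝ≥0∞) : lineIntegral γ (fun x => c * g x) = c * lineIntegral γ g := by
  rw [lineIntegral_eq hγ, lineIntegral_eq hγ, lintegral_const_mul' _ _ hc]

theorem lineIntegral_const {x : X} {γ : Curve X} (hγ : ∀ t, γ t = x) (g : X → ℝ≥0∞) :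
    lineIntegral γ g = 0 := by
  have h0 : length γ = 0 := eVariationOn.constant_on (by
    rintro _ ⟨a, -, rfl⟩ _ ⟨b, -, rfl⟩
    rw [hγ, hγ])
  rw [lineIntegral, if_neg (by simp [h0]), h0]
  simp

/-- If `∫_γ ∞·1_N < ∞`, then `γ` meets `U \ N` for every open set `U` that it meets, unless it is
constant. -/
theorem exists_mem_diff_of_lineIntegral {γ : Curve X} (hne : γ 0 ≠ γ 1) {N U : Set X}
    (hU : IsOpen U) {t₀ : unitInterval} (ht₀ : γ t₀ ∈ U) {g : X → ℝ≥0∞}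
    (hg : ∀ x ∈ N, g x = ⊤) (hint : lineIntegral γ g ≠ ⊤) :
    ∃ t, γ t ∈ U \ N := by
  have hl := length_ne_top_of_lineIntegral hint
  rw [lineIntegral_eq hl] at hint
  have hpos : 0 < arc γ 1 := by
    rcases (arc_mono hl (zero_le_one (α := unitInterval))).lt_or_eq with h | h
    · rwa [arc_zero] at h
    · exact absurd (by rw [← natParam_arc hl 0, h, natParam_arc hl]) hne
  by_contra! hcon
  have hcon' : ∀ τ ∈ Icc 0 (arc γ 1), natParam γ τ ∈ U → g (natParam γ τ) = ⊤ := by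
    intro τ hτ hτU
    rw [← arc_zero γ] at hτ
    obtain ⟨r, -, rfl⟩ := exists_arc_eq hl zero_le_one hτ
    rw [natParam_arc hl] at hτU ⊢
    by_contra h
    exact hcon r ⟨hτU, fun h' => h (hg _ h')⟩
  have hmem : arc γ t₀ ∈ Icc 0 (arc γ 1) :=
    ⟨by rw [← arc_zero γ]; exact arc_mono hl t₀.2.1, arc_mono hl t₀.2.2⟩
  have hnhds : natParam γ ⁻¹' U ∈ 𝓝[Icc 0 (arc γ 1)] (arc γ t₀) :=
    (continuousOn_natParam hl _ hmem).preimage_mem_nhdsWithin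
      (by rw [natParam_arc hl]; exact hU.mem_nhds ht₀)
  obtain ⟨ε, hε, hball⟩ := Metric.mem_nhdsWithin_iff.1 hnhds
  -- A neighbourhood of `arc γ t₀`, clipped to the parameter interval. It has positive length since
  -- `arc γ 1 > 0`, and the integrand would be infinite on all of it.
  set a := max 0 (arc γ t₀ - ε / 2)
  set b := min (arc γ 1) (arc γ t₀ + ε / 2)
  have hab : a < b := by
    refine max_lt ?_ ?_ <;> refine lt_min ?_ ?_ <;> linarith [hmem.1, hmem.2]
  have hsub : Icc a b ⊆ Icc 0 (arc γ 1) := Icc_subset_Icc (le_max_left _ _) (min_le_left _ _)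
  refine hint (eq_top_mono (lintegral_mono_set hsub) ?_)
  have : ∫⁻ τ in Icc a b, g (natParam γ τ) = ∫⁻ τ in Icc a b, ⊤ := by
    refine setLIntegral_congr_fun measurableSet_Icc fun τ hτ => ?_
    refine hcon' τ (hsub hτ) (hball ⟨?_, hsub hτ⟩)
    rw [Metric.mem_ball, Real.dist_eq, abs_lt]
    have h1 := (le_max_right _ _).trans hτ.1
    have h2 := hτ.2.trans (min_le_right _ _)
    constructor <;> linarith
  rw [this, setLIntegral_const, Real.volume_Icc, ENNReal.top_mul]
  simpa using hab

variable [MeasurableSpace X]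

/-- The curves on which a `p`-integrable function has infinite line integral form a family of
`p`-modulus zero. -/
theorem modulus_eq_zero_of_lintegral {μ : Measure X} {p : ℝ} (hp : 0 < p) {ρ : X → ℝ≥0∞}
    (hρ : Measurable ρ) (hint : ∫⁻ x, ρ x ^ p ∂μ ≠ ⊤) {Γ : Set (Curve X)}
    (hΓ : ∀ γ ∈ Γ, lineIntegral γ ρ = ⊤) : modulus μ p Γ = 0 := by
  -- Every multiple `ρ / (n + 1)` is still admissible, and its energy tends to zero.
  have key : ∀ n : ℕ, modulus μ p Γ ≤ ((n : ℝ≥0∞) + 1)⁻¹ ^ p * ∫⁻ x, ρ x ^ p ∂μ := by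
    intro n
    have hn0 : ((n : ℝ≥0∞) + 1)⁻¹ ≠ 0 := ENNReal.inv_ne_zero.2 (by finiteness)
    have hnt : ((n : ℝ≥0∞) + 1)⁻¹ ≠ ⊤ := ENNReal.inv_ne_top.2 (by simp)
    refine (iInf₂_le (fun x => ((n : ℝ≥0∞) + 1)⁻¹ * ρ x) (hρ.const_mul _)).trans
      ((iInf_le _ ?_).trans ?_)
    · intro γ hγ
      by_cases hl : length γ = ⊤
      · rw [lineIntegral_of_length_eq_top hl]; exact le_top
      · rw [lineIntegral_const_mul hl hnt, hΓ γ hγ, ENNReal.mul_top hn0]; exact le_top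
    · rw [← lintegral_const_mul' _ _ (ENNReal.rpow_ne_top_of_nonneg hp.le hnt)]
      simp_rw [ENNReal.mul_rpow_of_nonneg _ _ hp.le]
      exact le_rfl
  have hlim : Tendsto (fun n : ℕ => ((n : ℝ≥0∞) + 1)⁻¹ ^ p * ∫⁻ x, ρ x ^ p ∂μ) atTop
      (𝓝 (0 ^ p * ∫⁻ x, ρ x ^ p ∂μ)) := by
    refine ENNReal.Tendsto.mul_const ?_ (Or.inr hint)
    refine (ENNReal.continuous_rpow_const.tendsto 0).comp ?_
    have := ENNReal.tendsto_inv_nat_nhds_zero.comp (tendsto_add_atTop_nat 1)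
    refine this.congr fun n => ?_
    simp
  rw [ENNReal.zero_rpow_of_pos hp, zero_mul] at hlim
  exact le_antisymm (ge_of_tendsto' hlim key) bot_le

/-- A family of modulus zero consists of curves on which a fixed integrable function has infinite
line integral. -/
theorem exists_lineIntegral_eq_top_of_modulus {μ : Measure X} {p : ℝ} (hp : 0 < p)
    {Γ : Set (Curve X)} (hΓ : modulus μ p Γ = 0) :
    ∃ ρ : X → ℝ≥0∞, Measurable ρ ∧ ∫⁻ x, ρ x ^ p ∂μ ≠ ⊤ ∧ ∀ γ ∈ Γ, lineIntegral γ ρ = ⊤ := by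
  -- Admissible functions of energy so small that even the functions `n * ρ n` have summable
  -- energies. The energy bound has `n + 1` in its denominator to avoid division by zero at `n = 0`.
  have hex : ∀ n : ℕ, ∃ ρ : X → ℝ≥0∞, Measurable ρ ∧ (∀ γ ∈ Γ, 1 ≤ lineIntegral γ ρ) ∧
      (n : ℝ≥0∞) ^ p * ∫⁻ x, ρ x ^ p ∂μ ≤ 2⁻¹ ^ n := by
    intro n
    have h2 : (0 : ℝ≥0∞) < 2⁻¹ ^ n / (n + 1) ^ p := by
      refine ENNReal.div_pos (pow_ne_zero _ (by simp)) ?_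
      exact ENNReal.rpow_ne_top_of_nonneg hp.le (by finiteness)
    rw [← hΓ] at h2
    simp only [modulus, iInf_lt_iff] at h2
    obtain ⟨ρ, hρ, hadm, hlt⟩ := h2
    refine ⟨ρ, hρ, hadm, ?_⟩
    refine (mul_le_mul_right hlt.le _).trans ?_
    rw [← mul_div_assoc]
    refine ENNReal.div_le_of_le_mul ?_
    rw [mul_comm]
    gcongr
    exact le_self_add
  choose ρ hρ hadm hint using hex
  -- A supremum rather than a sum: its `p`-th power is at most the sum of the `p`-th powers, for
  -- every `p > 0`.
  refine ⟨fun x => ⨆ n : ℕ, (n : ℝ≥0∞) * ρ n x, .iSup fun n => (hρ n).const_mul _, ?_, ?_⟩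
  · have h1 : ∀ x, (⨆ n : ℕ, (n : ℝ≥0∞) * ρ n x) ^ p ≤ ∑' n : ℕ, (n : ℝ≥0∞) ^ p * ρ n x ^ p := by
      intro x
      rw [(ENNReal.monotone_rpow_of_nonneg hp.le).map_iSup_of_continuousAt
        ENNReal.continuous_rpow_const.continuousAt (by simp [hp])]
      refine iSup_le fun n => ?_
      rw [ENNReal.mul_rpow_of_nonneg _ _ hp.le]
      exact ENNReal.le_tsum (f := fun n : ℕ => (n : ℝ≥0∞) ^ p * ρ n x ^ p) n
    refine ne_top_of_le_ne_top ?_ (lintegral_mono h1)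
    rw [lintegral_tsum fun n => (((hρ n).pow_const p).const_mul _).aemeasurable]
    have h2 : ∑' n : ℕ, (2⁻¹ : ℝ≥0∞) ^ n ≠ ⊤ := by
      rw [ENNReal.tsum_geometric]; simp
    refine ne_top_of_le_ne_top h2 (ENNReal.tsum_le_tsum fun n => ?_)
    rw [lintegral_const_mul _ ((hρ n).pow_const p)]
    exact hint n
  · intro γ hγ
    by_cases hl : length γ = ⊤
    · exact lineIntegral_of_length_eq_top hl _
    refine ENNReal.eq_top_of_forall_nnreal_le fun r => ?_
    obtain ⟨n, hn⟩ := exists_nat_ge r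
    calc (r : ℝ≥0∞) ≤ n := by exact_mod_cast hn
      _ = n * 1 := (mul_one _).symm
      _ ≤ n * lineIntegral γ (ρ n) := by gcongr; exact hadm n γ hγ
      _ = lineIntegral γ (fun x => n * ρ n x) := (lineIntegral_const_mul hl (by simp) _).symm
      _ ≤ _ := lineIntegral_mono γ fun x => le_iSup (fun n : ℕ => (n : ℝ≥0∞) * ρ n x) n

end Modulus

/-! ### Weighted chain distance. -/

section Chains

variable {X : Type u} [MetricSpace X]

/-- The point `z` is reached from `p` by a chain with steps of size at most `δ` and of cost `L`,
a step from `y` to `z` having the cost `a(y) d(y,z)`. -/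
inductive ChainReach (a : X → ℝ) (δ : ℝ) (p : X) : X → ℝ → Prop
  | refl : ChainReach a δ p p 0
  | step {y z : X} {L : ℝ} : ChainReach a δ p y L → dist y z ≤ δ →
      ChainReach a δ p z (L + a y * dist y z)

/-- The least cost of a chain from `p` to `z`. -/
noncomputable def chainDist (a : X → ℝ) (δ : ℝ) (p z : X) : ℝ := sInf {L | ChainReach a δ p z L}

variable {a : X → ℝ} {δ : ℝ} {p : X}

theorem ChainReach.nonneg (ha : ∀ x, 0 ≤ a x) {z : X} {L : ℝ} (h : ChainReach a δ p z L) :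
    0 ≤ L := by
  induction h with
  | refl => exact le_rfl
  | step _ _ ih => exact add_nonneg ih (mul_nonneg (ha _) dist_nonneg)

/-- Points at distance less than `δ` are reachable together, so the reachable set is clopen. -/
theorem exists_chainReach [PreconnectedSpace X] (hδ : 0 < δ) (z : X) :
    ∃ L, ChainReach a δ p z L := by
  have hclopen : IsClopen {z : X | ∃ L, ChainReach a δ p z L} := by
    constructor
    · rw [← isOpen_compl_iff, Metric.isOpen_iff]
      intro z hz
      refine ⟨δ, hδ, fun w hw hw' => hz ?_⟩
      obtain ⟨L, hL⟩ := hw'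
      exact ⟨_, hL.step (Metric.mem_ball.1 hw).le⟩
    · rw [Metric.isOpen_iff]
      rintro z ⟨L, hL⟩
      refine ⟨δ, hδ, fun w hw => ⟨_, hL.step (Metric.mem_ball'.1 hw).le⟩⟩
  exact eq_univ_iff_forall.1 (hclopen.eq_univ ⟨p, 0, ChainReach.refl⟩) z

theorem bddBelow_chainReach (ha : ∀ x, 0 ≤ a x) (z : X) :
    BddBelow {L | ChainReach a δ p z L} := ⟨0, fun _ h => ChainReach.nonneg ha h⟩

theorem chainDist_self (ha : ∀ x, 0 ≤ a x) : chainDist a δ p p = 0 :=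
  le_antisymm (csInf_le (bddBelow_chainReach ha p) ChainReach.refl)
    (le_csInf ⟨0, ChainReach.refl⟩ fun _ h => ChainReach.nonneg ha h)

theorem chainDist_le_add [PreconnectedSpace X] (ha : ∀ x, 0 ≤ a x) (hδ : 0 < δ) {z w : X}
    (h : dist z w ≤ δ) : chainDist a δ p w ≤ chainDist a δ p z + a z * dist z w := by
  rw [← sub_le_iff_le_add]
  refine le_csInf (exists_chainReach hδ z) fun L hL => ?_
  rw [sub_le_iff_le_add]
  exact csInf_le (bddBelow_chainReach ha w) (ChainReach.step hL h)

/-- A step is weighted at its starting point, and chains may be prolonged from `z` to `w` or from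
`w` to `z`; the maximum covers both. -/
theorem abs_chainDist_sub_le [PreconnectedSpace X] (ha : ∀ x, 0 ≤ a x) (hδ : 0 < δ) {z w : X}
    (h : dist z w ≤ δ) :
    |chainDist a δ p z - chainDist a δ p w| ≤ max (a z) (a w) * dist z w := by
  have h1 := chainDist_le_add (p := p) ha hδ h
  have h2 := chainDist_le_add (p := p) ha hδ (dist_comm z w ▸ h)
  rw [dist_comm w z] at h2
  have h3 : a z * dist z w ≤ max (a z) (a w) * dist z w := by gcongr; exact le_max_left _ _
  have h4 : a w * dist z w ≤ max (a z) (a w) * dist z w := by gcongr; exact le_max_right _ _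
  rw [abs_le]
  constructor <;> linarith

end Chains

/-! ### Upper gradients from local Lipschitz bounds. -/

section UpperGradient

variable {X : Type u} [MetricSpace X] {a f : X → ℝ} {δ : ℝ}

theorem continuous_of_local_bound (ha : Continuous a) (hδ : 0 < δ)
    (h : ∀ z w, dist z w ≤ δ → |f z - f w| ≤ max (a z) (a w) * dist z w) : Continuous f := by
  rw [continuous_iff_continuousAt]
  intro z
  rw [ContinuousAt, tendsto_iff_dist_tendsto_zero]
  have h0 : Tendsto (fun w => max (a w) (a z) * dist w z) (𝓝 z) (𝓝 (max (a z) (a z) * dist z z)) :=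
    Continuous.tendsto (by fun_prop) z
  rw [dist_self, mul_zero] at h0
  refine tendsto_of_tendsto_of_tendsto_of_le_of_le' tendsto_const_nhds h0
    (Eventually.of_forall fun _ => dist_nonneg) ?_
  filter_upwards [Metric.closedBall_mem_nhds z hδ] with w hw
  exact h w z hw

/-- Along the arc length parametrization the right slopes of `f` are asymptotically at most `a`, by
continuity of `a`. A mean value inequality compares `f` with a primitive of `a`; `f` need not be
differentiable along the curve. -/
theorem sub_le_lineIntegral_of_local_bound (ha : Continuous a) (ha0 : ∀ x, 0 ≤ a x) (hδ : 0 < δ)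
    (h : ∀ z w, dist z w ≤ δ → |f z - f w| ≤ max (a z) (a w) * dist z w) (γ : Curve X) :
    ENNReal.ofReal (f (γ 1) - f (γ 0)) ≤ lineIntegral γ (fun x => ENNReal.ofReal (a x)) := by
  by_cases hγ : length γ = ⊤
  · rw [lineIntegral_of_length_eq_top hγ]; exact le_top
  have hf := continuous_of_local_bound ha hδ h
  have hl : 0 ≤ arc γ 1 := by rw [← arc_zero γ]; exact arc_mono hγ zero_le_one
  -- Constant extension beyond the endpoints makes the parametrization 1-Lipschitz on the whole
  -- line.
  set c : ℝ → X := fun t => natParam γ (projIcc 0 (arc γ 1) hl t) with hc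
  have hc1 : ∀ s t : ℝ, dist (c s) (c t) ≤ |s - t| := by
    intro s t
    refine (dist_natParam_le hγ (Subtype.mem _) (Subtype.mem _)).trans ?_
    have := (LipschitzWith.projIcc hl).dist_le_mul s t
    simpa [Subtype.dist_eq, Real.dist_eq] using this
  have hcc : Continuous c :=
    (LipschitzWith.of_dist_le_mul (K := 1) (by simpa [Real.dist_eq] using hc1)).continuous
  have hb : Continuous fun t => a (c t) := ha.comp hcc
  have hB : ∀ x, HasDerivAt (fun t => f (c 0) + ∫ x in (0 : ℝ)..t, a (c x)) (a (c x)) x := fun x =>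
    (hb.integral_hasStrictDerivAt 0 x).hasDerivAt.const_add _
  have key := image_le_of_liminf_slope_right_le_deriv_boundary (f := fun t => f (c t)) (a := 0)
    (b := arc γ 1) (hf.comp hcc).continuousOn (by simp)
    (fun x _ => (hB x).continuousAt.continuousWithinAt)
    (fun x _ => (hB x).hasDerivWithinAt) (by
      intro x _ r hr
      refine Eventually.frequently ?_
      have h1 : ∀ᶠ z in 𝓝[>] x, a (c z) < r :=
        (hb.tendsto x).mono_left nhdsWithin_le_nhds (Iio_mem_nhds hr)
      have h2 : ∀ᶠ z in 𝓝[>] x, z ∈ Ioc x (x + δ) := Ioc_mem_nhdsGT (by linarith)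
      filter_upwards [h1, h2] with z hz hzx
      have hzx' : 0 < z - x := sub_pos.2 hzx.1
      rw [slope_def_field, div_lt_iff₀ hzx']
      have hd : dist (c z) (c x) ≤ z - x := (hc1 z x).trans_eq (abs_of_pos hzx')
      calc f (c z) - f (c x) ≤ |f (c z) - f (c x)| := le_abs_self _
        _ ≤ max (a (c z)) (a (c x)) * dist (c z) (c x) := h _ _ (hd.trans (by linarith [hzx.2]))
        _ ≤ max (a (c z)) (a (c x)) * (z - x) := by
            gcongr; exact le_max_of_le_left (ha0 _)
        _ < r * (z - x) := by gcongr; exact max_lt hz hr)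
    (right_mem_Icc.2 hl)
  have hc0 : c 0 = γ 0 := by
    rw [hc]; simp only [projIcc_left]; rw [← natParam_arc hγ 0, arc_zero]
  have hcl : c (arc γ 1) = γ 1 := by
    rw [hc]; simp only [projIcc_right]; rw [natParam_arc hγ]
  simp only [hc0, hcl] at key
  rw [lineIntegral_eq hγ]
  have h3 : ∫⁻ τ in Icc 0 (arc γ 1), ENNReal.ofReal (a (natParam γ τ)) =
      ∫⁻ τ in Icc 0 (arc γ 1), ENNReal.ofReal (a (c τ)) := by
    refine setLIntegral_congr_fun measurableSet_Icc fun τ hτ => ?_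
    simp only [hc, projIcc_of_mem hl hτ]
  rw [h3, ← ofReal_integral_eq_lintegral_ofReal hb.continuousOn.integrableOn_Icc
    (Eventually.of_forall fun _ => ha0 _), integral_Icc_eq_integral_Ioc,
    ← intervalIntegral.integral_of_le hl]
  exact ENNReal.ofReal_le_ofReal (by linarith)

theorem isUpperGradientOn_of_local_bound [MeasurableSpace X] [BorelSpace X] (ha : Continuous a)
    (ha0 : ∀ x, 0 ≤ a x) (hδ : 0 < δ)
    (h : ∀ z w, dist z w ≤ δ → |f z - f w| ≤ max (a z) (a w) * dist z w) :
    IsUpperGradientOn univ f (fun x => ENNReal.ofReal (a x)) := by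
  refine ⟨ha.measurable.ennreal_ofReal, fun γ _ => ?_⟩
  have h1 := sub_le_lineIntegral_of_local_bound ha ha0 hδ h γ
  have h2 := sub_le_lineIntegral_of_local_bound (f := fun x => -f x) ha ha0 hδ
    (fun z w hzw => by rw [neg_sub_neg, abs_sub_comm]; exact h z w hzw) γ
  rw [edist_dist, Real.dist_eq, abs_eq_max_neg, ENNReal.ofReal_max]
  refine max_le ?_ ?_
  · rwa [neg_sub_neg] at h2
  · rwa [neg_sub]

end UpperGradient

/-! ### Limits of chains of bounded cost. -/

section ChainsToCurves

variable {X : Type u} [MetricSpace X]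

/-- A chain, parametrized by its cost. -/
theorem ChainReach.exists_param {a : X → ℝ} {δ A : ℝ} {p : X} (ha : ∀ x, 0 < a x)
    (hA : ∀ x, a x ≤ A) (hδ : 0 ≤ δ) {z : X} {L : ℝ} (h : ChainReach a δ p z L) :
    ∃ c : ℝ → X, c 0 = p ∧ (∀ t, L ≤ t → c t = z) ∧
      ∀ s t m, s ≤ t → 0 ≤ m → (∀ τ ∈ Icc s t, m ≤ a (c τ)) →
        m * dist (c s) (c t) ≤ t - s + A * δ := by
  have hAδ : 0 ≤ A * δ := mul_nonneg ((ha p).le.trans (hA p)) hδ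
  induction h with
  | refl =>
    refine ⟨fun _ => p, rfl, fun _ _ => rfl, fun s t m hst hm _ => ?_⟩
    rw [dist_self, mul_zero]
    linarith
  | @step y z L hL hyz ih =>
    obtain ⟨c, hc0, hcL, hc⟩ := ih
    by_cases hyz0 : y = z
    · subst hyz0
      exact ⟨c, hc0, fun t ht => hcL t (by simpa using ht), hc⟩
    have hd : 0 < a y * dist y z := mul_pos (ha y) (dist_pos.2 hyz0)
    have hL0 := ChainReach.nonneg (fun x => (ha x).le) hL
    set L' := L + a y * dist y z with hL'
    -- The path waits at `y` during `[L, L')`, a time equal to the cost of the step, and then jumps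
    -- to `z`. Only the waiting time in which `s` falls can be cut short, so the error is the cost
    -- of a single step, at most `A * δ`.
    refine ⟨fun t => if t < L' then c t else z, ?_, fun t ht => if_neg ht.not_gt, ?_⟩
    · beta_reduce
      rw [if_pos (show (0 : ℝ) < L' by linarith), hc0]
    intro s t m hst hm hma
    beta_reduce at hma ⊢
    have hyδ : a y * dist y z ≤ A * δ := by gcongr; exact (ha y).le.trans (hA y); exact hA y
    by_cases ht : t < L'
    · simp only [if_pos ht, if_pos (hst.trans_lt ht)]
      refine hc s t m hst hm fun τ hτ => ?_
      have := hma τ hτ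
      rwa [if_pos (hτ.2.trans_lt ht)] at this
    simp only [if_neg ht]
    rw [not_lt] at ht
    by_cases hs : s < L'
    · simp only [if_pos hs]
      by_cases hsL : L ≤ s
      · have := hma s ⟨le_rfl, hst⟩
        simp only [if_pos hs] at this
        rw [hcL s hsL] at this ⊢
        have : m * dist y z ≤ a y * dist y z := by gcongr
        linarith
      · rw [not_le] at hsL
        have hLL : L < L' := by linarith
        have h1 := hc s L m hsL.le hm fun τ hτ => by
          have := hma τ ⟨hτ.1, hτ.2.trans (hLL.le.trans ht)⟩
          rwa [if_pos (hτ.2.trans_lt hLL)] at this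
        have h2 := hma L ⟨hsL.le, hLL.le.trans ht⟩
        rw [if_pos hLL] at h2
        rw [hcL L le_rfl] at h1 h2
        have h3 : m * dist y z ≤ a y * dist y z := by gcongr
        have h4 : m * dist (c s) z ≤ m * (dist (c s) y + dist y z) := by
          gcongr; exact dist_triangle _ _ _
        linarith
    · simp only [if_neg hs, dist_self, mul_zero]
      linarith

/-- The line integral of a curve which is parametrized by a quantity that dominates the weighted
length. -/
theorem lineIntegral_le_of_weighted_bound {a : X → ℝ} (ha : Continuous a) {ε T : ℝ} (hε : 0 < ε)
    (haε : ∀ x, ε ≤ a x) (hT : 0 ≤ T) {γ : Curve X} (hγ : length γ ≠ ⊤)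
    (h : ∀ s t : unitInterval, ∀ m : ℝ, s ≤ t → 0 ≤ m → (∀ τ ∈ Icc s t, m < a (γ τ)) →
      m * dist (γ s) (γ t) ≤ T * (t - s)) :
    lineIntegral γ (fun x => ENNReal.ofReal (a x)) ≤ ENNReal.ofReal T := by
  have hmono := arc_mono hγ
  have hl : 0 ≤ arc γ 1 := by rw [← arc_zero γ]; exact hmono zero_le_one
  -- Where `a ∘ γ` stays within `η` of `v`, the hypothesis bounds `m` times the length for a lower
  -- bound `m` of `a ∘ γ`, while `a ∘ γ` exceeds `m` by at most `2 * η`.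
  have piece : ∀ η, 0 < η → η < ε → ∀ s t : unitInterval, s ≤ t → ∀ v,
      (∀ τ ∈ Icc s t, |a (γ τ) - v| < η) → ∫⁻ τ in Icc (arc γ s) (arc γ t),
        ENNReal.ofReal (a (natParam γ τ)) ≤
          ENNReal.ofReal (T * (t - s) + 2 * η * (arc γ t - arc γ s)) := by
    intro η hη hηε s t hst v hv
    have hst' : (s : ℝ) ≤ t := hst
    have harc := sub_nonneg.2 (hmono hst)
    have hm : ∀ τ ∈ Icc s t, v - η < a (γ τ) ∧ a (γ τ) < v + η := fun τ hτ => by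
      have := abs_lt.1 (hv τ hτ)
      constructor <;> linarith
    obtain ⟨m, hm0, hmv, hmη⟩ : ∃ m, 0 < m ∧ v - η ≤ m ∧ ∀ τ ∈ Icc s t, m < a (γ τ) := by
      -- The second entry keeps `m` positive, as required for the Lipschitz constant `T / m`.
      refine ⟨max (v - η) (ε - η), lt_max_of_lt_right (by linarith), le_max_left _ _, ?_⟩
      intro τ hτ
      exact max_lt (hm τ hτ).1 (by linarith [haε (γ τ)])
    have hlip : LipschitzOnWith (T / m).toNNReal γ (Icc s t) := by
      refine LipschitzOnWith.of_dist_le_mul ?_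
      have : ∀ s' ∈ Icc s t, ∀ t' ∈ Icc s t, s' ≤ t' →
          dist (γ s') (γ t') ≤ T / m * ((t' : ℝ) - s') := by
        intro s' hs' t' ht' hst'
        rw [div_mul_eq_mul_div, le_div_iff₀' hm0]
        exact h s' t' m hst' hm0.le fun τ hτ => hmη τ ⟨hs'.1.trans hτ.1, hτ.2.trans ht'.2⟩
      intro s' hs' t' ht'
      rw [Real.coe_toNNReal _ (by positivity), Subtype.dist_eq, Real.dist_eq]
      rcases le_total s' t' with hle | hle
      · have hle' : (s' : ℝ) ≤ t' := hle
        rw [abs_sub_comm, abs_of_nonneg (sub_nonneg.2 hle')]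
        exact this s' hs' t' ht' hle
      · have hle' : (t' : ℝ) ≤ s' := hle
        rw [abs_of_nonneg (sub_nonneg.2 hle'), dist_comm]
        exact this t' ht' s' hs' hle
    have hvar : m * (arc γ t - arc γ s) ≤ T * (t - s) := by
      have h1 := hlip.comp_eVariationOn_le (f := γ) (mapsTo_id (Icc s t))
      have h2 : MonotoneOn (fun t : unitInterval => (t : ℝ)) univ := fun _ _ _ _ h => h
      have h3 : eVariationOn (id : unitInterval → unitInterval) (Icc s t) =
          ENNReal.ofReal (t - s) := by
        have := h2.eVariationOn_eq (mem_univ s) (mem_univ t)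
        rwa [univ_inter] at this
      rw [Function.comp_id, h3, eVariationOn_Icc_eq_arc hγ hst, ← ENNReal.ofReal,
        ← ENNReal.ofReal_mul (by positivity), ENNReal.ofReal_le_ofReal_iff
          (mul_nonneg (by positivity) (sub_nonneg.2 hst')), div_mul_eq_mul_div,
        le_div_iff₀' hm0] at h1
      exact h1
    calc ∫⁻ τ in Icc (arc γ s) (arc γ t), ENNReal.ofReal (a (natParam γ τ))
        ≤ ∫⁻ τ in Icc (arc γ s) (arc γ t), ENNReal.ofReal (m + 2 * η) := by
          refine setLIntegral_mono_ae (by fun_prop) (Eventually.of_forall fun τ hτ => ?_)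
          obtain ⟨r, hr, rfl⟩ := exists_arc_eq hγ hst hτ
          rw [natParam_arc hγ]
          exact ENNReal.ofReal_le_ofReal (by linarith [(hm r hr).2])
      _ = ENNReal.ofReal ((m + 2 * η) * (arc γ t - arc γ s)) := by
          rw [setLIntegral_const, Real.volume_Icc, ENNReal.ofReal_mul (by positivity)]
      _ ≤ _ := ENNReal.ofReal_le_ofReal (by nlinarith)
  have hη : ∀ η, 0 < η → η < ε → lineIntegral γ (fun x => ENNReal.ofReal (a x)) ≤
      ENNReal.ofReal (T + 2 * η * arc γ 1) := by
    intro η hη hηε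
    -- A finite partition into pieces of small oscillation; the bounds add up to `T` plus an error
    -- that vanishes with `η`.
    obtain ⟨w, hw0, hw, ⟨N, hN⟩, hwU⟩ := exists_monotone_Icc_subset_open_cover_unitInterval
      (c := fun t₀ : unitInterval => {t | |a (γ t) - a (γ t₀)| < η})
      (fun t₀ => isOpen_lt (by fun_prop) continuous_const)
      (fun t _ => mem_iUnion.2 ⟨t, by simpa using hη⟩)
    have hind : ∀ n, ∫⁻ τ in Icc 0 (arc γ (w n)), ENNReal.ofReal (a (natParam γ τ)) ≤
        ENNReal.ofReal (T * w n + 2 * η * arc γ (w n)) := by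
      intro n
      induction n with
      | zero => simp [hw0]
      | succ n ih =>
        obtain ⟨t₀, ht₀⟩ := hwU n
        have hnn : w n ≤ w (n + 1) := hw n.le_succ
        have hnn' : (w n : ℝ) ≤ w (n + 1) := hnn
        have h0 : 0 ≤ arc γ (w n) := by rw [← arc_zero γ]; exact hmono (w n).2.1
        have h00 : (0 : ℝ) ≤ w n := (w n).2.1
        have h1 := sub_nonneg.2 (hmono hnn)
        rw [← lintegral_Icc_add_Icc _ h0 (hmono hnn)]
        refine (add_le_add ih (piece η hη hηε _ _ hnn _ fun τ hτ => ht₀ hτ)).trans ?_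
        have h2 : 0 ≤ (w (n + 1) : ℝ) - w n := sub_nonneg.2 hnn'
        rw [← ENNReal.ofReal_add (by positivity) (by positivity)]
        exact ENNReal.ofReal_le_ofReal (by linarith)
    have := hind N
    rw [hN N le_rfl] at this
    rw [lineIntegral_eq hγ]
    simpa using this
  refine ge_of_tendsto (x := 𝓝[>] (0 : ℝ))
    (f := fun η => ENNReal.ofReal (T + 2 * η * arc γ 1)) ?_ ?_
  · have : Tendsto (fun η : ℝ => ENNReal.ofReal (T + 2 * η * arc γ 1)) (𝓝 0)
        (𝓝 (ENNReal.ofReal (T + 2 * 0 * arc γ 1))) :=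
      Continuous.tendsto (ENNReal.continuous_ofReal.comp (by fun_prop)) 0
    rw [mul_zero, zero_mul, add_zero] at this
    exact this.mono_left nhdsWithin_le_nhds
  · filter_upwards [Ioo_mem_nhdsGT hε] with η hη' using hη η hη'.1 hη'.2

/-- Chains of bounded cost with vanishing step size, for an increasing sequence of weights,
subconverge to a Lipschitz curve. -/
theorem exists_curve_of_chains [ProperSpace X] {a : ℕ → X → ℝ} (hcont : ∀ k, Continuous (a k))
    (hmono : ∀ x, Monotone fun k => a k x) {ε : ℝ} (hε : 0 < ε) (haε : ∀ k x, ε ≤ a k x)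
    {A δ : ℕ → ℝ} (hA : ∀ k x, a k x ≤ A k) (hδ : ∀ k, 0 ≤ δ k)
    (hAδ : Tendsto (fun k => A k * δ k) atTop (𝓝 0)) {p q : X} {T : ℝ} (hT : 0 < T)
    (hchain : ∀ k, ∃ L ≤ T, ChainReach (a k) (δ k) p q L) :
    ∃ γ : Curve X, (∃ K, LipschitzWith K γ) ∧ γ 0 = p ∧ γ 1 = q ∧
      ∀ j, lineIntegral γ (fun x => ENNReal.ofReal (a j x)) ≤ ENNReal.ofReal T := by
  choose L hLT hL using hchain
  choose c₀ hc0 hcL hc using fun k => (hL k).exists_param (fun x => hε.trans_le (haε k x)) (hA k)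
    (hδ k)
  set e : ℕ → ℝ := fun k => A k * δ k with he
  -- All costs are at most `T`, so rescaling by the common factor `T` still reaches `q` at time 1.
  set c : ℕ → unitInterval → X := fun k t => c₀ k (T * t) with hcdef
  have hcp : ∀ k, c k 0 = p := fun k => by simp [hcdef, hc0]
  have hcq : ∀ k, c k 1 = q := fun k => by simp [hcdef, hcL k T (hLT k)]
  have hcb : ∀ k (s t : unitInterval) (m : ℝ), s ≤ t → 0 ≤ m → (∀ τ ∈ Icc s t, m ≤ a k (c k τ)) →
      m * dist (c k s) (c k t) ≤ T * (t - s) + e k := by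
    intro k s t m hst hm hτ
    have hst' : (s : ℝ) ≤ t := hst
    have := hc k (T * s) (T * t) m (by gcongr) hm fun τ hτ' => ?_
    · rwa [← mul_sub] at this
    · have h1 : τ / T ∈ Icc (s : ℝ) t :=
        ⟨by rw [le_div_iff₀' hT]; exact hτ'.1, by rw [div_le_iff₀' hT]; exact hτ'.2⟩
      have := hτ ⟨τ / T, s.2.1.trans h1.1, h1.2.trans t.2.2⟩ ⟨h1.1, h1.2⟩
      simpa [hcdef, mul_div_cancel₀ _ hT.ne'] using this
  have hclip : ∀ k (s t : unitInterval), ε * dist (c k s) (c k t) ≤ T * dist s t + e k := by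
    intro k s t
    rw [Subtype.dist_eq, Real.dist_eq]
    rcases le_total s t with hst | hst
    · have hst' : (s : ℝ) ≤ t := hst
      rw [abs_sub_comm, abs_of_nonneg (sub_nonneg.2 hst')]
      exact hcb k s t ε hst hε.le fun τ _ => haε k _
    · have hst' : (t : ℝ) ≤ s := hst
      rw [abs_of_nonneg (sub_nonneg.2 hst'), dist_comm]
      exact hcb k t s ε hst hε.le fun τ _ => haε k _
  obtain ⟨E, hE⟩ := hAδ.bddAbove_range
  have hball : ∀ k t, c k t ∈ Metric.closedBall p ((T + E) / ε) := by
    intro k t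
    rw [Metric.mem_closedBall, le_div_iff₀' hε, ← hcp k]
    refine (hclip k t 0).trans (add_le_add ?_ (hE ⟨k, rfl⟩))
    refine mul_le_of_le_one_right hT.le ?_
    rw [Subtype.dist_eq, Real.dist_eq]
    simpa [abs_of_nonneg t.2.1] using t.2.2
  -- An ultrafilter limit plays the role of the Arzelà–Ascoli theorem: the paths may jump and are
  -- Lipschitz only up to the error `e k`, but they stay in a compact ball and the error disappears
  -- in the limit.
  set 𝒰 : Ultrafilter ℕ := hyperfilter ℕ
  have h𝒰 : (𝒰 : Filter ℕ) ≤ atTop := Nat.hyperfilter_le_atTop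
  have hlim : ∀ t, ∃ x, Tendsto (fun k => c k t) 𝒰 (𝓝 x) := by
    intro t
    obtain ⟨x, -, hx⟩ := (isCompact_closedBall p ((T + E) / ε)).ultrafilter_le_nhds
      (𝒰.map fun k => c k t) (by
        rw [le_principal_iff]
        exact Eventually.of_forall (f := (𝒰 : Filter ℕ)) fun k => hball k t)
    exact ⟨x, hx⟩
  choose γ₀ hγ₀ using hlim
  have he0 : Tendsto e 𝒰 (𝓝 0) := hAδ.mono_left h𝒰
  have hγlip : ∀ s t : unitInterval, ε * dist (γ₀ s) (γ₀ t) ≤ T * dist s t := by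
    intro s t
    have h1 := ((hγ₀ s).dist (hγ₀ t)).const_mul ε
    have h2 := he0.const_add (T * dist s t)
    rw [add_zero] at h2
    exact le_of_tendsto_of_tendsto' h1 h2 fun k => hclip k s t
  have hlip : LipschitzWith (T / ε).toNNReal γ₀ := by
    refine LipschitzWith.of_dist_le_mul fun s t => ?_
    rw [Real.coe_toNNReal _ (by positivity), div_mul_eq_mul_div, le_div_iff₀' hε]
    exact hγlip s t
  set γ : Curve X := ⟨γ₀, hlip.continuous⟩ with hγ
  refine ⟨γ, ⟨_, hlip⟩, tendsto_nhds_unique (hγ₀ 0) (by simp [hcp]),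
    tendsto_nhds_unique (hγ₀ 1) (by simp [hcq]), fun j => ?_⟩
  refine lineIntegral_le_of_weighted_bound (hcont j) hε (haε j) hT.le
    (length_ne_top_of_lipschitz ⟨_, hlip⟩) fun s t m hst hm hma => ?_
  -- The strict inequality along the limit curve passes to the approximating paths by compactness:
  -- times of failure would converge to some `τ₀` with `a j (γ₀ τ₀) ≤ m`.
  have hev : ∀ᶠ k in (𝒰 : Filter ℕ), ∀ τ ∈ Icc s t, m ≤ a j (c k τ) := by
    by_contra hcon
    rw [← Ultrafilter.eventually_not] at hcon
    have hex : ∀ k, ∃ τ ∈ Icc s t, (¬ ∀ τ ∈ Icc s t, m ≤ a j (c k τ)) → a j (c k τ) < m := by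
      intro k
      by_cases h : ∀ τ ∈ Icc s t, m ≤ a j (c k τ)
      · exact ⟨s, left_mem_Icc.2 hst, fun h' => absurd h h'⟩
      · have h' := h
        push Not at h'
        obtain ⟨τ, hτ, hlt⟩ := h'
        exact ⟨τ, hτ, fun _ => hlt⟩
    choose τ hτ hτm using hex
    obtain ⟨τ₀, hτ₀, hτlim⟩ := (isCompact_Icc (a := s) (b := t)).ultrafilter_le_nhds (𝒰.map τ) (by
      rw [le_principal_iff]
      exact Eventually.of_forall (f := (𝒰 : Filter ℕ)) hτ)
    have hτlim' : Tendsto τ 𝒰 (𝓝 τ₀) := hτlim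
    have hcτ : Tendsto (fun k => c k (τ k)) 𝒰 (𝓝 (γ₀ τ₀)) := by
      rw [tendsto_iff_dist_tendsto_zero]
      have h1 : Tendsto (fun k => (T * dist (τ k) τ₀ + e k) / ε + dist (c k τ₀) (γ₀ τ₀)) 𝒰
          (𝓝 ((T * 0 + 0) / ε + 0)) :=
        ((((tendsto_iff_dist_tendsto_zero.1 hτlim').const_mul T).add he0).div_const ε).add
          (tendsto_iff_dist_tendsto_zero.1 (hγ₀ τ₀))
      norm_num at h1
      refine tendsto_of_tendsto_of_tendsto_of_le_of_le tendsto_const_nhds h1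
        (fun k => dist_nonneg) fun k => (dist_triangle _ (c k τ₀) _).trans ?_
      gcongr
      rw [le_div_iff₀' hε]
      exact hclip k _ _
    have h2 : a j (γ₀ τ₀) ≤ m :=
      le_of_tendsto (((hcont j).tendsto _).comp hcτ) (hcon.mono fun k hk => (hτm k hk).le)
    exact absurd (hma τ₀ hτ₀) h2.not_gt
  -- For `k ≥ j` the lower bound `m` for `a j` is also one for `a k`, so the estimate for the `k`-th
  -- chain applies.
  have hev2 : ∀ᶠ k in (𝒰 : Filter ℕ), j ≤ k := h𝒰 (eventually_ge_atTop j)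
  have h1 := ((hγ₀ s).dist (hγ₀ t)).const_mul m
  have h2 := he0.const_add (T * ((t : ℝ) - s))
  rw [add_zero] at h2
  refine le_of_tendsto_of_tendsto h1 h2 ?_
  filter_upwards [hev, hev2] with k hk hjk
  exact hcb k s t m hst hm fun τ hτ => (hk τ hτ).trans (hmono _ hjk)

end ChainsToCurves

/-! ### Continuous approximation from below. -/

section LowerSemicontinuous

variable {X : Type u} [MetricSpace X]

/-- The inf-convolutions approximating a lower semicontinuous function from below. -/
noncomputable def infConv (h : X → ℝ≥0∞) (ε : ℝ) (k : ℕ) (x : X) : ℝ :=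
  ⨅ z, (min (h z) (ENNReal.ofReal (k + ε))).toReal + k * dist x z

variable {h : X → ℝ≥0∞} {ε : ℝ}

theorem infConv_term_ge (hh : ∀ x, ENNReal.ofReal ε ≤ h x) (k : ℕ) (x z : X) :
    ε ≤ (min (h z) (ENNReal.ofReal (k + ε))).toReal + k * dist x z := by
  have h1 : ENNReal.ofReal ε ≤ min (h z) (ENNReal.ofReal (k + ε)) :=
    le_min (hh z) (ENNReal.ofReal_le_ofReal (by linarith [Nat.cast_nonneg (α := ℝ) k]))
  have h2 := (ENNReal.ofReal_le_iff_le_toReal (by simp)).1 h1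
  have : 0 ≤ k * dist x z := by positivity
  linarith

theorem infConv_bddBelow (hh : ∀ x, ENNReal.ofReal ε ≤ h x) (k : ℕ) (x : X) : BddBelow (range fun z =>
    (min (h z) (ENNReal.ofReal (k + ε))).toReal + k * dist x z) :=
  ⟨ε, by rintro _ ⟨z, rfl⟩; exact infConv_term_ge hh k x z⟩

theorem le_infConv (hh : ∀ x, ENNReal.ofReal ε ≤ h x) (k : ℕ) (x : X) : ε ≤ infConv h ε k x :=
  have : Nonempty X := ⟨x⟩
  le_ciInf fun z => infConv_term_ge hh k x z

theorem infConv_le_toReal (hh : ∀ x, ENNReal.ofReal ε ≤ h x) (k : ℕ) (x : X) :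
    infConv h ε k x ≤ (min (h x) (ENNReal.ofReal (k + ε))).toReal := by
  have := ciInf_le (infConv_bddBelow hh k x) x
  rw [dist_self, mul_zero, add_zero] at this
  exact this

theorem infConv_le_nat (hε : 0 < ε) (hh : ∀ x, ENNReal.ofReal ε ≤ h x)
    (k : ℕ) (x : X) : infConv h ε k x ≤ k + ε := by
  refine (infConv_le_toReal hh k x).trans ?_
  have := ENNReal.toReal_mono (by simp) (min_le_right (h x) (ENNReal.ofReal (k + ε)))
  rwa [ENNReal.toReal_ofReal (by positivity)] at this

theorem ofReal_infConv_le (hh : ∀ x, ENNReal.ofReal ε ≤ h x) (k : ℕ) (x : X) : ENNReal.ofReal (infConv h ε k x) ≤ h x := by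
  refine (ENNReal.ofReal_le_ofReal (infConv_le_toReal hh k x)).trans ?_
  rw [ENNReal.ofReal_toReal (ne_top_of_le_ne_top ENNReal.ofReal_ne_top (min_le_right _ _))]
  exact min_le_left _ _

theorem infConv_mono (hh : ∀ x, ENNReal.ofReal ε ≤ h x) (x : X) : Monotone fun k => infConv h ε k x := by
  intro j k hjk
  have : Nonempty X := ⟨x⟩
  refine ciInf_mono (infConv_bddBelow hh j x) fun z => ?_
  gcongr
  · exact ne_top_of_le_ne_top ENNReal.ofReal_ne_top (min_le_right _ _)

theorem infConv_continuous (hh : ∀ x, ENNReal.ofReal ε ≤ h x) (k : ℕ) : Continuous (infConv h ε k) := by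
  have key : ∀ x y, infConv h ε k x ≤ infConv h ε k y + k * dist x y := by
    intro x y
    have : Nonempty X := ⟨x⟩
    rw [← sub_le_iff_le_add]
    refine le_ciInf fun z => ?_
    rw [sub_le_iff_le_add]
    refine (ciInf_le (infConv_bddBelow hh k x) z).trans ?_
    have : (k : ℝ) * dist x z ≤ k * (dist x y + dist y z) := by gcongr; exact dist_triangle _ _ _
    linarith
  refine LipschitzWith.continuous (K := k) (LipschitzWith.of_le_add_mul _ ?_)
  simpa using key

/-- Given `b < h x`, semicontinuity keeps `h` above `b` on a ball of radius `r`. Once `k ≥ b` and `k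
* r ≥ b`, points inside the ball contribute at least `b` through the truncated `h`, points outside
through the penalty `k * dist x z`. -/
theorem iSup_ofReal_infConv (hε : 0 < ε) (hh : ∀ x, ENNReal.ofReal ε ≤ h x)
    (hlsc : LowerSemicontinuous h) (x : X) :
    ⨆ k, ENNReal.ofReal (infConv h ε k x) = h x := by
  refine le_antisymm (iSup_le fun k => ofReal_infConv_le hh k x) ?_
  refine ENNReal.le_of_forall_nnreal_lt fun b hb => ?_
  have : Nonempty X := ⟨x⟩
  obtain ⟨r, hr, hball⟩ := Metric.eventually_nhds_iff_ball.1 (hlsc x b hb)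
  obtain ⟨k, hk⟩ := exists_nat_ge (max (b : ℝ) (b / r))
  refine le_iSup_of_le k ?_
  rw [ENNReal.le_ofReal_iff_toReal_le ENNReal.coe_ne_top (hε.le.trans (le_infConv hh k x)),
    ENNReal.coe_toReal]
  refine le_ciInf fun z => ?_
  by_cases hz : z ∈ Metric.ball x r
  · have h1 : (b : ℝ≥0∞) ≤ min (h z) (ENNReal.ofReal (k + ε)) := by
      refine le_min (hball z hz).le ?_
      rw [ENNReal.le_ofReal_iff_toReal_le ENNReal.coe_ne_top (by positivity), ENNReal.coe_toReal]
      linarith [(le_max_left _ _).trans hk]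
    have h2 := ENNReal.toReal_mono
      (ne_top_of_le_ne_top ENNReal.ofReal_ne_top (min_le_right _ _)) h1
    rw [ENNReal.coe_toReal] at h2
    have : 0 ≤ k * dist x z := by positivity
    linarith
  · rw [Metric.mem_ball, not_lt, dist_comm] at hz
    have h1 := (div_le_iff₀ hr).1 ((le_max_right _ _).trans hk)
    have h2 : (k : ℝ) * r ≤ k * dist x z := by gcongr
    have h3 : 0 ≤ (min (h z) (ENNReal.ofReal (k + ε))).toReal := ENNReal.toReal_nonneg
    linarith

end LowerSemicontinuous

/-- The line integral commutes with increasing limits of continuous functions. -/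
theorem lineIntegral_iSup {X : Type u} [MetricSpace X] {γ : Curve X} (hγ : length γ ≠ ⊤)
    {a : ℕ → X → ℝ} (ha : ∀ k, Continuous (a k)) (hmono : ∀ x, Monotone fun k => a k x) :
    lineIntegral γ (fun x => ⨆ k, ENNReal.ofReal (a k x)) =
      ⨆ k, lineIntegral γ (fun x => ENNReal.ofReal (a k x)) := by
  simp_rw [lineIntegral_eq hγ]
  refine lintegral_iSup' (fun k => ?_) (Eventually.of_forall fun τ j k hjk =>
    ENNReal.ofReal_le_ofReal (hmono _ hjk))
  exact (((ha k).comp_continuousOn (continuousOn_natParam hγ)).aemeasurable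
    measurableSet_Icc).ennreal_ofReal

/-! ### Diameters of concentric balls. -/

section Diameters

variable {X : Type u} [MetricSpace X]

theorem ediam_ball_le_ofReal (x : X) (r : ℝ) :
    Metric.ediam (Metric.ball x r) ≤ ENNReal.ofReal (2 * r) := by
  refine Metric.ediam_le fun y hy z hz => ?_
  rw [edist_dist]
  refine ENNReal.ofReal_le_ofReal ?_
  rw [Metric.mem_ball] at hy
  rw [Metric.mem_ball'] at hz
  linarith [dist_triangle y x z]

/-- In a connected space the diameters of concentric balls are comparable. -/
theorem ediam_ball_mul_le [PreconnectedSpace X] (x : X) {r K : ℝ} (hr : 0 < r) (hK : 1 ≤ K) :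
    Metric.ediam (Metric.ball x (K * r)) ≤
      ENNReal.ofReal (2 * K) * Metric.ediam (Metric.ball x r) := by
  by_cases h : Metric.ball x r = univ
  · rw [h]
    refine (Metric.ediam_mono (subset_univ _)).trans (le_mul_of_one_le_left' ?_)
    rw [ENNReal.one_le_ofReal]
    linarith
  · obtain ⟨y, hy⟩ := (ne_univ_iff_exists_notMem _).1 h
    rw [Metric.mem_ball, not_lt] at hy
    -- Some point lies at distance at least `r` from `x`; by connectedness the distance to `x` then
    -- takes every value in `[0, r)`.
    have hdiam : ENNReal.ofReal r ≤ Metric.ediam (Metric.ball x r) := by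
      refine le_of_forall_lt fun s hs => ?_
      obtain ⟨s', hss', hs'r⟩ := exists_between hs
      refine hss'.trans_le ?_
      have hs'top : s' ≠ ⊤ := ne_top_of_lt hs'r
      obtain ⟨z, hz⟩ := mem_range_of_exists_le_of_exists_ge (c := s'.toReal)
        (f := fun z => dist z x) (by fun_prop) ⟨x, by simp⟩
        ⟨y, (ENNReal.toReal_le_of_le_ofReal hr.le hs'r.le).trans hy⟩
      have hzr : dist z x < r := by
        have hz' : dist z x = s'.toReal := hz
        rw [hz', ← ENNReal.ofReal_lt_ofReal_iff hr, ENNReal.ofReal_toReal hs'top]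
        exact hs'r
      have h1 := Metric.edist_le_ediam_of_mem (Metric.mem_ball.2 hzr) (Metric.mem_ball_self hr)
      have hz' : dist z x = s'.toReal := hz
      rwa [edist_dist, hz', ENNReal.ofReal_toReal hs'top] at h1
    refine (ediam_ball_le_ofReal x (K * r)).trans ?_
    rw [← mul_assoc, ENNReal.ofReal_mul (by linarith)]
    gcongr

end Diameters

/-! ### Doubling at all scales and connectedness. -/

section Geometry

variable {X : Type u} [MetricSpace X] [MeasurableSpace X] {μ : Measure X}

theorem BallsPosFinite.isLocallyFiniteMeasure (hμ : BallsPosFinite μ) :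
    IsLocallyFiniteMeasure μ :=
  ⟨fun x => ⟨Metric.ball x 1, Metric.ball_mem_nhds x one_pos, (hμ x 1 one_pos).2⟩⟩

theorem BallsPosFinite.isOpenPosMeasure (hμ : BallsPosFinite μ) : μ.IsOpenPosMeasure := by
  refine ⟨fun U hU ⟨x, hx⟩ h0 => ?_⟩
  obtain ⟨r, hr, hball⟩ := Metric.isOpen_iff.1 hU x hx
  exact (hμ x r hr).1.ne' (measure_mono_null hball h0)

/-- A doubling measure satisfies the doubling condition at all scales. -/
theorem DoublingWith.measure_ball_le {C : ℝ} (hd : DoublingWith C μ) (hC : 1 ≤ C) (x : X)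
    {r : ℝ} (hr : 0 < r) :
    μ (Metric.ball x (2 * r)) ≤ ENNReal.ofReal C * μ (Metric.ball x r) := by
  by_cases h : ENNReal.ofReal r < Metric.ediam (univ : Set X)
  · exact hd x r hr h
  rw [not_lt] at h
  have hC' : 1 ≤ ENNReal.ofReal C := ENNReal.one_le_ofReal.2 hC
  have hbd : ∀ s, Metric.ediam (univ : Set X) < ENNReal.ofReal s →
      Metric.ball x s = univ := by
    intro s hs
    refine eq_univ_of_forall fun y => ?_
    have h1 := (Metric.edist_le_ediam_of_mem (mem_univ y) (mem_univ x)).trans_lt hs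
    rw [edist_dist] at h1
    exact Metric.mem_ball.2 (ENNReal.ofReal_lt_ofReal_iff'.1 h1).1
  rcases h.lt_or_eq with h | h
  · rw [hbd r h]
    exact (measure_mono (subset_univ _)).trans (le_mul_of_one_le_left' hC')
  -- In the borderline case where `r` is the diameter, the ball of radius `3r/2` is already the
  -- whole space, and `3r/4` is a radius to which the doubling condition applies.
  · have h1 : Metric.ball x (2 * (3 / 4 * r)) = univ := by
      apply hbd
      rw [h]
      exact (ENNReal.ofReal_lt_ofReal_iff (by positivity)).2 (by linarith)
    have h2 := hd x (3 / 4 * r) (by positivity) (by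
      rw [h]; exact (ENNReal.ofReal_lt_ofReal_iff hr).2 (by linarith))
    rw [h1] at h2
    refine (measure_mono (subset_univ _)).trans (h2.trans ?_)
    gcongr
    linarith

/-- A space that supports a Poincaré inequality is connected. -/
theorem PoincareWith.preconnectedSpace [BorelSpace X] {q C σ : ℝ} (hq : 0 < q)
    (hP : PoincareWith q C σ μ) (hμ : BallsPosFinite μ) : PreconnectedSpace X := by
  have := hμ.isLocallyFiniteMeasure
  have := hμ.isOpenPosMeasure
  rw [preconnectedSpace_iff_clopen]
  intro A hA
  by_contra! hcon
  obtain ⟨hne, hnu⟩ := hcon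
  obtain ⟨x, hx⟩ := hne
  obtain ⟨y, hy⟩ := (ne_univ_iff_exists_notMem A).1 hnu
  -- The indicator of a clopen set is constant along every curve, so zero is an upper gradient. The
  -- Poincaré inequality then makes it constant almost everywhere on a ball that meets both `A` and
  -- its complement.
  set w : X → ℝ := A.indicator 1 with hw
  have hug : IsUpperGradientOn univ w (fun _ => 0) := by
    refine ⟨measurable_const, fun γ _ => ?_⟩
    have : w (γ 0) = w (γ 1) := by
      rcases isClopen_iff.1 (hA.preimage γ.continuous) with h | h
      · have h' : ∀ t, γ t ∉ A := fun t ht => by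
          have : t ∈ γ ⁻¹' A := ht
          rw [h] at this; exact this
        rw [hw, indicator_of_notMem (h' 0), indicator_of_notMem (h' 1)]
      · have h' : ∀ t, γ t ∈ A := fun t => by
          have : t ∈ γ ⁻¹' A := by rw [h]; trivial
          exact this
        rw [hw, indicator_of_mem (h' 0), indicator_of_mem (h' 1)]; rfl
    rw [this, edist_self]
    exact bot_le
  have hint : LocallyIntegrable w μ :=
    (locallyIntegrable_const (1 : ℝ)).indicator hA.isOpen.measurableSet
  set r := dist y x + 1 with hr
  have hr0 : 0 < r := by positivity
  have h := hP w _ hint hug x r hr0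
  rw [ENNReal.zero_rpow_of_pos hq, laverage_zero, ENNReal.zero_rpow_of_pos (by positivity),
    mul_zero, nonpos_iff_eq_zero, setLAverage_eq, ENNReal.div_eq_zero_iff,
    or_iff_left (hμ x r hr0).2.ne] at h
  have hmeas : Measurable w := measurable_one.indicator hA.isOpen.measurableSet
  rw [lintegral_eq_zero_iff (by fun_prop)] at h
  set m := ⨍ z in Metric.ball x r, w z ∂μ
  have hae : ∀ U : Set X, IsOpen U → (U ∩ Metric.ball x r).Nonempty →
      ∃ z ∈ U, w z = m := by
    intro U hU hne
    have hpos := (hU.inter Metric.isOpen_ball).measure_pos μ hne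
    rw [EventuallyEq, ae_restrict_iff' Metric.isOpen_ball.measurableSet] at h
    by_contra! hno
    refine hpos.ne' (measure_mono_null ?_ h)
    intro z hz h'
    have h0 := h' hz.2
    simp only [Pi.zero_apply, enorm_eq_zero, sub_eq_zero] at h0
    exact hno z hz.1 h0
  obtain ⟨z, hzA, hz⟩ := hae A hA.isOpen ⟨x, hx, Metric.mem_ball_self hr0⟩
  obtain ⟨z', hzA', hz'⟩ := hae Aᶜ hA.compl.isOpen ⟨y, hy, by rw [Metric.mem_ball, hr]; linarith⟩
  rw [← hz, hw, indicator_of_notMem hzA', indicator_of_mem hzA] at hz'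
  exact zero_ne_one hz'

end Geometry

/-! ### Dyadic sums of Poincaré bounds. -/

section PoincareSum

variable {X : Type u} [MetricSpace X] [MeasurableSpace X] {μ : Measure X} {Q σ : ℝ}

/-- The sum over the balls `B(p,r/2ⁿ)` of the right-hand sides of the Poincaré inequality. -/
noncomputable def poincareSum (μ : Measure X) (Q σ : ℝ) (G : X → ℝ≥0∞) (p : X) (r : ℝ) : ℝ≥0∞ :=
  ∑' n : ℕ, Metric.ediam (Metric.ball p (r / 2 ^ n)) *
    (⨍⁻ y in Metric.ball p (σ * (r / 2 ^ n)), G y ^ Q ∂μ) ^ (1 / Q)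

theorem poincareSum_mono {G H : X → ℝ≥0∞} (hQ : 0 ≤ Q) (h : ∀ x, G x ≤ H x) (p : X) (r : ℝ) :
    poincareSum μ Q σ G p r ≤ poincareSum μ Q σ H p r := by
  refine ENNReal.tsum_le_tsum fun n => ?_
  gcongr
  exact Eventually.of_forall fun y => ENNReal.rpow_le_rpow (h y) hQ

theorem poincareSum_add_le {G H : X → ℝ≥0∞} (hQ : 1 ≤ Q) (hG : Measurable G) (hH : Measurable H)
    (p : X) (r : ℝ) :
    poincareSum μ Q σ (fun x => G x + H x) p r ≤
      poincareSum μ Q σ G p r + poincareSum μ Q σ H p r := by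
  rw [poincareSum, poincareSum, poincareSum, ← ENNReal.tsum_add]
  refine ENNReal.tsum_le_tsum fun n => ?_
  rw [← mul_add]
  gcongr
  exact ENNReal.lintegral_Lp_add_le hG.aemeasurable hH.aemeasurable hQ

theorem poincareSum_const_mul {G : X → ℝ≥0∞} (hQ : 0 < Q) {c : ℝ≥0∞} (hc : c ≠ ⊤)
    (p : X) (r : ℝ) :
    poincareSum μ Q σ (fun x => c * G x) p r = c * poincareSum μ Q σ G p r := by
  rw [poincareSum, poincareSum, ← ENNReal.tsum_mul_left]
  refine tsum_congr fun n => ?_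
  simp_rw [ENNReal.mul_rpow_of_nonneg _ _ hQ.le]
  rw [laverage_eq', lintegral_const_mul' _ _ (ENNReal.rpow_ne_top_of_nonneg hQ.le hc),
    ENNReal.mul_rpow_of_nonneg _ _ (by positivity), ← ENNReal.rpow_mul, mul_one_div_cancel hQ.ne',
    ENNReal.rpow_one, mul_left_comm]
  rfl

end PoincareSum

/-! ### The telescoping argument. -/

section Telescoping

variable {X : Type u} [MetricSpace X] [ProperSpace X] [MeasurableSpace X] [BorelSpace X]
  {μ : Measure X}

theorem Continuous.integrableOn_ball' [IsLocallyFiniteMeasure μ] {f : X → ℝ} (hf : Continuous f)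
    (x : X) (r : ℝ) : IntegrableOn f (Metric.ball x r) μ :=
  (hf.continuousOn.integrableOn_compact (isCompact_closedBall x r)).mono_set
    Metric.ball_subset_closedBall

theorem edist_average_le (hμ : BallsPosFinite μ) {f : X → ℝ} (hf : Continuous f) {p q : X}
    {r s : ℝ} (hr : 0 < r) (hs : 0 < s) (hsub : Metric.ball q s ⊆ Metric.ball p r) {M : ℝ≥0∞}
    (hM : μ (Metric.ball p r) ≤ M * μ (Metric.ball q s)) (m : ℝ) :
    edist (⨍ z in Metric.ball q s, f z ∂μ) m ≤
      M * ⨍⁻ z in Metric.ball p r, ‖f z - m‖ₑ ∂μ := by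
  have := hμ.isLocallyFiniteMeasure
  have hq := hμ q s hs
  have hp := hμ p r hr
  have hne : NeZero (μ.restrict (Metric.ball q s)) :=
    ⟨fun h => hq.1.ne' (by rw [← Measure.restrict_apply_univ, h]; rfl)⟩
  have hfin : IsFiniteMeasure (μ.restrict (Metric.ball q s)) :=
    ⟨by rw [Measure.restrict_apply_univ]; exact hq.2⟩
  have h1 : (⨍ z in Metric.ball q s, f z ∂μ) - m = ⨍ z in Metric.ball q s, (f z - m) ∂μ := by
    have hc : ⨍ _ in Metric.ball q s, m ∂μ = m := average_const _ m
    rw [average_eq] at hc ⊢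
    rw [average_eq, integral_sub (Continuous.integrableOn_ball' hf q s) (integrable_const m),
      smul_sub, hc]
  rw [edist_eq_enorm_sub, h1]
  calc ‖⨍ z in Metric.ball q s, (f z - m) ∂μ‖ₑ
      ≤ ⨍⁻ z in Metric.ball q s, ‖f z - m‖ₑ ∂μ := enorm_integral_le_lintegral_enorm _
    _ = (∫⁻ z in Metric.ball q s, ‖f z - m‖ₑ ∂μ) / μ (Metric.ball q s) := setLAverage_eq _ _ _
    _ ≤ (∫⁻ z in Metric.ball p r, ‖f z - m‖ₑ ∂μ) / μ (Metric.ball q s) := by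
        gcongr
    _ ≤ M * ((∫⁻ z in Metric.ball p r, ‖f z - m‖ₑ ∂μ) / μ (Metric.ball p r)) := by
        rw [div_eq_mul_inv, div_eq_mul_inv, mul_left_comm]
        gcongr
        rw [← div_eq_mul_inv, ENNReal.le_div_iff_mul_le (Or.inl hp.1.ne') (Or.inl hp.2.ne),
          mul_comm, ← div_eq_mul_inv]
        exact ENNReal.div_le_of_le_mul hM
    _ = M * ⨍⁻ z in Metric.ball p r, ‖f z - m‖ₑ ∂μ := by rw [setLAverage_eq]

theorem tendsto_average_ball (hμ : BallsPosFinite μ) {f : X → ℝ} (hf : Continuous f) (p : X)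
    {s : ℕ → ℝ} (hs0 : ∀ n, 0 < s n) (hs : Tendsto s atTop (𝓝 0)) :
    Tendsto (fun n => ⨍ z in Metric.ball p (s n), f z ∂μ) atTop (𝓝 (f p)) := by
  have := hμ.isLocallyFiniteMeasure
  rw [Metric.tendsto_nhds]
  intro ε hε
  obtain ⟨δ, hδ, hball⟩ := Metric.continuousAt_iff.1 hf.continuousAt (ε / 2) (half_pos hε)
  filter_upwards [hs.eventually_lt_const hδ] with n hn
  have h1 : (⨍ z in Metric.ball p (s n), f z ∂μ) ∈ Metric.closedBall (f p) (ε / 2) := by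
    refine (convex_closedBall (f p) (ε / 2)).set_average_mem Metric.isClosed_closedBall
      (hμ p _ (hs0 n)).1.ne' (hμ p _ (hs0 n)).2.ne ?_ (Continuous.integrableOn_ball' hf p (s n))
    refine ae_restrict_of_forall_mem Metric.isOpen_ball.measurableSet fun z hz => ?_
    exact (hball ((Metric.mem_ball.1 hz).trans hn)).le
  exact (Metric.mem_closedBall.1 h1).trans_lt (half_lt_self hε)

variable {Q Cμ CP σ : ℝ}

/-- The averages over the balls `B(p, r/2ⁿ)` tend to `f p` by continuity, and doubling with the
Poincaré inequality bounds each difference of consecutive averages by a multiple of one term of the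
sum. -/
theorem edist_average_le_poincareSum (hμ : BallsPosFinite μ) (hCμ : 1 ≤ Cμ)
    (hd : DoublingWith Cμ μ) (hP : PoincareWith Q CP σ μ) {f : X → ℝ} (hf : Continuous f)
    {G : X → ℝ≥0∞} (hG : IsUpperGradientOn univ f G) (p : X) {r : ℝ} (hr : 0 < r) :
    edist (⨍ z in Metric.ball p r, f z ∂μ) (f p) ≤
      ENNReal.ofReal Cμ * ENNReal.ofReal CP * poincareSum μ Q σ G p r := by
  have := hμ.isLocallyFiniteMeasure
  have hs0 : ∀ n : ℕ, 0 < r / 2 ^ n := fun n => by positivity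
  have hs : Tendsto (fun n : ℕ => r / 2 ^ n) atTop (𝓝 0) := by
    have := (tendsto_pow_atTop_nhds_zero_of_lt_one (r := (1 / 2 : ℝ)) (by norm_num)
      (by norm_num)).const_mul r
    rw [mul_zero] at this
    refine this.congr fun n => ?_
    rw [one_div, inv_pow, div_eq_mul_inv]
  have key := edist_le_tsum_of_edist_le_of_tendsto₀
    (f := fun n : ℕ => ⨍ z in Metric.ball p (r / 2 ^ n), f z ∂μ)
    (fun n : ℕ => ENNReal.ofReal Cμ * ENNReal.ofReal CP *
      (Metric.ediam (Metric.ball p (r / 2 ^ n)) *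
        (⨍⁻ y in Metric.ball p (σ * (r / 2 ^ n)), G y ^ Q ∂μ) ^ (1 / Q))) ?_
    (tendsto_average_ball hμ hf p hs0 hs)
  · rw [ENNReal.tsum_mul_left] at key
    simpa [poincareSum] using key
  · intro n
    have hhalf : r / 2 ^ n = 2 * (r / 2 ^ (n + 1)) := by rw [pow_succ]; field_simp
    rw [edist_comm]
    refine (edist_average_le hμ hf (hs0 n) (hs0 (n + 1)) (Metric.ball_subset_ball ?_)
      (M := ENNReal.ofReal Cμ) ?_ _).trans ?_
    · rw [hhalf]; linarith [hs0 (n + 1)]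
    · rw [hhalf]; exact hd.measure_ball_le hCμ p (hs0 (n + 1))
    · rw [mul_assoc, ← mul_assoc (ENNReal.ofReal CP)]
      gcongr
      exact hP f G hf.locallyIntegrable hG p _ (hs0 n)

/-- The telescoping estimate for the oscillation of a continuous function with a given upper
gradient. -/
theorem edist_le_poincareSum (hμ : BallsPosFinite μ) (hCμ : 1 ≤ Cμ)
    (hd : DoublingWith Cμ μ) (hP : PoincareWith Q CP σ μ) {f : X → ℝ} (hf : Continuous f)
    {G : X → ℝ≥0∞} (hG : IsUpperGradientOn univ f G) {p q : X} (hpq : p ≠ q) :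
    edist (f p) (f q) ≤ ENNReal.ofReal (2 * Cμ ^ 2 * CP) *
      (poincareSum μ Q σ G p (2 * dist p q) + poincareSum μ Q σ G q (dist p q)) := by
  have := hμ.isLocallyFiniteMeasure
  set D := dist p q
  have hD : 0 < D := dist_pos.2 hpq
  have h1 := edist_average_le_poincareSum hμ hCμ hd hP hf hG p (r := 2 * D) (by positivity)
  have h2 := edist_average_le_poincareSum hμ hCμ hd hP hf hG q hD
  set c := ENNReal.ofReal Cμ with hc
  have hc1 : 1 ≤ c := ENNReal.one_le_ofReal.2 hCμ
  have hsub : Metric.ball q D ⊆ Metric.ball p (2 * D) := by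
    refine Metric.ball_subset_ball' ?_
    rw [dist_comm q p]; linarith
  -- Passing from `B(p, 2D)` to `B(q, D)` through `B(q, 4D)` costs two doublings. The resulting term
  -- is again dominated by the sum at `p`, whence the final factor 2.
  have hM : μ (Metric.ball p (2 * D)) ≤ c ^ 2 * μ (Metric.ball q D) := by
    calc μ (Metric.ball p (2 * D)) ≤ μ (Metric.ball q (2 * (2 * D))) := by
          refine measure_mono (Metric.ball_subset_ball' ?_)
          change 2 * D + D ≤ _
          linarith
      _ ≤ c * μ (Metric.ball q (2 * D)) := hd.measure_ball_le hCμ q (by positivity)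
      _ ≤ c * (c * μ (Metric.ball q D)) := by gcongr; exact hd.measure_ball_le hCμ q hD
      _ = _ := by ring
  have h3 : edist (⨍ z in Metric.ball q D, f z ∂μ) (⨍ z in Metric.ball p (2 * D), f z ∂μ) ≤
      c ^ 2 * ENNReal.ofReal CP * poincareSum μ Q σ G p (2 * D) := by
    refine (edist_average_le hμ hf (by positivity) hD hsub hM _).trans ?_
    rw [mul_assoc]
    gcongr
    refine (hP f G hf.locallyIntegrable hG p (2 * D) (by positivity)).trans ?_
    rw [mul_assoc]
    gcongr
    have := ENNReal.le_tsum (f := fun n : ℕ => Metric.ediam (Metric.ball p (2 * D / 2 ^ n)) *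
      (⨍⁻ y in Metric.ball p (σ * (2 * D / 2 ^ n)), G y ^ Q ∂μ) ^ (1 / Q)) 0
    simpa [poincareSum] using this
  have hcc : c ≤ c ^ 2 := by rw [sq]; exact le_mul_of_one_le_left' hc1
  have hK : ENNReal.ofReal (2 * Cμ ^ 2 * CP) = 2 * (c ^ 2 * ENNReal.ofReal CP) := by
    rw [ENNReal.ofReal_mul (by positivity), ENNReal.ofReal_mul (by positivity),
      ENNReal.ofReal_pow (by positivity), ← hc]
    norm_num [mul_assoc]
  rw [hK]
  set S1 := poincareSum μ Q σ G p (2 * D)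
  set S2 := poincareSum μ Q σ G q D
  set P := ENNReal.ofReal CP
  rw [edist_comm] at h1
  calc edist (f p) (f q)
      ≤ edist (f p) (⨍ z in Metric.ball p (2 * D), f z ∂μ) +
        edist (⨍ z in Metric.ball p (2 * D), f z ∂μ) (⨍ z in Metric.ball q D, f z ∂μ) +
          edist (⨍ z in Metric.ball q D, f z ∂μ) (f q) := edist_triangle4 _ _ _ _
    _ ≤ c ^ 2 * P * S1 + c ^ 2 * P * S1 + c ^ 2 * P * S2 := by
        refine add_le_add (add_le_add (h1.trans ?_) ?_) (h2.trans ?_)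
        · gcongr
        · rwa [edist_comm]
        · gcongr
    _ ≤ c ^ 2 * P * S1 + c ^ 2 * P * S1 + (c ^ 2 * P * S2 + c ^ 2 * P * S2) := by
        gcongr; exact le_self_add
    _ = 2 * (c ^ 2 * P) * (S1 + S2) := by ring

end Telescoping

theorem tsum_ediam_rpow_le {X : Type u} [MetricSpace X] (x : X) {r t : ℝ} (hr : 0 ≤ r)
    (ht : 0 ≤ t) :
    ∑' n : ℕ, Metric.ediam (Metric.ball x (r / 2 ^ n)) ^ t ≤
      ENNReal.ofReal (2 * r) ^ t * (1 - ENNReal.ofReal ((1 / 2) ^ t))⁻¹ := by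
  rw [← ENNReal.tsum_geometric, ← ENNReal.tsum_mul_left]
  refine ENNReal.tsum_le_tsum fun n => ?_
  calc Metric.ediam (Metric.ball x (r / 2 ^ n)) ^ t
      ≤ ENNReal.ofReal (2 * (r / 2 ^ n)) ^ t := by gcongr; exact ediam_ball_le_ofReal _ _
    _ = ENNReal.ofReal (2 * r * (1 / 2) ^ n) ^ t := by
        rw [one_div, inv_pow, mul_div_assoc', div_eq_mul_inv]
    _ = ENNReal.ofReal (2 * r) ^ t * ENNReal.ofReal ((1 / 2) ^ t) ^ n := by
        rw [ENNReal.ofReal_mul (by positivity), ENNReal.mul_rpow_of_nonneg _ _ ht,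
          ENNReal.ofReal_rpow_of_nonneg (x := (1 / 2) ^ n) (by positivity) ht,
          ← ENNReal.ofReal_pow (by positivity), ← Real.rpow_natCast, ← Real.rpow_mul (by norm_num),
          ← Real.rpow_natCast, ← Real.rpow_mul (by norm_num), mul_comm (n : ℝ)]

/-! ### Morrey's estimate. -/

section Morrey

variable {X : Type u} [MetricSpace X] [MeasurableSpace X] {μ : Measure X} {p Q σ c : ℝ}

/-- The Hölder inequality for averages. -/
theorem laverage_rpow_le (hμ : BallsPosFinite μ) (hQ : 0 < Q) (hQp : Q ≤ p) {g : X → ℝ≥0∞}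
    (hg : Measurable g) (x : X) {r : ℝ} (hr : 0 < r) :
    (⨍⁻ y in Metric.ball x r, g y ^ Q ∂μ) ^ (1 / Q) ≤
      (⨍⁻ y in Metric.ball x r, g y ^ p ∂μ) ^ (1 / p) := by
  have hne : NeZero (μ.restrict (Metric.ball x r)) :=
    ⟨fun h => (hμ x r hr).1.ne' (by rw [← Measure.restrict_apply_univ, h]; rfl)⟩
  have hfin : IsFiniteMeasure (μ.restrict (Metric.ball x r)) :=
    ⟨by rw [Measure.restrict_apply_univ]; exact (hμ x r hr).2⟩
  have := eLpNorm'_le_eLpNorm'_of_exponent_le hQ hQp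
    (((μ.restrict (Metric.ball x r)) univ)⁻¹ • μ.restrict (Metric.ball x r))
    hg.aestronglyMeasurable
  simpa only [eLpNorm', enorm_eq_self, laverage_eq'] using this

/-- The Poincaré inequality pairs the diameter of a ball with an average over its `σ`-dilation,
hence the two radii: the diameter is taken at `s`, the measure at `s'`, which becomes `σ * s`. -/
theorem RelVolumeBound.inv_measure_ball_le (hμ : BallsPosFinite μ) (hc : 0 < c)
    (hQ : 0 < Q) (hV : RelVolumeBound c Q μ) {x x₀ : X} {s s' R : ℝ} (hs : 0 < s) (hss' : s ≤ s')
    (hR : 0 < R) (hsub : Metric.ball x s' ⊆ Metric.ball x₀ R)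
    (h0 : Metric.ediam (Metric.ball x s) ≠ 0) :
    (μ (Metric.ball x s'))⁻¹ ≤ (ENNReal.ofReal c)⁻¹ * (Metric.ediam (Metric.ball x s) ^ Q)⁻¹ *
      Metric.ediam (Metric.ball x₀ R) ^ Q * (μ (Metric.ball x₀ R))⁻¹ := by
  have hs' := hs.trans_le hss'
  have hm := hμ x s' hs'
  have hM := hμ x₀ R hR
  set d := Metric.ediam (Metric.ball x s)
  set E := Metric.ediam (Metric.ball x₀ R)
  have hdt : d ≠ ⊤ := ne_top_of_le_ne_top ENNReal.ofReal_ne_top (ediam_ball_le_ofReal x s)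
  have hdQ0 : d ^ Q ≠ 0 := by simp [ENNReal.rpow_eq_zero_iff, h0, hQ.not_gt]
  have hdQt : d ^ Q ≠ ⊤ := ENNReal.rpow_ne_top_of_nonneg hQ.le hdt
  have hc0 : ENNReal.ofReal c ≠ 0 := by simpa using hc
  have h := hV x x₀ s' R hs' hR hsub
  have h1 : ENNReal.ofReal c * d ^ Q * μ (Metric.ball x₀ R) ≤ μ (Metric.ball x s') * E ^ Q := by
    refine le_trans ?_ h
    gcongr
    exact Metric.ediam_mono (Metric.ball_subset_ball hss')
  rw [← ENNReal.mul_inv (Or.inl hc0) (Or.inl ENNReal.ofReal_ne_top), mul_right_comm,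
    ← ENNReal.mul_inv (Or.inr hM.2.ne) (Or.inr hM.1.ne'), mul_comm, ← div_eq_mul_inv,
    ENNReal.le_div_iff_mul_le (Or.inl (mul_ne_zero (mul_ne_zero hc0 hdQ0) hM.1.ne'))
      (Or.inl (ENNReal.mul_ne_top (ENNReal.mul_ne_top ENNReal.ofReal_ne_top hdQt) hM.2.ne)),
    mul_comm, ← div_eq_mul_inv]
  refine ENNReal.div_le_of_le_mul ?_
  rwa [mul_comm (E ^ Q)]

/-- The ratio of the geometric series in Morrey's inequality. -/
noncomputable def morreyConst (p Q c : ℝ) : ℝ≥0∞ :=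
  (ENNReal.ofReal c)⁻¹ ^ (1 / p) * (1 - ENNReal.ofReal ((1 / 2) ^ (1 - Q / p)))⁻¹

theorem morreyConst_ne_top (hc : 0 < c) (hQ : 0 < Q) (hp : Q < p) : morreyConst p Q c ≠ ⊤ := by
  have hp0 := hQ.trans hp
  refine ENNReal.mul_ne_top (ENNReal.rpow_ne_top_of_nonneg (by positivity) (by simpa using hc)) ?_
  rw [ENNReal.inv_ne_top, ne_eq, tsub_eq_zero_iff_le, not_le, ENNReal.ofReal_lt_one]
  exact Real.rpow_lt_one (by norm_num) (by norm_num) (by rw [sub_pos, div_lt_one hp0]; exact hp)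

/-- Morrey's estimate for the sum of the Poincaré bounds of a `p`-integrable function. -/
theorem poincareSum_le_morrey (hμ : BallsPosFinite μ) (hc : 0 < c) (hQ : 0 < Q) (hp : Q < p)
    (hσ : 1 ≤ σ) (hV : RelVolumeBound c Q μ) {g : X → ℝ≥0∞} (hg : Measurable g) {x x₀ : X}
    {r R : ℝ} (hr : 0 < r) (hR : 0 < R) (hsub : Metric.ball x (σ * r) ⊆ Metric.ball x₀ R) :
    poincareSum μ Q σ g x r ≤ morreyConst p Q c * ENNReal.ofReal (2 * r) ^ (1 - Q / p) *
      Metric.ediam (Metric.ball x₀ R) ^ (Q / p) *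
        (⨍⁻ y in Metric.ball x₀ R, g y ^ p ∂μ) ^ (1 / p) := by
  have hp0 := hQ.trans hp
  have hσ0 : 0 < σ := by linarith
  have ht : 0 < 1 - Q / p := by rw [sub_pos, div_lt_one hp0]; exact hp
  set E := Metric.ediam (Metric.ball x₀ R)
  set I := ⨍⁻ y in Metric.ball x₀ R, g y ^ p ∂μ with hI
  -- Hölder raises the exponent from `Q` to `p`, and the volume bound moves the average to the large
  -- ball at the price of `diam^(-Q/p)`. What remains, `diam^(1 - Q/p)`, is summable because `Q <
  -- p`.
  have hterm : ∀ n : ℕ, Metric.ediam (Metric.ball x (r / 2 ^ n)) *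
      (⨍⁻ y in Metric.ball x (σ * (r / 2 ^ n)), g y ^ Q ∂μ) ^ (1 / Q) ≤
        ((ENNReal.ofReal c)⁻¹ ^ (1 / p) * E ^ (Q / p) * I ^ (1 / p)) *
          Metric.ediam (Metric.ball x (r / 2 ^ n)) ^ (1 - Q / p) := by
    intro n
    set s := r / 2 ^ n with hs
    have hs0 : 0 < s := by positivity
    have hsr : s ≤ r := div_le_self hr.le (one_le_pow₀ one_le_two)
    set d := Metric.ediam (Metric.ball x s)
    by_cases hd0 : d = 0
    · rw [hd0, zero_mul]; exact bot_le
    have hdt : d ≠ ⊤ := ne_top_of_le_ne_top ENNReal.ofReal_ne_top (ediam_ball_le_ofReal x s)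
    have hsub' : Metric.ball x (σ * s) ⊆ Metric.ball x₀ R :=
      (Metric.ball_subset_ball (by gcongr)).trans hsub
    have hinv := hV.inv_measure_ball_le hμ hc hQ hs0 (le_mul_of_one_le_left hs0.le hσ) hR hsub' hd0
    calc d * (⨍⁻ y in Metric.ball x (σ * s), g y ^ Q ∂μ) ^ (1 / Q)
        ≤ d * (⨍⁻ y in Metric.ball x (σ * s), g y ^ p ∂μ) ^ (1 / p) := by
          gcongr
          exact laverage_rpow_le hμ hQ hp.le hg x (by positivity)
      _ ≤ d * ((ENNReal.ofReal c)⁻¹ * (d ^ Q)⁻¹ * E ^ Q * I) ^ (1 / p) := by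
          gcongr
          rw [hI, setLAverage_eq, setLAverage_eq, div_eq_mul_inv, div_eq_mul_inv, mul_comm,
            mul_comm (∫⁻ y in Metric.ball x₀ R, g y ^ p ∂μ), ← mul_assoc]
          gcongr
      _ = d * ((ENNReal.ofReal c)⁻¹ ^ (1 / p) * d ^ (-(Q / p)) * E ^ (Q / p) * I ^ (1 / p)) := by
          rw [ENNReal.mul_rpow_of_nonneg _ _ (by positivity),
            ENNReal.mul_rpow_of_nonneg _ _ (by positivity),
            ENNReal.mul_rpow_of_nonneg _ _ (by positivity), ← ENNReal.rpow_neg,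
            ← ENNReal.rpow_mul, ← ENNReal.rpow_mul, neg_mul, mul_one_div]
      _ = ((ENNReal.ofReal c)⁻¹ ^ (1 / p) * E ^ (Q / p) * I ^ (1 / p)) *
          (d ^ (1 : ℝ) * d ^ (-(Q / p))) := by rw [ENNReal.rpow_one]; ring
      _ = _ := by rw [← ENNReal.rpow_add _ _ hd0 hdt, ← sub_eq_add_neg]
  refine (ENNReal.tsum_le_tsum hterm).trans ?_
  rw [ENNReal.tsum_mul_left]
  refine (mul_le_mul_right (tsum_ediam_rpow_le x hr.le ht.le) _).trans_eq ?_
  rw [morreyConst]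
  ring

/-- With averages bounded uniformly in the scale, only the geometric series of the diameters is
left. This gives finiteness of the sums wherever the maximal function is finite. -/
theorem poincareSum_le_of_laverage_le (hQ : 0 < Q) {g : X → ℝ≥0∞} {x : X}
    {r : ℝ} (hr : 0 < r) {A : ℝ≥0∞}
    (hA : ∀ s, 0 < s → s ≤ r → ⨍⁻ y in Metric.ball x (σ * s), g y ^ Q ∂μ ≤ A) :
    poincareSum μ Q σ g x r ≤ A ^ (1 / Q) * ENNReal.ofReal (4 * r) := by
  have h1 := tsum_ediam_rpow_le x hr.le zero_le_one
  have h2 : (1 - ENNReal.ofReal ((1 / 2) ^ (1 : ℝ)))⁻¹ = 2 := by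
    rw [Real.rpow_one, one_div, ENNReal.ofReal_inv_of_pos two_pos]
    simp
  simp only [ENNReal.rpow_one, h2] at h1
  have h3 : ENNReal.ofReal (4 * r) = ENNReal.ofReal (2 * r) * 2 := by
    rw [← ENNReal.ofReal_ofNat 2, ← ENNReal.ofReal_mul (by positivity)]
    congr 1; ring
  rw [h3]
  refine le_trans ?_ (mul_le_mul_right h1 _)
  rw [← ENNReal.tsum_mul_left]
  refine ENNReal.tsum_le_tsum fun n => ?_
  rw [mul_comm]
  gcongr
  exact hA _ (by positivity) (div_le_self hr.le (one_le_pow₀ one_le_two))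

end Morrey

/-! ### Points with finite maximal function. -/

section GoodPoints

variable {X : Type u} [MetricSpace X] [MeasurableSpace X]

/-- The points at which the maximal function of `F` is finite. -/
def FiniteMaximal (μ : Measure X) (F : X → ℝ≥0∞) (x : X) : Prop :=
  ∃ A : ℝ≥0∞, A ≠ ⊤ ∧ ∀ s, 0 < s → ⨍⁻ y in Metric.ball x s, F y ∂μ ≤ A

/-- Lebesgue differentiation suffices, without a weak-type estimate: averages over small closed
balls are below `F x + 1`, open balls cost a further factor `C`, and for radii above `r₀` the total
integral over the measure of `B(x, r₀)` is a bound. -/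
theorem ae_finiteMaximal [BorelSpace X] [SecondCountableTopology X] {μ : Measure X} {C : ℝ}
    (hμ : BallsPosFinite μ) (hC : 1 ≤ C) (hd : DoublingWith C μ) {F : X → ℝ≥0∞}
    (hF : Measurable F) (hint : ∫⁻ x, F x ∂μ ≠ ⊤) : ∀ᵐ x ∂μ, FiniteMaximal μ F x := by
  have := hμ.isLocallyFiniteMeasure
  have hcl : ∀ x r, 0 < r → μ (Metric.closedBall x r) ≤ ENNReal.ofReal C * μ (Metric.ball x r) :=
    fun x r hr => (measure_mono (Metric.closedBall_subset_ball (by linarith))).trans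
      (hd.measure_ball_le hC x hr)
  have hdoub : IsUnifLocDoublingMeasure μ := by
    refine ⟨⟨C.toNNReal ^ 2, ?_⟩⟩
    filter_upwards [self_mem_nhdsWithin] with r hr x
    have hr0 : (0 : ℝ) < r := hr
    calc μ (Metric.closedBall x (2 * r)) ≤ ENNReal.ofReal C * μ (Metric.ball x (2 * r)) :=
          hcl x _ (by positivity)
      _ ≤ ENNReal.ofReal C * (ENNReal.ofReal C * μ (Metric.ball x r)) := by
          gcongr; exact hd.measure_ball_le hC x hr0
      _ ≤ ENNReal.ofReal C * (ENNReal.ofReal C * μ (Metric.closedBall x r)) := by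
          gcongr; exact Metric.ball_subset_closedBall
      _ = _ := by rw [← mul_assoc, ← sq]; norm_cast
  filter_upwards [(IsUnifLocDoublingMeasure.vitaliFamily μ 1).ae_tendsto_lintegral_div
    hF.aemeasurable hint, ae_lt_top hF hint] with x hx hxt
  have hlim := hx.comp (IsUnifLocDoublingMeasure.tendsto_closedBall_filterAt (μ := μ) (K := 1)
    (x := x) (l := 𝓝[>] (0 : ℝ)) (fun _ => x) id tendsto_id
    (eventually_nhdsWithin_of_forall fun r hr => by
      have hr0 : (0 : ℝ) < r := hr
      simpa using hr0.le))
  have hev := hlim.eventually_lt_const (ENNReal.lt_add_right hxt.ne one_ne_zero)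
  obtain ⟨r₀, hr₀, hball⟩ := mem_nhdsGT_iff_exists_Ioc_subset.1 hev
  have hr₀' : (0 : ℝ) < r₀ := hr₀
  refine ⟨max (ENNReal.ofReal C * (F x + 1)) ((∫⁻ x, F x ∂μ) / μ (Metric.ball x r₀)), ?_, ?_⟩
  · refine (max_lt ?_ ?_).ne
    · exact ENNReal.mul_lt_top ENNReal.ofReal_lt_top (ENNReal.add_lt_top.2 ⟨hxt, ENNReal.one_lt_top⟩)
    · exact ENNReal.div_lt_top hint (hμ x r₀ hr₀').1.ne'
  intro s hs
  rw [setLAverage_eq]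
  rcases le_total s r₀ with hsr | hsr
  · refine le_max_of_le_left ?_
    have h1 : (∫⁻ y in Metric.closedBall x s, F y ∂μ) / μ (Metric.closedBall x s) < F x + 1 :=
      hball ⟨hs, hsr⟩
    have hc0 : μ (Metric.closedBall x s) ≠ 0 :=
      ((hμ x s hs).1.trans_le (measure_mono Metric.ball_subset_closedBall)).ne'
    have hct : μ (Metric.closedBall x s) ≠ ⊤ :=
      ((hcl x s hs).trans_lt (ENNReal.mul_lt_top ENNReal.ofReal_lt_top (hμ x s hs).2)).ne
    refine ENNReal.div_le_of_le_mul ?_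
    rw [ENNReal.div_lt_iff (Or.inl hc0) (Or.inl hct)] at h1
    calc ∫⁻ y in Metric.ball x s, F y ∂μ ≤ ∫⁻ y in Metric.closedBall x s, F y ∂μ :=
          lintegral_mono_set Metric.ball_subset_closedBall
      _ ≤ (F x + 1) * μ (Metric.closedBall x s) := h1.le
      _ ≤ (F x + 1) * (ENNReal.ofReal C * μ (Metric.ball x s)) := by gcongr; exact hcl x s hs
      _ = _ := by ring
  · refine le_max_of_le_right ?_
    gcongr
    exact Measure.restrict_le_self

end GoodPoints

/-! ### Connecting curves from the Poincaré inequality. -/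

section Core

variable {X : Type u} [MetricSpace X] [ProperSpace X] [MeasurableSpace X] [BorelSpace X]
  {μ : Measure X} {p Q Cμ CP σ c : ℝ}

/-- Two points at which the Poincaré sums are finite are joined by a curve whose line integral is
controlled by the Poincaré sums. -/
theorem exists_curve_of_poincareSum [PreconnectedSpace X] (hμ : BallsPosFinite μ) (hQ : 1 ≤ Q)
    (hCμ : 1 ≤ Cμ) (hd : DoublingWith Cμ μ) (hP : PoincareWith Q CP σ μ) {g ρ : X → ℝ≥0∞}
    (hg : LowerSemicontinuous g) (hρ : LowerSemicontinuous ρ) {x y : X} (hxy : x ≠ y) {M : ℝ≥0∞}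
    (hM : M ≠ ⊤) (hSg : ENNReal.ofReal (2 * Cμ ^ 2 * CP) *
      (poincareSum μ Q σ g x (2 * dist x y) + poincareSum μ Q σ g y (dist x y)) ≤ M)
    (hρx : poincareSum μ Q σ ρ x (2 * dist x y) ≠ ⊤)
    (hρy : poincareSum μ Q σ ρ y (dist x y) ≠ ⊤) {η : ℝ} (hη : 0 < η) :
    ∃ γ : Curve X, (∃ K, LipschitzWith K γ) ∧ γ 0 = x ∧ γ 1 = y ∧
      lineIntegral γ g ≤ M + ENNReal.ofReal η ∧ lineIntegral γ ρ ≠ ⊤ := by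
  have hQ0 : 0 < Q := by linarith
  set K := ENNReal.ofReal (2 * Cμ ^ 2 * CP)
  set D := dist x y
  have hD : 0 < D := dist_pos.2 hxy
  have hone : ∀ z r, 0 < r → poincareSum μ Q σ (fun _ => 1) z r ≠ ⊤ := by
    intro z r hr
    refine ne_top_of_le_ne_top (b := 1 ^ (1 / Q) * ENNReal.ofReal (4 * r))
      (ENNReal.mul_ne_top (by simp) ENNReal.ofReal_ne_top)
      (poincareSum_le_of_laverage_le hQ0 hr fun s _ _ => ?_)
    rw [setLAverage_eq]
    simp only [ENNReal.one_rpow, lintegral_one, Measure.restrict_apply_univ]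
    exact ENNReal.div_self_le_one
  have hρ1 : ∀ z r, 0 < r → poincareSum μ Q σ ρ z r ≠ ⊤ →
      poincareSum μ Q σ (fun z => ρ z + 1) z r ≠ ⊤ := fun z r hr h =>
    ne_top_of_le_ne_top (ENNReal.add_ne_top.2 ⟨h, hone z r hr⟩)
      (poincareSum_add_le hQ hρ.measurable measurable_const z r)
  set S := K * (poincareSum μ Q σ (fun z => ρ z + 1) x (2 * D) +
    poincareSum μ Q σ (fun z => ρ z + 1) y D) with hS
  have hSt : S ≠ ⊤ := ENNReal.mul_ne_top ENNReal.ofReal_ne_top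
    (ENNReal.add_ne_top.2 ⟨hρ1 _ _ (by positivity) hρx, hρ1 _ _ hD hρy⟩)
  -- Chosen so that adding `ε(ρ + 1)` to `g` raises the bound by at most `η / 2`.
  set ε : ℝ := η / 2 / (S.toReal + 1) with hε
  have hS0 : 0 ≤ S.toReal := ENNReal.toReal_nonneg
  have hε0 : 0 < ε := by positivity
  have hεS : ENNReal.ofReal ε * S ≤ ENNReal.ofReal (η / 2) := by
    rw [← ENNReal.ofReal_toReal hSt, ← ENNReal.ofReal_mul hε0.le]
    refine ENNReal.ofReal_le_ofReal ?_
    rw [hε, div_mul_eq_mul_div, div_le_iff₀ (by positivity)]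
    nlinarith
  -- The multiple of `ρ` makes its integral along the limit curve finite; the constant `ε` keeps the
  -- weights away from zero, which makes the limit curve Lipschitz.
  set h : X → ℝ≥0∞ := fun z => g z + ENNReal.ofReal ε * (ρ z + 1) with hh
  have hρ1lsc : LowerSemicontinuous fun z => ρ z + 1 := hρ.add lowerSemicontinuous_const
  have hlsc : LowerSemicontinuous h := by
    refine hg.add ?_
    exact (ENNReal.continuous_const_mul ENNReal.ofReal_ne_top).comp_lowerSemicontinuous hρ1lsc
      fun a b hab => mul_le_mul_right hab _
  have hhε : ∀ z, ENNReal.ofReal ε ≤ h z := fun z => by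
    refine le_add_left ?_
    rw [mul_add, mul_one]
    exact le_add_self
  have hSh : K * (poincareSum μ Q σ h x (2 * D) + poincareSum μ Q σ h y D) ≤
      M + ENNReal.ofReal (η / 2) := by
    have hadd : ∀ z r, poincareSum μ Q σ h z r ≤ poincareSum μ Q σ g z r +
        ENNReal.ofReal ε * poincareSum μ Q σ (fun z => ρ z + 1) z r := by
      intro z r
      rw [← poincareSum_const_mul hQ0 ENNReal.ofReal_ne_top]
      exact poincareSum_add_le hQ hg.measurable (hρ1lsc.measurable.const_mul _) z r
    calc K * (poincareSum μ Q σ h x (2 * D) + poincareSum μ Q σ h y D)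
        ≤ K * ((poincareSum μ Q σ g x (2 * D) +
          ENNReal.ofReal ε * poincareSum μ Q σ (fun z => ρ z + 1) x (2 * D)) +
          (poincareSum μ Q σ g y D +
            ENNReal.ofReal ε * poincareSum μ Q σ (fun z => ρ z + 1) y D)) := by
          gcongr <;> exact hadd _ _
      _ = K * (poincareSum μ Q σ g x (2 * D) + poincareSum μ Q σ g y D) +
          ENNReal.ofReal ε * S := by rw [hS]; ring
      _ ≤ _ := add_le_add hSg hεS
  set B := M + ENNReal.ofReal (η / 2) with hB
  have hBt : B ≠ ⊤ := ENNReal.add_ne_top.2 ⟨hM, ENNReal.ofReal_ne_top⟩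
  set a : ℕ → X → ℝ := infConv h ε
  have ha0 : ∀ k z, 0 < a k z := fun k z => hε0.trans_le (le_infConv hhε k z)
  -- The weight `a k` is at most `k + ε`, so a single step costs at most `1 / (k + 1)`.
  set δ : ℕ → ℝ := fun k => ((k : ℝ) + 1)⁻¹ * ((k : ℝ) + ε)⁻¹ with hδ
  have hδ0 : ∀ k, 0 < δ k := fun k => by positivity
  set T := B.toReal + η / 2 with hT
  have hT0 : 0 < T := by positivity
  -- The chain distance vanishes at `x` and has upper gradient `a k ≤ h`, so its value at `y` is at
  -- most `B` for all `k`; the slack `η / 2` in `T` makes up for the infimum not being attained.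
  have hchain : ∀ k, ∃ L ≤ T, ChainReach (a k) (δ k) x y L := by
    intro k
    have hloc : ∀ z w, dist z w ≤ δ k → |chainDist (a k) (δ k) x z - chainDist (a k) (δ k) x w| ≤
        max (a k z) (a k w) * dist z w := fun z w hzw =>
      abs_chainDist_sub_le (fun z => (ha0 k z).le) (hδ0 k) hzw
    have hcont := infConv_continuous hhε k
    have h1 := edist_le_poincareSum hμ hCμ hd hP
      (continuous_of_local_bound hcont (hδ0 k) hloc)
      (isUpperGradientOn_of_local_bound hcont (fun z => (ha0 k z).le) (hδ0 k) hloc) hxy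
    have h2 : edist (chainDist (a k) (δ k) x x) (chainDist (a k) (δ k) x y) ≤ B := by
      refine h1.trans (le_trans ?_ hSh)
      gcongr <;> exact poincareSum_mono hQ0.le (ofReal_infConv_le hhε k) _ _
    rw [chainDist_self fun z => (ha0 k z).le, edist_dist, Real.dist_eq, zero_sub, abs_neg,
      ENNReal.ofReal_le_iff_le_toReal hBt] at h2
    obtain ⟨L, hL, hLT⟩ := exists_lt_of_csInf_lt (s := {L | ChainReach (a k) (δ k) x y L})
      (exists_chainReach (hδ0 k) y) (b := T)
      (((le_abs_self _).trans h2).trans_lt (by rw [hT]; linarith))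
    exact ⟨L, hLT.le, hL⟩
  obtain ⟨γ, hγL, hγ0, hγ1, hγ⟩ := exists_curve_of_chains (infConv_continuous hhε)
    (infConv_mono hhε) hε0 (le_infConv hhε) (A := fun k => k + ε) (infConv_le_nat hε0 hhε)
    (fun k => (hδ0 k).le) (by
      have := tendsto_one_div_add_atTop_nhds_zero_nat (𝕜 := ℝ)
      refine this.congr fun k => ?_
      have : (k : ℝ) + ε ≠ 0 := by positivity
      simp only [hδ]
      field_simp) hT0 hchain
  have hlen := length_ne_top_of_lipschitz hγL
  have hγh : lineIntegral γ h ≤ ENNReal.ofReal T := by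
    have := lineIntegral_iSup hlen (infConv_continuous hhε) (infConv_mono hhε)
    simp only [iSup_ofReal_infConv hε0 hhε hlsc] at this
    rw [this]
    exact iSup_le hγ
  refine ⟨γ, hγL, hγ0, hγ1, ?_, ?_⟩
  · refine (lineIntegral_mono γ fun z => le_self_add).trans (hγh.trans_eq ?_)
    rw [hT, ENNReal.ofReal_add ENNReal.toReal_nonneg (by positivity), ENNReal.ofReal_toReal hBt, hB,
      add_assoc, ← ENNReal.ofReal_add (by positivity) (by positivity), add_halves]
  · intro htop
    have h1 : lineIntegral γ (fun z => ENNReal.ofReal ε * ρ z) ≤ lineIntegral γ h :=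
      lineIntegral_mono γ fun z => le_add_left (mul_le_mul_right le_self_add _)
    rw [lineIntegral_const_mul hlen ENNReal.ofReal_ne_top, htop,
      ENNReal.mul_top (by simpa using hε0)] at h1
    exact ENNReal.ofReal_ne_top (top_le_iff.1 (h1.trans hγh))

/-- The Vitali–Carathéodory theorem for `p`-integrable functions. -/
theorem exists_lowerSemicontinuous_rpow (ν : Measure X) [IsFiniteMeasure ν] {p : ℝ} (hp : 0 < p)
    {g : X → ℝ≥0∞} (hg : Measurable g) {ε : ℝ≥0∞} (hε : ε ≠ 0) :
    ∃ h : X → ℝ≥0∞, (∀ x, g x ≤ h x) ∧ LowerSemicontinuous h ∧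
      ∫⁻ x, h x ^ p ∂ν ≤ ∫⁻ x, g x ^ p ∂ν + ε := by
  obtain ⟨H, hgH, hH, hint⟩ := exists_le_lowerSemicontinuous_lintegral_ge ν (fun x => g x ^ p)
    (hg.pow_const p) hε
  refine ⟨fun x => H x ^ (1 / p), fun x => ?_, ?_, ?_⟩
  · rw [one_div, ENNReal.le_rpow_inv_iff hp]
    exact hgH x
  · exact ENNReal.continuous_rpow_const.comp_lowerSemicontinuous hH
      (ENNReal.monotone_rpow_of_nonneg (by positivity))
  · simpa [← ENNReal.rpow_mul, inv_mul_cancel₀ hp.ne'] using hint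

/-- The constant in the Morrey estimate for the line integral of connecting curves. -/
noncomputable def curveConst (p Q Cμ c CP : ℝ) : ℝ≥0∞ :=
  2 * ENNReal.ofReal (2 * Cμ ^ 2 * CP) * morreyConst p Q c

/-- Outside a null set, any two points are joined by a curve which avoids a given exceptional
family and which satisfies Morrey's estimate. -/
theorem exists_null_forall_exists_curve (hμ : BallsPosFinite μ) (hQ : 1 ≤ Q)
    (hp : Q < p) (hCμ : 1 ≤ Cμ) (hc : 0 < c) (hσ : 1 ≤ σ) (hd : DoublingWith Cμ μ)
    (hV : RelVolumeBound c Q μ) (hP : PoincareWith Q CP σ μ) {ρ : X → ℝ≥0∞} (hρ : Measurable ρ)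
    (x₀ : X) {R : ℝ} (hR : 0 < R) (hρint : ∫⁻ z in Metric.ball x₀ R, ρ z ^ Q ∂μ ≠ ⊤) :
    ∃ N : Set X, MeasurableSet N ∧ μ N = 0 ∧ ∀ g : X → ℝ≥0∞, Measurable g →
      ∫⁻ z in Metric.ball x₀ R, g z ^ p ∂μ ≠ ⊤ → ∀ x ∉ N, ∀ y ∉ N,
      Metric.ball x (σ * (2 * dist x y)) ⊆ Metric.ball x₀ R →
      Metric.ball y (σ * dist x y) ⊆ Metric.ball x₀ R → ∀ η : ℝ, 0 < η →
      ∃ γ : Curve X, (∃ K, LipschitzWith K γ) ∧ γ 0 = x ∧ γ 1 = y ∧ lineIntegral γ ρ ≠ ⊤ ∧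
        lineIntegral γ g ≤ curveConst p Q Cμ c CP * ENNReal.ofReal (4 * dist x y) ^ (1 - Q / p) *
          Metric.ediam (Metric.ball x₀ R) ^ (Q / p) *
            (⨍⁻ z in Metric.ball x₀ R, g z ^ p ∂μ) ^ (1 / p) + ENNReal.ofReal η := by
  have hQ0 : 0 < Q := by linarith
  have hp0 : 0 < p := by linarith
  have ht : 0 < 1 - Q / p := by rw [sub_pos, div_lt_one hp0]; exact hp
  have := hμ.isLocallyFiniteMeasure
  have := hP.preconnectedSpace hQ0 hμ
  set B := Metric.ball x₀ R with hB
  have hBm : MeasurableSet B := Metric.isOpen_ball.measurableSet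
  have hBμ := hμ x₀ R hR
  have hfin : IsFiniteMeasure (μ.restrict B) := ⟨by rw [Measure.restrict_apply_univ]; exact hBμ.2⟩
  obtain ⟨ρ', hρρ', hρ'lsc, hρ'int⟩ :=
    exists_lowerSemicontinuous_rpow (μ.restrict B) hQ0 hρ one_ne_zero
  set F : X → ℝ≥0∞ := B.indicator fun z => ρ' z ^ Q with hF
  have hFm : Measurable F := (hρ'lsc.measurable.pow_const Q).indicator hBm
  have hFint : ∫⁻ z, F z ∂μ ≠ ⊤ := by
    rw [hF, lintegral_indicator hBm]
    exact ne_top_of_le_ne_top (ENNReal.add_ne_top.2 ⟨hρint, ENNReal.one_ne_top⟩) hρ'int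
  -- The null set depends on `ρ` only: for `g`, Morrey's estimate holds at every point.
  obtain ⟨N, hsub, hN, hN0⟩ := exists_measurable_superset_of_null
    (ae_iff.1 (ae_finiteMaximal hμ hCμ hd hFm hFint))
  refine ⟨N, hN, hN0, fun g hg hgint x hx y hy hxB hyB η hη => ?_⟩
  by_cases hxy : x = y
  · subst hxy
    have h0 : ∀ f, lineIntegral (ContinuousMap.const unitInterval x) f = 0 :=
      lineIntegral_const (x := x) fun _ => rfl
    exact ⟨ContinuousMap.const _ x, ⟨0, LipschitzWith.const x⟩, rfl, rfl, by simp [h0],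
      by simp [h0]⟩
  have hD : 0 < dist x y := dist_pos.2 hxy
  set D := dist x y
  have hgood : ∀ z ∉ N, ∀ r, 0 < r → Metric.ball z (σ * r) ⊆ B →
      poincareSum μ Q σ ρ' z r ≠ ⊤ := by
    intro z hz r hr hzB
    obtain ⟨A, hA, hAs⟩ : FiniteMaximal μ F z := by
      by_contra hcon
      exact hz (hsub hcon)
    refine ne_top_of_le_ne_top (b := A ^ (1 / Q) * ENNReal.ofReal (4 * r))
      (ENNReal.mul_ne_top (ENNReal.rpow_ne_top_of_nonneg (by positivity) hA) ENNReal.ofReal_ne_top)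
      (poincareSum_le_of_laverage_le hQ0 hr fun s hs hsr => ?_)
    refine le_trans (le_of_eq ?_) (hAs (σ * s) (by positivity))
    rw [setLAverage_eq, setLAverage_eq]
    congr 1
    refine setLIntegral_congr_fun Metric.isOpen_ball.measurableSet fun w hw => ?_
    rw [hF, indicator_of_mem (hzB (Metric.ball_subset_ball (by gcongr) hw))]
  set E := Metric.ediam B
  have hE : E ≠ ⊤ := ne_top_of_le_ne_top ENNReal.ofReal_ne_top (ediam_ball_le_ofReal x₀ R)
  set Kc := curveConst p Q Cμ c CP * ENNReal.ofReal (4 * D) ^ (1 - Q / p) * E ^ (Q / p) with hKc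
  have hKct : Kc ≠ ⊤ := by
    refine ENNReal.mul_ne_top (ENNReal.mul_ne_top (ENNReal.mul_ne_top (ENNReal.mul_ne_top
      ENNReal.ofNat_ne_top ENNReal.ofReal_ne_top) (morreyConst_ne_top hc hQ0 hp)) ?_) ?_
    · exact ENNReal.rpow_ne_top_of_nonneg ht.le ENNReal.ofReal_ne_top
    · exact ENNReal.rpow_ne_top_of_nonneg (by positivity) hE
  -- The admissible increase of the normalized `L^p` norm when `g` is replaced by a lower
  -- semicontinuous majorant; it costs at most `η / 2` in the final bound. The other half is spent
  -- on the connecting curve.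
  set t₀ := ENNReal.ofReal (η / 2) / (Kc + 1) with ht₀
  have ht₀0 : t₀ ≠ 0 := (ENNReal.div_pos (by simpa using hη) (by finiteness)).ne'
  have ht₀t : t₀ ≠ ⊤ := ENNReal.div_ne_top ENNReal.ofReal_ne_top (by simp)
  have hKt₀ : Kc * t₀ ≤ ENNReal.ofReal (η / 2) := by
    rw [ht₀, mul_comm]
    calc ENNReal.ofReal (η / 2) / (Kc + 1) * Kc
        ≤ ENNReal.ofReal (η / 2) / (Kc + 1) * (Kc + 1) := by gcongr; exact le_self_add
      _ = _ := ENNReal.div_mul_cancel (by simp) (by finiteness)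
  obtain ⟨g', hgg', hg'lsc, hg'int⟩ := exists_lowerSemicontinuous_rpow (μ.restrict B) hp0 hg
    (ε := t₀ ^ p * μ B) (mul_ne_zero (by simp [ENNReal.rpow_eq_zero_iff, ht₀0, hp0.not_gt])
      hBμ.1.ne')
  set I := ⨍⁻ z in B, g z ^ p ∂μ with hI
  have hI' : (⨍⁻ z in B, g' z ^ p ∂μ) ^ (1 / p) ≤ I ^ (1 / p) + t₀ := by
    have h1 : ⨍⁻ z in B, g' z ^ p ∂μ ≤ I + t₀ ^ p := by
      rw [hI, setLAverage_eq, setLAverage_eq]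
      refine (ENNReal.div_le_div_right hg'int _).trans_eq ?_
      rw [ENNReal.add_div, ENNReal.mul_div_cancel_right hBμ.1.ne' hBμ.2.ne]
    calc (⨍⁻ z in B, g' z ^ p ∂μ) ^ (1 / p) ≤ (I + t₀ ^ p) ^ (1 / p) := by gcongr
      _ ≤ I ^ (1 / p) + (t₀ ^ p) ^ (1 / p) := ENNReal.rpow_add_le_add_rpow _ _ (by positivity)
          (by rw [div_le_one hp0]; linarith)
      _ = _ := by rw [← ENNReal.rpow_mul, mul_one_div_cancel hp0.ne', ENNReal.rpow_one]
  have hIt : I ≠ ⊤ := by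
    rw [hI, setLAverage_eq]
    exact (ENNReal.div_lt_top hgint hBμ.1.ne').ne
  have hS : ENNReal.ofReal (2 * Cμ ^ 2 * CP) *
      (poincareSum μ Q σ g' x (2 * D) + poincareSum μ Q σ g' y D) ≤
        Kc * I ^ (1 / p) + ENNReal.ofReal (η / 2) := by
    have h1 := poincareSum_le_morrey hμ hc hQ0 hp hσ hV hg'lsc.measurable
      (r := 2 * D) (by positivity) hR hxB
    have h2 := poincareSum_le_morrey hμ hc hQ0 hp hσ hV hg'lsc.measurable hD hR hyB
    rw [show 2 * (2 * D) = 4 * D by ring] at h1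
    have h24 : ENNReal.ofReal (2 * D) ≤ ENNReal.ofReal (4 * D) :=
      ENNReal.ofReal_le_ofReal (by linarith)
    -- Both sums are bounded by the estimate for radius `2D`; the two equal terms give the leading 2
    -- of `curveConst`.
    calc ENNReal.ofReal (2 * Cμ ^ 2 * CP) *
        (poincareSum μ Q σ g' x (2 * D) + poincareSum μ Q σ g' y D)
        ≤ ENNReal.ofReal (2 * Cμ ^ 2 * CP) *
          (morreyConst p Q c * ENNReal.ofReal (4 * D) ^ (1 - Q / p) * E ^ (Q / p) *
            (⨍⁻ z in B, g' z ^ p ∂μ) ^ (1 / p) +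
          morreyConst p Q c * ENNReal.ofReal (4 * D) ^ (1 - Q / p) * E ^ (Q / p) *
            (⨍⁻ z in B, g' z ^ p ∂μ) ^ (1 / p)) := by
          gcongr
          refine h2.trans ?_
          gcongr
      _ = Kc * (⨍⁻ z in B, g' z ^ p ∂μ) ^ (1 / p) := by rw [hKc, curveConst]; ring
      _ ≤ Kc * (I ^ (1 / p) + t₀) := by gcongr
      _ ≤ _ := by rw [mul_add]; gcongr
  obtain ⟨γ, hγL, hγ0, hγ1, hγg, hγρ⟩ := exists_curve_of_poincareSum hμ hQ hCμ hd hP hg'lsc hρ'lsc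
    hxy (ENNReal.add_ne_top.2 ⟨ENNReal.mul_ne_top hKct
      (ENNReal.rpow_ne_top_of_nonneg (by positivity) hIt), ENNReal.ofReal_ne_top⟩) hS
    (hgood x hx _ (by positivity) hxB) (hgood y hy _ hD hyB) (half_pos hη)
  refine ⟨γ, hγL, hγ0, hγ1, ne_top_of_le_ne_top hγρ (lineIntegral_mono γ hρρ'), ?_⟩
  refine (lineIntegral_mono γ hgg').trans (hγg.trans_eq ?_)
  rw [add_assoc, ← ENNReal.ofReal_add (by positivity) (by positivity), add_halves]

end Core

theorem lintegral_max_rpow_ne_top {X : Type u} [MeasurableSpace X] {μ : Measure X} {p : ℝ}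
    {f g : X → ℝ≥0∞} (hf : Measurable f) (hfi : ∫⁻ x, f x ^ p ∂μ ≠ ⊤) (hgi : ∫⁻ x, g x ^ p ∂μ ≠ ⊤) :
    ∫⁻ x, max (f x) (g x) ^ p ∂μ ≠ ⊤ := by
  refine ne_top_of_le_ne_top (ENNReal.add_ne_top.2 ⟨hfi, hgi⟩) ?_
  rw [← lintegral_add_left (hf.pow_const p)]
  refine lintegral_mono fun x => ?_
  rcases le_total (f x) (g x) with h | h
  · rw [max_eq_right h]; exact le_add_self
  · rw [max_eq_left h]; exact le_self_add

/-! ### Upper gradients of locally Newtonian maps. -/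

section UpperGradients

variable {X : Type u} [MetricSpace X]

theorem lineIntegral_mono_of_image {γ : Curve X} {g h : X → ℝ≥0∞}
    (hgh : ∀ t, g (γ t) ≤ h (γ t)) : lineIntegral γ g ≤ lineIntegral γ h := by
  by_cases hγ : length γ = ⊤
  · rw [lineIntegral_of_length_eq_top hγ, lineIntegral_of_length_eq_top hγ]
  rw [lineIntegral_eq hγ, lineIntegral_eq hγ]
  refine setLIntegral_mono' measurableSet_Icc fun τ hτ => ?_
  rw [← arc_zero γ] at hτ
  obtain ⟨t, -, rfl⟩ := exists_arc_eq hγ zero_le_one hτ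
  rw [natParam_arc hγ]
  exact hgh t

/-- Finiteness of the integral of `ρ` is inherited by subcurves, so no subcurve is exceptional. -/
theorem length_comp_le_of_weak {Y : Type v} [MetricSpace Y] {f : X → Y} {g ρ : X → ℝ≥0∞}
    (h : ∀ γ : Curve X, lineIntegral γ ρ ≠ ⊤ → edist (f (γ 0)) (f (γ 1)) ≤ lineIntegral γ g)
    {γ : Curve X} (hγ : lineIntegral γ ρ ≠ ⊤) :
    length (fun t => f (γ t)) ≤ lineIntegral γ g := by
  have hl := length_ne_top_of_lineIntegral hγ
  refine length_comp_le_lineIntegral f g fun s t hst => ?_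
  simpa using h (subcurve γ s t)
    (ne_top_of_le_ne_top hγ (lineIntegral_subcurve_le hl hst ρ))

variable [MeasurableSpace X] {μ : Measure X} {p : ℝ}

theorem LocLp.lintegral_ne_top {g : X → ℝ≥0∞} (hg : LocLp μ p g) {K : Set X} (hK : IsCompact K) :
    ∫⁻ x in K, g x ^ p ∂μ ≠ ⊤ := by
  refine hK.induction_on (p := fun s => ∫⁻ x in s, g x ^ p ∂μ ≠ ⊤) (by simp)
    (fun s t hst ht => ne_top_of_le_ne_top ht (lintegral_mono_set hst))
    (fun s t hs ht => ne_top_of_le_ne_top (ENNReal.add_ne_top.2 ⟨hs, ht⟩)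
      (lintegral_union_le _ _ _)) fun x _ => ?_
  obtain ⟨U, hU, hxU, hint⟩ := hg x
  exact ⟨U, mem_nhdsWithin_of_mem_nhds (hU.mem_nhds hxU), hint.ne⟩

/-- Locally Newtonian maps have upper gradients that are `p`-integrable on a given ball. -/
theorem MemLocNewtonian.exists_upperGradient [ProperSpace X] [BorelSpace X] {Y : Type v}
    [MetricSpace Y] {f : X → Y} (hp : 0 < p) (hf : MemLocNewtonian μ p f) (x₀ : X) (R : ℝ) :
    ∃ g : X → ℝ≥0∞, Measurable g ∧ ∫⁻ x in Metric.ball x₀ R, g x ^ p ∂μ ≠ ⊤ ∧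
      ∀ γ : Curve X, edist (f (γ 0)) (f (γ 1)) ≤ lineIntegral γ g := by
  obtain ⟨V, _, _, _, _, ι, hι, -, hloc⟩ := hf
  choose U hU hxU hN using hloc
  choose G hG hGint using fun x => (hN x).2
  set K := Metric.closedBall x₀ R with hK
  obtain ⟨t, -, hKt⟩ := (isCompact_closedBall x₀ R).elim_nhds_subcover U
    fun x _ => (hU x).mem_nhds (hxU x)
  have hfin : ∀ t : Finset X, ∃ g : X → ℝ≥0∞, Measurable g ∧ ∫⁻ x, g x ^ p ∂μ ≠ ⊤ ∧
      ∀ z ∈ t, ∀ x ∈ U z, G z x ≤ g x := by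
    intro t
    classical
    induction t using Finset.induction_on with
    | empty => exact ⟨fun _ => 0, measurable_const, by simp [hp], by simp⟩
    | insert z t _ ih =>
      obtain ⟨g, hg, hgi, hgG⟩ := ih
      have hm : Measurable ((U z).indicator (G z)) := (hG z).1.indicator (hU z).measurableSet
      refine ⟨fun x => max ((U z).indicator (G z) x) (g x), hm.max hg,
        lintegral_max_rpow_ne_top hm ?_ hgi, ?_⟩
      · have : (fun x => (U z).indicator (G z) x ^ p) = (U z).indicator fun x => G z x ^ p := by
          ext x
          by_cases hx : x ∈ U z <;> simp [hx, hp]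
        rw [this, lintegral_indicator (hU z).measurableSet]
        exact (hGint z).ne
      · intro z' hz' x hx
        rcases Finset.mem_insert.1 hz' with rfl | hz'
        · refine le_max_of_le_left ?_
          rw [indicator_of_mem hx]
        · exact le_max_of_le_right (hgG z' hz' x hx)
  obtain ⟨g, hg, hgi, hgG⟩ := hfin t
  have hKo : IsOpen Kᶜ := Metric.isClosed_closedBall.isOpen_compl
  -- A curve with distinct endpoints that leaves the closed ball spends positive length in its open
  -- complement, so the value `∞` there makes the inequality trivial for it. The other curves are
  -- cut into pieces, each inside one set of the finite cover.
  set g' : X → ℝ≥0∞ := fun x => max (g x) (Kᶜ.indicator (fun _ => ⊤) x) with hg'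
  refine ⟨g', hg.max (measurable_const.indicator hKo.measurableSet), ?_, fun γ => ?_⟩
  · have : ∫⁻ x in Metric.ball x₀ R, g' x ^ p ∂μ = ∫⁻ x in Metric.ball x₀ R, g x ^ p ∂μ := by
      refine setLIntegral_congr_fun Metric.isOpen_ball.measurableSet fun x hx => ?_
      have : x ∉ Kᶜ := fun h => h (Metric.ball_subset_closedBall hx)
      simp only [hg', indicator_of_notMem this, max_eq_left, zero_le]
    rw [this]
    exact ne_top_of_le_ne_top hgi (setLIntegral_le_lintegral _ _)
  · by_cases htop : lineIntegral γ g' = ⊤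
    · rw [htop]; exact le_top
    by_cases hne : γ 0 = γ 1
    · rw [hne, edist_self]; exact bot_le
    have hl := length_ne_top_of_lineIntegral htop
    have hγK : ∀ s, γ s ∈ K := by
      intro s
      by_contra hs
      obtain ⟨r, hr, hr'⟩ := exists_mem_diff_of_lineIntegral hne (N := Kᶜ) hKo (t₀ := s) hs
        (fun x hx => by simp only [hg', indicator_of_mem hx]; exact max_eq_right le_top) htop
      exact hr' hr
    obtain ⟨w, hw0, hw, ⟨n, hn⟩, hwU⟩ := exists_monotone_Icc_subset_open_cover_unitInterval
      (c := fun z : t => γ ⁻¹' U z) (fun z => (hU z).preimage γ.continuous) (fun s _ => by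
        obtain ⟨z, hz, hs⟩ := mem_iUnion₂.1 (hKt (hγK s))
        exact mem_iUnion.2 ⟨⟨z, hz⟩, hs⟩)
    have hind : ∀ m, edist (f (γ 0)) (f (γ (w m))) ≤ lineIntegral (subcurve γ 0 (w m)) g' := by
      intro m
      induction m with
      | zero => simp [hw0]
      | succ m ih =>
        obtain ⟨z, hz⟩ := hwU m
        have hmm : w m ≤ w (m + 1) := hw m.le_succ
        rw [← lineIntegral_subcurve_add hl (show 0 ≤ w m from (w m).2.1) hmm]
        refine (edist_triangle _ (f (γ (w m))) _).trans (add_le_add ih ?_)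
        have hsub : ∀ r, subcurve γ (w m) (w (m + 1)) r ∈ U z := by
          intro r
          have h0 := affineParam_mono hmm (show 0 ≤ r from r.2.1)
          have h1 := affineParam_mono hmm (show r ≤ 1 from r.2.2)
          rw [affineParam_zero] at h0
          rw [affineParam_one] at h1
          exact hz ⟨h0, h1⟩
        have := (hG z).2 (subcurve γ (w m) (w (m + 1))) hsub
        rw [hι.edist_eq, subcurve_zero, subcurve_one] at this
        exact this.trans (lineIntegral_mono_of_image fun r =>
          le_max_of_le_left (hgG z z.2 _ (hsub r)))
    have := hind n
    rwa [hn n le_rfl, subcurve_zero_one] at this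

end UpperGradients

theorem curvesJoining_mono {X : Type u} [MetricSpace X] {E E' F F' : Set X} (hE : E ⊆ E') (hF : F ⊆ F') :
    curvesJoining E F ⊆ curvesJoining E' F' := fun _ h => ⟨h.1, hE h.2.1, hF h.2.2⟩

theorem length_subcurve_le {X : Type u} [MetricSpace X] {Y : Type v} [MetricSpace Y] {f : X → Y}
    {γ : Curve X} {s t : unitInterval} (hst : s ≤ t) :
    length (fun r => f (subcurve γ s t r)) ≤ length (fun r => f (γ r)) :=
  (length_subcurve (fun r => f (γ r)) hst).trans_le (eVariationOn.mono _ (subset_univ _))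

/-! ### The essential pull-back distance. -/

section PullbackDistance

variable {X : Type u} [MetricSpace X] [MeasurableSpace X] {μ : Measure X} {p Q : ℝ}
  {Y : Type v} [MetricSpace Y] {f : X → Y}

/-- Families of modulus zero are replaced by integrable functions `ρ`. Small `δ` suffice, since a
curve admissible for a small radius is admissible for larger ones. -/
theorem essPullbackDist_le (hQ : 0 < Q) {x y : X} {B : ℝ≥0∞} {δ₀ : ℝ} (hδ₀ : 0 < δ₀)
    (h : ∀ δ, 0 < δ → δ ≤ δ₀ → ∀ ρ : X → ℝ≥0∞, Measurable ρ → ∫⁻ z, ρ z ^ Q ∂μ ≠ ⊤ →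
      ∀ η : ℝ, 0 < η → ∃ γ ∈ curvesJoining (Metric.closedBall x δ) (Metric.closedBall y δ),
        lineIntegral γ ρ ≠ ⊤ ∧ length (fun t => f (γ t)) ≤ B + ENNReal.ofReal η) :
    essPullbackDist μ Q f x y ≤ B := by
  refine iSup₂_le fun δ hδ => iSup₂_le fun Γ₀ hΓ₀ => ?_
  obtain ⟨ρ, hρ, hρi, hρΓ⟩ := exists_lineIntegral_eq_top_of_modulus hQ hΓ₀
  refine ENNReal.le_of_forall_pos_le_add fun η hη _ => ?_
  obtain ⟨γ, hγ, hγρ, hγl⟩ := h (min δ δ₀) (lt_min hδ hδ₀) (min_le_right _ _) ρ hρ hρi η hη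
  rw [ENNReal.ofReal_coe_nnreal] at hγl
  refine (iInf₂_le γ ⟨curvesJoining_mono ?_ ?_ hγ, fun h' => hγρ (hρΓ γ h')⟩).trans hγl <;>
  exact Metric.closedBall_subset_closedBall (min_le_left _ _)

/-- The curves along which `ρ` has infinite integral form one of the families in the supremum. -/
theorem exists_curve_of_essPullbackDist (hQ : 0 < Q) {x y : X}
    (hd : essPullbackDist μ Q f x y ≠ ⊤) {δ : ℝ} (hδ : 0 < δ) {ρ : X → ℝ≥0∞} (hρ : Measurable ρ)
    (hρi : ∫⁻ z, ρ z ^ Q ∂μ ≠ ⊤) {η : ℝ} (hη : 0 < η) :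
    ∃ γ ∈ curvesJoining (Metric.closedBall x δ) (Metric.closedBall y δ),
      lineIntegral γ ρ ≠ ⊤ ∧
        length (fun t => f (γ t)) ≤ essPullbackDist μ Q f x y + ENNReal.ofReal η := by
  set Γ₀ : Set (Curve X) := {γ | lineIntegral γ ρ = ⊤}
  have hΓ₀ : modulus μ Q Γ₀ = 0 := modulus_eq_zero_of_lintegral hQ hρ hρi fun γ hγ => hγ
  have h1 : ⨅ γ ∈ curvesJoining (Metric.closedBall x δ) (Metric.closedBall y δ) \ Γ₀,
      length (fun t => f (γ t)) < essPullbackDist μ Q f x y + ENNReal.ofReal η := by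
    refine lt_of_le_of_lt ?_ (ENNReal.lt_add_right hd (by simpa using hη))
    exact (le_iSup₂ (f := fun (Γ₀ : Set (Curve X)) (_ : modulus μ Q Γ₀ = 0) =>
      ⨅ γ ∈ curvesJoining (Metric.closedBall x δ) (Metric.closedBall y δ) \ Γ₀,
        length (fun t => f (γ t))) Γ₀ hΓ₀).trans
      (le_iSup₂ (f := fun (δ : ℝ) (_ : 0 < δ) => essLength μ Q f
        (curvesJoining (Metric.closedBall x δ) (Metric.closedBall y δ))) δ hδ)
  simp only [iInf_lt_iff] at h1
  obtain ⟨γ, ⟨hγ, hγ'⟩, hlt⟩ := h1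
  exact ⟨γ, hγ, hγ', hlt.le⟩

theorem essPullbackDist_self (hQ : 0 < Q) (x : X) : essPullbackDist μ Q f x x = 0 := by
  refine le_antisymm (essPullbackDist_le hQ one_pos fun δ hδ _ ρ _ _ η _ => ?_) bot_le
  refine ⟨ContinuousMap.const _ x, ⟨⟨0, LipschitzWith.const x⟩, Metric.mem_closedBall_self hδ.le,
    Metric.mem_closedBall_self hδ.le⟩, ?_, ?_⟩
  · rw [lineIntegral_const (x := x) fun _ => rfl]
    exact ENNReal.zero_ne_top
  · have : length (fun t => f (ContinuousMap.const unitInterval x t)) = 0 :=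
      eVariationOn.constant_on (by rintro _ ⟨_, -, rfl⟩ _ ⟨_, -, rfl⟩; rfl)
    rw [this]
    exact bot_le

theorem essPullbackDist_symm_le (hQ : 0 < Q) (x y : X) :
    essPullbackDist μ Q f x y ≤ essPullbackDist μ Q f y x := by
  by_cases hd : essPullbackDist μ Q f y x = ⊤
  · rw [hd]; exact le_top
  refine essPullbackDist_le hQ one_pos fun δ hδ _ ρ hρ hρi η hη => ?_
  obtain ⟨γ, ⟨hL, h0, h1⟩, hγρ, hγl⟩ := exists_curve_of_essPullbackDist hQ hd hδ hρ hρi hη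
  refine ⟨reverse γ, ⟨lipschitz_reverse hL, ?_, ?_⟩, ?_, ?_⟩
  · simpa [reverse_apply] using h1
  · simpa [reverse_apply] using h0
  · rwa [lineIntegral_reverse]
  · exact (length_symm fun t => f (γ t)).trans_le hγl

theorem exists_mem_closedBall_notMem (hμ : BallsPosFinite μ) {N : Set X} (hN : μ N = 0) (x : X)
    {δ : ℝ} (hδ : 0 < δ) : ∃ y ∈ Metric.closedBall x δ, y ∉ N := by
  by_contra! hcon
  exact (hμ x δ hδ).1.ne' (measure_mono_null
    (Metric.ball_subset_closedBall.trans fun y hy => hcon y hy) hN)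

variable [ProperSpace X] [BorelSpace X] {Cμ CP σ c : ℝ}

/-- The constant of the Hölder estimate for the essential pull-back distance. -/
noncomputable def pullbackConst (p Q Cμ c CP σ : ℝ) : ℝ≥0∞ :=
  curveConst p Q Cμ c CP * 8 ^ (1 - Q / p) * ENNReal.ofReal (2 * (5 * σ)) ^ (Q / p)

theorem curveConst_ne_top (hc : 0 < c) (hQ : 0 < Q) (hp : Q < p) :
    curveConst p Q Cμ c CP ≠ ⊤ :=
  ENNReal.mul_ne_top (ENNReal.mul_ne_top ENNReal.ofNat_ne_top ENNReal.ofReal_ne_top)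
    (morreyConst_ne_top hc hQ hp)

theorem pullbackConst_ne_top (hc : 0 < c) (hQ : 0 < Q) (hp : Q < p) :
    pullbackConst p Q Cμ c CP σ ≠ ⊤ := by
  have hp0 := hQ.trans hp
  have ht : 0 < 1 - Q / p := by rw [sub_pos, div_lt_one hp0]; exact hp
  exact ENNReal.mul_ne_top (ENNReal.mul_ne_top (curveConst_ne_top hc hQ hp)
    (ENNReal.rpow_ne_top_of_nonneg ht.le ENNReal.ofNat_ne_top))
    (ENNReal.rpow_ne_top_of_nonneg (by positivity) ENNReal.ofReal_ne_top)

/-- The Hölder estimate for the essential pull-back distance. -/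
theorem essPullbackDist_le_holder (hμ : BallsPosFinite μ) (hQ : 1 ≤ Q)
    (hp : Q < p) (hCμ : 1 ≤ Cμ) (hc : 0 < c) (hσ : 1 ≤ σ) (hd : DoublingWith Cμ μ)
    (hV : RelVolumeBound c Q μ) (hP : PoincareWith Q CP σ μ) {g ρ₁ : X → ℝ≥0∞} (hg : Measurable g)
    (hρ₁ : Measurable ρ₁) (hρ₁i : ∫⁻ z, ρ₁ z ^ p ∂μ ≠ ⊤)
    (hfg : ∀ γ : Curve X, lineIntegral γ ρ₁ ≠ ⊤ →
      edist (f (γ 0)) (f (γ 1)) ≤ lineIntegral γ g) {x₀ : X} {r : ℝ} (hr : 0 < r)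
    (hgi : ∫⁻ z in Metric.ball x₀ (5 * σ * r), g z ^ p ∂μ ≠ ⊤)
    {x y : X} (hx : x ∈ Metric.ball x₀ r) (hy : y ∈ Metric.ball x₀ r) :
    essPullbackDist μ Q f x y ≤ pullbackConst p Q Cμ c CP σ *
      Metric.ediam (Metric.ball x₀ r) ^ (Q / p) * edist x y ^ (1 - Q / p) *
        (⨍⁻ z in Metric.ball x₀ (5 * σ * r), g z ^ p ∂μ) ^ (1 / p) := by
  have hQ0 : 0 < Q := by linarith
  have hp0 : 0 < p := by linarith
  have ht : 0 < 1 - Q / p := by rw [sub_pos, div_lt_one hp0]; exact hp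
  have := hP.preconnectedSpace hQ0 hμ
  by_cases hxy : x = y
  · subst hxy
    rw [essPullbackDist_self hQ0]
    exact bot_le
  have hD : 0 < dist x y := dist_pos.2 hxy
  set R := 5 * σ * r with hR
  have hR0 : 0 < R := by positivity
  rw [Metric.mem_ball] at hx hy
  -- Endpoints moved by at most `δ₀` stay in the ball, and their distance is at most `2 * dist x y`.
  refine essPullbackDist_le hQ0 (δ₀ := min (dist x y / 2) (min ((r - dist x x₀) / 2)
    ((r - dist y x₀) / 2))) (lt_min (by positivity) (lt_min (by linarith) (by linarith)))
    fun δ hδ hδ₀ ρ hρ hρi η hη => ?_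
  have hδ1 : δ ≤ dist x y / 2 := hδ₀.trans (min_le_left _ _)
  have hδ2 : δ ≤ (r - dist x x₀) / 2 := hδ₀.trans ((min_le_right _ _).trans (min_le_left _ _))
  have hδ3 : δ ≤ (r - dist y x₀) / 2 := hδ₀.trans ((min_le_right _ _).trans (min_le_right _ _))
  -- `ρ₁` is only `p`-integrable, but `ρ₁ ^ Q ≤ 1 + ρ₁ ^ p` and the ball has finite measure.
  have hρ₁i' : ∫⁻ z in Metric.ball x₀ R, ρ₁ z ^ Q ∂μ ≠ ⊤ := by
    refine ne_top_of_le_ne_top (b := ∫⁻ z in Metric.ball x₀ R, (1 + ρ₁ z ^ p) ∂μ) ?_ ?_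
    · rw [lintegral_add_left measurable_const, lintegral_one, Measure.restrict_apply_univ]
      exact ENNReal.add_ne_top.2 ⟨(hμ x₀ R hR0).2.ne,
        ne_top_of_le_ne_top hρ₁i (setLIntegral_le_lintegral _ _)⟩
    · refine lintegral_mono fun z => ?_
      rcases le_total (ρ₁ z) 1 with h | h
      · exact (ENNReal.rpow_le_one h hQ0.le).trans le_self_add
      · exact (ENNReal.rpow_le_rpow_of_exponent_le h hp.le).trans le_add_self
  obtain ⟨N, -, hN0, hN⟩ := exists_null_forall_exists_curve hμ hQ hp hCμ hc hσ hd hV hP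
    (hρ.max hρ₁) x₀ hR0 (lintegral_max_rpow_ne_top hρ
      (ne_top_of_le_ne_top hρi (setLIntegral_le_lintegral _ _)) hρ₁i')
  obtain ⟨x', hx', hx'N⟩ := exists_mem_closedBall_notMem hμ hN0 x hδ
  obtain ⟨y', hy', hy'N⟩ := exists_mem_closedBall_notMem hμ hN0 y hδ
  have hx'd : dist x' x₀ < r := by
    have := dist_triangle x' x x₀
    rw [Metric.mem_closedBall] at hx'
    linarith
  have hy'd : dist y' x₀ < r := by
    have := dist_triangle y' y x₀
    rw [Metric.mem_closedBall] at hy'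
    linarith
  have hD'r : dist x' y' < 2 * r := by
    have := dist_triangle_right x' y' x₀
    linarith
  have hD' : dist x' y' ≤ 2 * dist x y := by
    have := dist_triangle4 x' x y y'
    rw [Metric.mem_closedBall] at hx'
    rw [Metric.mem_closedBall'] at hy'
    linarith
  -- Since `dist x' y' < 2 * r`, the dilated balls lie within distance `4σr + r ≤ 5σr` of `x₀`; this
  -- fixes the factor `5 * σ`.
  obtain ⟨γ, hγL, hγ0, hγ1, hγρ, hγg⟩ := hN g hg hgi x' hx'N y' hy'N
    (Metric.ball_subset_ball' (by rw [hR]; nlinarith))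
    (Metric.ball_subset_ball' (by rw [hR]; nlinarith)) η hη
  refine ⟨γ, ⟨hγL, hγ0 ▸ hx', hγ1 ▸ hy'⟩,
    ne_top_of_le_ne_top hγρ (lineIntegral_mono γ fun z => le_max_left _ _), ?_⟩
  refine (length_comp_le_of_weak hfg (ne_top_of_le_ne_top hγρ
    (lineIntegral_mono γ fun z => le_max_right _ _))).trans (hγg.trans ?_)
  refine add_le_add (mul_le_mul_left ?_ _) le_rfl
  have h1 : ENNReal.ofReal (4 * dist x' y') ≤ 8 * edist x y := by
    rw [edist_dist, ← ENNReal.ofReal_ofNat 8, ← ENNReal.ofReal_mul (by norm_num)]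
    exact ENNReal.ofReal_le_ofReal (by linarith)
  have h2 : Metric.ediam (Metric.ball x₀ R) ≤
      ENNReal.ofReal (2 * (5 * σ)) * Metric.ediam (Metric.ball x₀ r) :=
    ediam_ball_mul_le x₀ hr (by linarith)
  calc curveConst p Q Cμ c CP * ENNReal.ofReal (4 * dist x' y') ^ (1 - Q / p) *
      Metric.ediam (Metric.ball x₀ R) ^ (Q / p)
      ≤ curveConst p Q Cμ c CP * (8 * edist x y) ^ (1 - Q / p) *
        (ENNReal.ofReal (2 * (5 * σ)) * Metric.ediam (Metric.ball x₀ r)) ^ (Q / p) := by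
        gcongr
    _ = _ := by
        rw [ENNReal.mul_rpow_of_nonneg _ _ ht.le, ENNReal.mul_rpow_of_nonneg _ _ (by positivity),
          pullbackConst]
        ring

theorem essPullbackDist_lt_top (hμ : BallsPosFinite μ) (hQ : 1 ≤ Q)
    (hp : Q < p) (hCμ : 1 ≤ Cμ) (hc : 0 < c) (hσ : 1 ≤ σ) (hd : DoublingWith Cμ μ)
    (hV : RelVolumeBound c Q μ) (hP : PoincareWith Q CP σ μ) (hf : MemLocNewtonian μ p f)
    (x y : X) : essPullbackDist μ Q f x y < ⊤ := by
  have hQ0 : 0 < Q := by linarith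
  have hp0 : 0 < p := by linarith
  have ht : 0 < 1 - Q / p := by rw [sub_pos, div_lt_one hp0]; exact hp
  have hr : 0 < dist x y + 1 := by positivity
  obtain ⟨g, hg, hgi, hfg⟩ := hf.exists_upperGradient hp0 x (5 * σ * (dist x y + 1))
  refine (essPullbackDist_le_holder hμ hQ hp hCμ hc hσ hd hV hP hg
    (ρ₁ := fun _ => 0) measurable_const (by simp [hp0]) (fun γ _ => hfg γ)
    (x₀ := x) hr hgi (Metric.mem_ball_self hr)
    (by rw [Metric.mem_ball']; linarith)).trans_lt (lt_top_iff_ne_top.2 ?_)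
  refine ENNReal.mul_ne_top (ENNReal.mul_ne_top (ENNReal.mul_ne_top
    (pullbackConst_ne_top hc hQ0 hp) ?_) ?_) ?_
  · exact ENNReal.rpow_ne_top_of_nonneg (by positivity)
      (ne_top_of_le_ne_top ENNReal.ofReal_ne_top (ediam_ball_le_ofReal _ _))
  · exact ENNReal.rpow_ne_top_of_nonneg ht.le (edist_ne_top _ _)
  · refine ENNReal.rpow_ne_top_of_nonneg (by positivity) ?_
    rw [setLAverage_eq]
    exact (ENNReal.div_lt_top hgi (hμ x _ (by positivity)).1.ne').ne

/-- The triangle inequality for the essential pull-back distance. -/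
theorem essPullbackDist_triangle (hμ : BallsPosFinite μ) (hQ : 1 ≤ Q)
    (hp : Q < p) (hCμ : 1 ≤ Cμ) (hc : 0 < c) (hσ : 1 ≤ σ) (hd : DoublingWith Cμ μ)
    (hV : RelVolumeBound c Q μ) (hP : PoincareWith Q CP σ μ) (hf : MemLocNewtonian μ p f)
    (x y z : X) : essPullbackDist μ Q f x z ≤
      essPullbackDist μ Q f x y + essPullbackDist μ Q f y z := by
  have hQ0 : 0 < Q := by linarith
  have hp0 : 0 < p := by linarith
  have ht : 0 < 1 - Q / p := by rw [sub_pos, div_lt_one hp0]; exact hp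
  by_cases hxy : x = y
  · subst hxy
    exact le_add_self
  by_cases hyz : y = z
  · subst hyz
    exact le_self_add
  have hxyt := (essPullbackDist_lt_top hμ hQ hp hCμ hc hσ hd hV hP hf x y).ne
  have hyzt := (essPullbackDist_lt_top hμ hQ hp hCμ hc hσ hd hV hP hf y z).ne
  have hR : 0 < 5 * σ := by linarith
  obtain ⟨g, hg, hgi, hfg⟩ := hf.exists_upperGradient hp0 y (5 * σ)
  refine essPullbackDist_le hQ0 one_pos fun δ hδ _ ρ hρ hρi η hη => ?_
  obtain ⟨N, hNm, hN0, hN⟩ := exists_null_forall_exists_curve hμ hQ hp hCμ hc hσ hd hV hP hρ y hR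
    (ne_top_of_le_ne_top hρi (setLIntegral_le_lintegral _ _))
  set E := Metric.ediam (Metric.ball y (5 * σ))
  set I := ⨍⁻ w in Metric.ball y (5 * σ), g w ^ p ∂μ with hI
  -- Morrey's bound tends to zero with the distance of the points, so any two good points of `B(y,
  -- s)` are joined by a curve with short image.
  obtain ⟨s, ⟨hs0, hs1⟩, hsη⟩ : ∃ s ∈ Ioc (0 : ℝ) 1, curveConst p Q Cμ c CP *
      ENNReal.ofReal (4 * (2 * s)) ^ (1 - Q / p) * E ^ (Q / p) * I ^ (1 / p) ≤
        ENNReal.ofReal (η / 4) := by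
    have hlim : Tendsto (fun s : ℝ => curveConst p Q Cμ c CP *
        ENNReal.ofReal (4 * (2 * s)) ^ (1 - Q / p) * E ^ (Q / p) * I ^ (1 / p)) (𝓝 0)
        (𝓝 (curveConst p Q Cμ c CP * 0 * E ^ (Q / p) * I ^ (1 / p))) := by
      refine ENNReal.Tendsto.mul_const (ENNReal.Tendsto.mul_const (ENNReal.Tendsto.const_mul ?_
        (Or.inr (curveConst_ne_top hc hQ0 hp))) (Or.inr ?_)) (Or.inr ?_)
      · have : Continuous fun s : ℝ => ENNReal.ofReal (4 * (2 * s)) ^ (1 - Q / p) :=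
          ENNReal.continuous_rpow_const.comp (ENNReal.continuous_ofReal.comp (by fun_prop))
        simpa [ht] using this.tendsto 0
      · exact ENNReal.rpow_ne_top_of_nonneg (by positivity)
          (ne_top_of_le_ne_top ENNReal.ofReal_ne_top (ediam_ball_le_ofReal _ _))
      · refine ENNReal.rpow_ne_top_of_nonneg (by positivity) ?_
        rw [hI, setLAverage_eq]
        exact (ENNReal.div_lt_top hgi (hμ y _ hR).1.ne').ne
    rw [mul_zero, zero_mul, zero_mul] at hlim
    have hev := (hlim.mono_left (nhdsWithin_le_nhds (s := Ioi 0))).eventually_le_const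
      (show (0 : ℝ≥0∞) < ENNReal.ofReal (η / 4) by simpa using hη)
    obtain ⟨s, hs, hs'⟩ := (hev.and (Ioc_mem_nhdsGT one_pos)).exists
    exact ⟨s, hs', hs⟩
  have hxy0 := dist_pos.2 hxy
  have hyz0 := dist_pos.2 hyz
  -- The bound `s / 2` puts the relevant endpoints into `B(y, s)`; the thirds make the endpoints of
  -- each curve distinct.
  set δ' := min (min δ (s / 2)) (min (dist x y / 3) (dist y z / 3)) with hδ'
  have hδ'0 : 0 < δ' := lt_min (lt_min hδ (by positivity)) (lt_min (by positivity) (by positivity))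
  have hδ'δ : δ' ≤ δ := (min_le_left _ _).trans (min_le_left _ _)
  have hδ's : δ' ≤ s / 2 := (min_le_left _ _).trans (min_le_right _ _)
  have hδ'x : δ' ≤ dist x y / 3 := (min_le_right _ _).trans (min_le_left _ _)
  have hδ'z : δ' ≤ dist y z / 3 := (min_le_right _ _).trans (min_le_right _ _)
  -- The value `∞` on the null set `N` leaves the integral finite and forces the two curves to visit
  -- points of `B(y, s)` outside `N`.
  have hρ' : Measurable fun w => max (ρ w) (N.indicator (fun _ => ⊤) w) :=
    hρ.max (measurable_const.indicator hNm)
  have hρ'i : ∫⁻ w, max (ρ w) (N.indicator (fun _ => ⊤) w) ^ Q ∂μ ≠ ⊤ := by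
    refine lintegral_max_rpow_ne_top hρ hρi ?_
    have : (fun w => N.indicator (fun _ => (⊤ : ℝ≥0∞)) w ^ Q) = N.indicator fun _ => ⊤ := by
      ext w
      by_cases hw : w ∈ N <;> simp [hw, hQ0]
    rw [this, lintegral_indicator hNm, setLIntegral_const, hN0, mul_zero]
    exact ENNReal.zero_ne_top
  have hρ'N : ∀ w ∈ N, max (ρ w) (N.indicator (fun _ => ⊤) w) = ⊤ := fun w hw => by
    rw [indicator_of_mem hw]; exact max_eq_right le_top
  have hρρ' : ∀ w, ρ w ≤ max (ρ w) (N.indicator (fun _ => ⊤) w) := fun w => le_max_left _ _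
  have hη4 : 0 < η / 4 := by positivity
  obtain ⟨γ₁, ⟨hL₁, h10, h11⟩, hρ₁, hl₁⟩ :=
    exists_curve_of_essPullbackDist hQ0 hxyt hδ'0 hρ' hρ'i hη4
  obtain ⟨γ₂, ⟨hL₂, h20, h21⟩, hρ₂, hl₂⟩ :=
    exists_curve_of_essPullbackDist hQ0 hyzt hδ'0 hρ' hρ'i hη4
  rw [Metric.mem_closedBall] at h10 h11 h20 h21
  have hne₁ : γ₁ 0 ≠ γ₁ 1 := by
    intro h
    rw [← h] at h11
    linarith [dist_triangle_left x y (γ₁ 0)]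
  have hne₂ : γ₂ 0 ≠ γ₂ 1 := by
    intro h
    rw [← h] at h21
    linarith [dist_triangle_left y z (γ₂ 0)]
  obtain ⟨t₁, ht₁, ht₁N⟩ := exists_mem_diff_of_lineIntegral hne₁ (U := Metric.ball y s)
    Metric.isOpen_ball (t₀ := 1) (Metric.mem_ball.2 (by linarith)) hρ'N hρ₁
  obtain ⟨t₂, ht₂, ht₂N⟩ := exists_mem_diff_of_lineIntegral hne₂ (U := Metric.ball y s)
    Metric.isOpen_ball (t₀ := 0) (Metric.mem_ball.2 (by linarith)) hρ'N hρ₂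
  rw [Metric.mem_ball] at ht₁ ht₂
  have hd12 : dist (γ₁ t₁) (γ₂ t₂) ≤ 2 * s := by
    linarith [dist_triangle_right (γ₁ t₁) (γ₂ t₂) y]
  have hd0 : 0 ≤ dist (γ₁ t₁) (γ₂ t₂) := dist_nonneg
  obtain ⟨γ₃, hL₃, h30, h31, hρ₃, hg₃⟩ := hN g hg hgi (γ₁ t₁) ht₁N (γ₂ t₂) ht₂N
    (Metric.ball_subset_ball' (by nlinarith)) (Metric.ball_subset_ball' (by nlinarith)) (η / 4) hη4
  have hl₃ : length (fun r => f (γ₃ r)) ≤ ENNReal.ofReal (η / 4) + ENNReal.ofReal (η / 4) := by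
    refine (length_comp_le_of_weak (fun γ _ => hfg γ) hρ₃).trans (hg₃.trans ?_)
    gcongr
    refine le_trans ?_ hsη
    gcongr
  have h0t₁ : (0 : unitInterval) ≤ t₁ := t₁.2.1
  have ht₂1 : t₂ ≤ (1 : unitInterval) := t₂.2.2
  have e1 : subcurve γ₁ 0 t₁ 1 = γ₃ 0 := by rw [subcurve_one, h30]
  have e2 : concat (subcurve γ₁ 0 t₁) γ₃ e1 1 = subcurve γ₂ t₂ 1 0 := by
    rw [concat_one, h31, subcurve_zero]
  -- The first curve is followed to its good point near `y`, then the bridge, then the rest of the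
  -- second. Each outer piece has an error of `η / 4`, the bridge one of `η / 2`.
  refine ⟨concat (concat (subcurve γ₁ 0 t₁) γ₃ e1) (subcurve γ₂ t₂ 1) e2, ⟨?_, ?_, ?_⟩, ?_, ?_⟩
  · exact lipschitz_concat _ (lipschitz_concat _ (lipschitz_subcurve hL₁ _ _) hL₃)
      (lipschitz_subcurve hL₂ _ _)
  · rw [concat_zero, concat_zero, subcurve_zero]
    exact Metric.mem_closedBall.2 (h10.trans hδ'δ)
  · rw [concat_one, subcurve_one]
    exact Metric.mem_closedBall.2 (h21.trans hδ'δ)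
  · rw [lineIntegral_concat, lineIntegral_concat]
    refine ENNReal.add_ne_top.2 ⟨ENNReal.add_ne_top.2 ⟨?_, hρ₃⟩, ?_⟩
    · exact ne_top_of_le_ne_top hρ₁ ((lineIntegral_subcurve_le
        (length_ne_top_of_lipschitz hL₁) h0t₁ _).trans (lineIntegral_mono _ hρρ'))
    · exact ne_top_of_le_ne_top hρ₂ ((lineIntegral_subcurve_le
        (length_ne_top_of_lipschitz hL₂) ht₂1 _).trans (lineIntegral_mono _ hρρ'))
  · rw [length_comp_concat, length_comp_concat]
    have hη' : ENNReal.ofReal η = ENNReal.ofReal (η / 4) + ENNReal.ofReal (η / 4) +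
        ENNReal.ofReal (η / 4) + ENNReal.ofReal (η / 4) := by
      rw [← ENNReal.ofReal_add (by positivity) (by positivity),
        ← ENNReal.ofReal_add (by positivity) (by positivity),
        ← ENNReal.ofReal_add (by positivity) (by positivity)]
      congr 1; ring
    calc _ ≤ essPullbackDist μ Q f x y + ENNReal.ofReal (η / 4) +
          (ENNReal.ofReal (η / 4) + ENNReal.ofReal (η / 4)) +
          (essPullbackDist μ Q f y z + ENNReal.ofReal (η / 4)) :=
          add_le_add (add_le_add ((length_subcurve_le h0t₁).trans hl₁) hl₃)
            ((length_subcurve_le ht₂1).trans hl₂)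
      _ = _ := by rw [hη']; ring

end PullbackDistance

end EssPullback

/-! ### The proposition. -/

theorem mainTheorem10 (p Q Cμ c CP σ : ℝ) (hQ : 1 ≤ Q) (hp : Q < p) (hCμ : 1 ≤ Cμ)
    (hc : 0 < c) (hCP : 1 ≤ CP) (hσ : 1 ≤ σ) :
    ∃ C σ' : ℝ, 1 ≤ C ∧ 1 ≤ σ' ∧
      ∀ (X : Type*) [MetricSpace X] [ProperSpace X] [MeasurableSpace X] [BorelSpace X]
        (μ : Measure X) (Y : Type*) [MetricSpace Y] [ProperSpace Y] (u : X → Y),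
        EssPullback.BallsPosFinite μ →
        EssPullback.DoublingWith Cμ μ →
        EssPullback.RelVolumeBound c Q μ →
        EssPullback.PoincareWith Q CP σ μ →
        EssPullback.MemLocNewtonian μ p u →
        ((∀ x y, EssPullback.essPullbackDist μ Q u x y < ⊤) ∧
          (∀ x, EssPullback.essPullbackDist μ Q u x x = 0) ∧
          (∀ x y, EssPullback.essPullbackDist μ Q u x y =
            EssPullback.essPullbackDist μ Q u y x) ∧
          (∀ x y z, EssPullback.essPullbackDist μ Q u x z ≤
            EssPullback.essPullbackDist μ Q u x y + EssPullback.essPullbackDist μ Q u y z)) ∧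
        ∀ g : X → ℝ≥0∞, EssPullback.IsMinimalWeakUpperGradient μ p u g →
          ∀ (x₀ : X) (r : ℝ), 0 < r → ∀ x ∈ Metric.ball x₀ r, ∀ y ∈ Metric.ball x₀ r,
            EssPullback.essPullbackDist μ Q u x y ≤
              ENNReal.ofReal C * Metric.ediam (Metric.ball x₀ r) ^ (Q / p) *
                edist x y ^ (1 - Q / p) *
                (⨍⁻ z in Metric.ball x₀ (σ' * r), g z ^ p ∂μ) ^ (1 / p) := by
  have hQ0 : 0 < Q := by linarith
  have hp0 : 0 < p := by linarith
  refine ⟨max 1 (EssPullback.pullbackConst p Q Cμ c CP σ).toReal, 5 * σ, le_max_left _ _,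
    by linarith, ?_⟩
  intro X _ _ _ _ μ Y _ _ u hμ hd hV hP hu
  refine ⟨⟨EssPullback.essPullbackDist_lt_top hμ hQ hp hCμ hc hσ hd hV hP hu,
    EssPullback.essPullbackDist_self hQ0,
    fun x y => le_antisymm (EssPullback.essPullbackDist_symm_le hQ0 x y)
      (EssPullback.essPullbackDist_symm_le hQ0 y x),
    EssPullback.essPullbackDist_triangle hμ hQ hp hCμ hc hσ hd hV hP hu⟩, ?_⟩
  rintro g ⟨⟨hg, Γ₀, hΓ₀, hug⟩, hgloc, -⟩ x₀ r hr x hx y hy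
  -- The exceptional family of the weak upper gradient has `p`-modulus zero, so it is encoded by a
  -- `p`-integrable function.
  obtain ⟨ρ₁, hρ₁, hρ₁i, hρ₁Γ⟩ := EssPullback.exists_lineIntegral_eq_top_of_modulus hp0 hΓ₀
  refine (EssPullback.essPullbackDist_le_holder hμ hQ hp hCμ hc hσ hd hV hP hg hρ₁ hρ₁i
    (fun γ hγ => hug γ fun h => hγ (hρ₁Γ γ h)) hr ?_ hx hy).trans ?_
  · exact ne_top_of_le_ne_top (hgloc.lintegral_ne_top (isCompact_closedBall x₀ (5 * σ * r)))
      (lintegral_mono_set Metric.ball_subset_closedBall)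
  · gcongr
    exact (ENNReal.ofReal_toReal (EssPullback.pullbackConst_ne_top hc hQ0 hp)).symm.trans_le
      (ENNReal.ofReal_le_ofReal (le_max_right _ _))
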